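/- For an integer $q\ge 0$ let $\mathbb H^q$ be the space of $q$-tuples of quaternions, regarded as a complex vector space by left multiplication by $\mathbb C\subset\mathbb H$, and let $\mathbf j$ be left multiplication by the quaternion $j$. Let $\ell\to\mathbb P_{\mathbb C}(\mathbb H^q)$ be the tautological complex line bundle, $\mathcal O(2)=\operatorname{Hom}(\ell\otimes\ell,\mathbb C)$, and let $Q(\mathbb H^q)$ be the Thom space of $\mathcal O(2)$, that is, the one-point compactification of its total space (a single point if $q=0$). Let $\mathbb Z_2$ act on $Q(\mathbb H^q)$ by the involution that fixes $\infty$ and sends a linear form $h$ on $\ell_x\otimes\ell_x$ to the linear form $\mathbf jv\otimes\mathbf jw\mapsto\overline{h(v\otimes w)}$ on $\ell_{\mathbf jx}\otimes\ell_{\mathbf jx}$. Then, for every integer $n\ge 0$, the integral singular homology of the quotient space $Q(\mathbb H^q)/\mathbb Z_2$ is $$ H_n\bigl(Q(\mathbb H^q)/\mathbb Z_2;\,\mathbb Z\bigr)\cong\begin{cases} \mathbb Z & \text{if } n\equiv 0 \pmod 4 \text{ and } n\le 4q,\\ \mathbb Z/2 & \text{if } n\equiv 2 \pmod 4 \text{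 and } n\le 4q-2,\\ 0 & \text{otherwise.} \end{cases} $$ -/

import Mathlib

open CategoryTheory AlgebraicTopology

noncomputable section

namespace QuatThom

/-- The quaternionic vector space `ℍ^q`. Quaternions act by coordinatewise left multiplication;
complex scalars act through the inclusion `ℂ ⊂ ℍ` given by `a + b i ↦ a + b i`. -/
abbrev HSpace (q : ℕ) : Type := Fin q → Quaternion ℝ

/-- The quaternion `j`. -/
def quatJ : Quaternion ℝ := ⟨0, 0, 1, 0⟩

lemma quatJ_mul_self : quatJ * quatJ = -1 := by
  apply Quaternion.ext <;>
    simp only [Quaternion.re_mul, Quaternion.imI_mul, Quaternion.imJ_mul, Quaternion.imK_mul,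
      Quaternion.re_neg, Quaternion.imI_neg, Quaternion.imJ_neg, Quaternion.imK_neg,
      Quaternion.re_one, Quaternion.imI_one, Quaternion.imJ_one, Quaternion.imK_one] <;>
    simp [quatJ]

lemma quatJ_ne_zero : quatJ ≠ 0 := fun h => by
  have h1 : quatJ.imJ = (0 : Quaternion ℝ).imJ := congrArg _ h
  rw [Quaternion.imJ_zero] at h1
  exact one_ne_zero h1

lemma quatJ_mul_coe (z : ℂ) :
    quatJ * (z : Quaternion ℝ) = ((starRingEnd ℂ z : ℂ) : Quaternion ℝ) * quatJ := by
  apply Quaternion.ext <;>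
    simp only [Quaternion.re_mul, Quaternion.imI_mul, Quaternion.imJ_mul, Quaternion.imK_mul,
      Quaternion.re_coeComplex, Quaternion.imI_coeComplex, Quaternion.imJ_coeComplex,
      Quaternion.imK_coeComplex] <;>
    simp [quatJ]

/-- The nonzero vectors of `ℍ^q`. -/
abbrev NonzeroVec (q : ℕ) : Type := {v : HSpace q // v ≠ 0}

/-- The relation `(v, c) ∼ (z v, z² c)`, for `z ∈ ℂ^×`, on `(ℍ^q ∖ 0) × ℂ`. -/
def o2Setoid (q : ℕ) : Setoid (NonzeroVec q × ℂ) where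
  r a b := ∃ z : ℂ, z ≠ 0 ∧ b.1.1 = (z : Quaternion ℝ) • a.1.1 ∧ b.2 = z ^ 2 * a.2
  iseqv :=
    { refl := fun a => ⟨1, one_ne_zero, by simp, by simp⟩
      symm := by
        rintro a b ⟨z, hz, h1, h2⟩
        refine ⟨z⁻¹, inv_ne_zero hz, ?_, ?_⟩
        · rw [h1, smul_smul, ← Quaternion.coeComplex_mul, inv_mul_cancel₀ hz]
          simp
        · rw [h2]
          field_simp
      trans := by
        rintro a b c ⟨z, hz, h1, h2⟩ ⟨w, hw, h3, h4⟩
        refine ⟨w * z, mul_ne_zero hw hz, ?_, ?_⟩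
        · rw [h3, h1, smul_smul, Quaternion.coeComplex_mul]
        · rw [h4, h2]
          ring }

/-- The total space of the holomorphic line bundle `𝒪(2) = Hom(ℓ ⊗ ℓ, ℂ)` over `P_ℂ(ℍ^q)`,
where `ℓ` is the tautological line bundle, as the associated bundle `(ℍ^q ∖ 0) ×_{ℂ^×} ℂ`
with the quotient topology. The class `[v, c]` is the linear form on `ℓ ⊗ ℓ`, `ℓ = ℂ v`, that
takes the value `c` at `v ⊗ v`; it lies over the point `[v]` of `P_ℂ(ℍ^q)`. -/
def O2 (q : ℕ) : Type := Quotient (o2Setoid q)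

instance (q : ℕ) : TopologicalSpace (O2 q) :=
  inferInstanceAs (TopologicalSpace (Quotient (o2Setoid q)))

/-- Left multiplication by `j` on the nonzero vectors. -/
def jVec {q : ℕ} (v : NonzeroVec q) : NonzeroVec q :=
  ⟨quatJ • v.1, smul_ne_zero quatJ_ne_zero v.2⟩

/-- The antilinear bundle map of `𝒪(2)` induced by multiplication by `j`: a form `h` on `ℓ ⊗ ℓ`
goes to the form `conj ∘ h ∘ (j ⊗ j)⁻¹` on `jℓ ⊗ jℓ`, that is `[v, c] ↦ [j v, conj c]`. -/
def o2Conj {q : ℕ} : O2 q → O2 q :=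
  Quotient.map (sa := o2Setoid q) (sb := o2Setoid q)
    (fun a => (jVec a.1, starRingEnd ℂ a.2)) (by
      rintro a b ⟨z, hz, h1, h2⟩
      refine ⟨starRingEnd ℂ z, by simpa using hz, ?_, ?_⟩
      · simp only [jVec]
        rw [h1, smul_smul, smul_smul, quatJ_mul_coe]
      · simp [h2])

lemma o2Conj_o2Conj {q : ℕ} (x : O2 q) : o2Conj (o2Conj x) = x := by
  induction x using Quotient.inductionOn with
  | h a =>
    refine Quotient.sound (s := o2Setoid q) ⟨-1, by simp, ?_, by simp⟩
    have h1 : ((-1 : ℂ) : Quaternion ℝ) = -1 := by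
      rw [← map_one Quaternion.ofComplex, ← map_neg]
      rfl
    simp [jVec, smul_smul, quatJ_mul_self, h1]

/-- `Q(ℍ^q)`, the Thom space of `𝒪(2)` over `P_ℂ(ℍ^q)`: since the base is compact, it is the
one-point compactification of the total space. -/
abbrev Q (q : ℕ) : Type := OnePoint (O2 q)

/-- The real structure of `Q(ℍ^q)`: the extension of the antilinear bundle map that fixes `∞`. -/
def realStr {q : ℕ} : Q q → Q q := OnePoint.map o2Conj

lemma realStr_realStr {q : ℕ} (x : Q q) : realStr (realStr x) = x := by
  induction x using OnePoint.rec with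
  | infty => simp [realStr]
  | coe x => simp [realStr, o2Conj_o2Conj]

/-- The orbit relation of the `ℤ/2`-action on `Q(ℍ^q)` generated by the real structure. -/
def orbitSetoid (q : ℕ) : Setoid (Q q) where
  r x y := y = x ∨ y = realStr x
  iseqv :=
    { refl := fun _ => Or.inl rfl
      symm := by
        rintro x y (rfl | rfl)
        · exact Or.inl rfl
        · exact Or.inr (realStr_realStr x).symm
      trans := by
        rintro x y z (rfl | rfl) (rfl | rfl)
        · exact Or.inl rfl
        · exact Or.inr rfl
        · exact Or.inr rfl
        · exact Or.inl (realStr_realStr x) }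

/-- The orbit space `Y = Q(ℍ^q) / ℤ₂`, with the quotient topology. -/
def Y (q : ℕ) : Type := Quotient (orbitSetoid q)

instance (q : ℕ) : TopologicalSpace (Y q) :=
  inferInstanceAs (TopologicalSpace (Quotient (orbitSetoid q)))

/-- The singular homology group `H_n(X; ℤ)`. -/
abbrev integralHomology (n : ℕ) (X : Type) [TopologicalSpace X] : ModuleCat.{0} ℤ :=
  ((singularHomologyFunctor (ModuleCat.{0} ℤ) n).obj (ModuleCat.of ℤ ℤ)).obj (TopCat.of X)

end QuatThom

end

/-!
The orbit space `Y q` is the quotient of `(ℍ^q × ℂ) ∖ 0` by the group generated by `ℂ^×`, acting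
with weights `1` and `2`, and by `(v, c) ↦ (j v, conj c)`; the vectors with `v = 0` form the orbit
`∞` (`isOrbitMap_proj`, and `isOrbitMap_cproj` in the coordinates used below). Its homology is
computed by induction on `q`.

Write a point of `ℍ^(q+1) × ℂ` as `(a + b j, v, c)` with `a, b, c ∈ ℂ` and `v ∈ ℍ^q`, and consider
the following subsets of `Y (q + 1)`.

* `N`, where `(v, c) ≠ 0`. Shrinking `a + b j` to zero shows `N ≃ Y q` (`equiv_setN`).
* `V`, where `a b ≠ 0`. The only point outside `N ∪ V` is the class of `(1, 0, 0, 0)`, near which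
  the orbit space is a manifold of dimension `4 q + 4` (`chartEquiv`). So the homology of
  `Y (q + 1)` relative to `N ∪ V` is `ℤ` in degree `4 q + 4` and zero elsewhere
  (`homology_rel_compl`).
* `V0 ⊆ V`, where the real part of `c / (a b)` is nonzero. This real part is determined up to sign,
  because `j` sends `c / (a b)` to the negative of its conjugate.

On `V` the `4 q + 1` real coordinates of `(a + b j)⁻¹ v` and `Im (c / (a b))` can be translated
independently, so that the homology of `(N ∪ V, N)` is that of `(V, V0)` with degrees raised by
`4 q + 1` (`equiv_suspension`). The sets `V` and `V0` are homotopy equivalent to circles: the invariant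
of a point of `V` is the square of `u = b / a`, up to scaling, because `j` replaces `u` by a
negative multiple of itself, while on `V0` the product of `u` with the sign of `Re (c / (a b))`,
which `j` changes too, is an invariant. So the inclusion `V0 → V` has degree two (`circleEquivV0`,
`circleEquivV`), and the homology of `(N ∪ V, N)` is `ℤ/2` in degree `4 q + 2` and zero elsewhere
(`homology_of_squaring`, `homology_compl_rel`). As the homology of `Y q` vanishes above degree
`4 q`, the long exact sequences of `N ⊆ N ∪ V ⊆ Y (q + 1)` degenerate (`homology_orbit_space`).

Singular homology is handled through concrete chains in one ambient space: `Z n B A` and `Bd n B A`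
are the relative cycles and boundaries of a pair of subsets, `H n B A` is their quotient, and chains
are pushed forward along maps that need only be continuous on the subset in question. The comparison
with Mathlib is `nonempty_equiv_integralHomology`. Homotopy invariance and excision
(`homotopy_invariance`, `excision`) both come from one operator, `prism`, which triangulates a prism
over a simplex so that one end is barycentrically subdivided and the other is not.
-/

noncomputable section

namespace RelHom

/-! ### Affine chains -/

/-- The group of ordered affine chains in `E`: formal integer combinations of `n`-tuples of
vertices. An `n`-tuple spans an `(n - 1)`-simplex, so the complex is augmented by the empty tuple
in degree `0`. -/
abbrev LC (n : ℕ) (E : Type*) : Type _ := (Fin n → E) →₀ ℤ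

/-- The alternating sum of the faces of an affine chain. -/
def ld {E : Type*} (n : ℕ) : LC (n + 1) E →ₗ[ℤ] LC n E :=
  Finsupp.linearCombination ℤ fun v : Fin (n + 1) → E =>
    ∑ i : Fin (n + 1), (-1 : ℤ) ^ (i : ℕ) • Finsupp.single (fun k => v (i.succAbove k)) (1 : ℤ)

/-- The cone of an affine chain with apex `b`. -/
def cone {E : Type*} (b : E) (n : ℕ) : LC n E →ₗ[ℤ] LC (n + 1) E :=
  Finsupp.lmapDomain ℤ ℤ fun v : Fin n → E => (Fin.cons b v : Fin (n + 1) → E)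

/-- The image of an affine chain under a map of vertices. -/
def lmap {E F : Type*} (f : E → F) (n : ℕ) : LC n E →ₗ[ℤ] LC n F :=
  Finsupp.lmapDomain ℤ ℤ fun v : Fin n → E => f ∘ v

lemma ld_single {E : Type*} (n : ℕ) (v : Fin (n + 1) → E) :
    ld n (Finsupp.single v 1) = ∑ i : Fin (n + 1), (-1 : ℤ) ^ (i : ℕ) •
      Finsupp.single (fun k => v (i.succAbove k)) (1 : ℤ) := by
  simp [ld]

lemma cone_single {E : Type*} (b : E) (n : ℕ) (v : Fin n → E) (a : ℤ) :
    cone b n (Finsupp.single v a) = Finsupp.single (Fin.cons b v : Fin (n + 1) → E) a := by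
  simp [cone]

lemma lmap_single {E F : Type*} (f : E → F) (n : ℕ) (v : Fin n → E) (a : ℤ) :
    lmap f n (Finsupp.single v a) = Finsupp.single (f ∘ v) a := by
  simp [lmap]

lemma lin_ext {α M : Type*} [AddCommMonoid M] [Module ℤ M] {F G : (α →₀ ℤ) →ₗ[ℤ] M}
    (h : ∀ a, F (Finsupp.single a 1) = G (Finsupp.single a 1)) (x : α →₀ ℤ) : F x = G x := by
  have : F = G := by
    ext a
    simpa using h a
  rw [this]

lemma lmap_lmap {E F G : Type*} (f : E → F) (g : F → G) (n : ℕ) (x : LC n E) :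
    lmap g n (lmap f n x) = lmap (g ∘ f) n x := by
  refine lin_ext (F := lmap g n ∘ₗ lmap f n) (G := lmap (g ∘ f) n) (fun v => ?_) x
  simp [lmap_single, Function.comp_assoc]

lemma ld_lmap {E F : Type*} (f : E → F) (n : ℕ) (x : LC (n + 1) E) :
    ld n (lmap f (n + 1) x) = lmap f n (ld n x) := by
  refine lin_ext (F := ld n ∘ₗ lmap f (n + 1)) (G := lmap f n ∘ₗ ld n) (fun v => ?_) x
  simp only [LinearMap.comp_apply, lmap_single, ld_single, map_sum, map_smul]
  rfl

lemma lmap_cone {E F : Type*} (f : E → F) (b : E) (n : ℕ) (x : LC n E) :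
    lmap f (n + 1) (cone b n x) = cone (f b) n (lmap f n x) := by
  refine lin_ext (F := lmap f (n + 1) ∘ₗ cone b n) (G := cone (f b) n ∘ₗ lmap f n)
    (fun v => ?_) x
  simp only [LinearMap.comp_apply, lmap_single, cone_single]
  congr 1
  funext i
  refine Fin.cases ?_ (fun j => ?_) i <;> simp

lemma ld_cone_zero {E : Type*} (b : E) (x : LC 0 E) : ld 0 (cone b 0 x) = x := by
  refine lin_ext (F := ld 0 ∘ₗ cone b 0) (G := LinearMap.id) (fun v => ?_) x
  simp only [LinearMap.comp_apply, cone_single, ld_single, LinearMap.id_apply]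
  simp

lemma ld_cone {E : Type*} (b : E) (n : ℕ) (x : LC (n + 1) E) :
    ld (n + 1) (cone b (n + 1) x) = x - cone b n (ld n x) := by
  refine lin_ext (F := ld (n + 1) ∘ₗ cone b (n + 1)) (G := LinearMap.id - cone b n ∘ₗ ld n)
    (fun v => ?_) x
  simp only [LinearMap.comp_apply, cone_single, ld_single, LinearMap.id_apply, LinearMap.sub_apply,
    map_sum, map_smul]
  rw [Fin.sum_univ_succ, sub_eq_add_neg, ← Finset.sum_neg_distrib]
  congr 1
  · simp
  · refine Finset.sum_congr rfl fun i _ => ?_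
    rw [Fin.val_succ, pow_succ, mul_neg_one, neg_smul]
    congr 3
    funext k
    refine Fin.cases ?_ (fun j => ?_) k <;> simp

lemma ld_ld {E : Type*} (n : ℕ) (x : LC (n + 2) E) : ld n (ld (n + 1) x) = 0 := by
  induction n with
  | zero =>
    refine lin_ext (F := ld 0 ∘ₗ ld 1) (G := 0) (fun v => ?_) x
    have hv : Finsupp.single v (1 : ℤ) = cone (v 0) 1 (Finsupp.single (Fin.tail v) 1) := by
      rw [cone_single, Fin.cons_self_tail]
    rw [LinearMap.comp_apply, hv, ld_cone, map_sub, ld_cone_zero, sub_self]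
    rfl
  | succ n ih =>
    refine lin_ext (F := ld (n + 1) ∘ₗ ld (n + 2)) (G := 0) (fun v => ?_) x
    have hv : Finsupp.single v (1 : ℤ) = cone (v 0) (n + 2) (Finsupp.single (Fin.tail v) 1) := by
      rw [cone_single, Fin.cons_self_tail]
    rw [LinearMap.comp_apply, hv, ld_cone, map_sub, ld_cone, ih]
    simp

section Subdivision

variable {E F : Type*} [AddCommGroup E] [Module ℝ E] [AddCommGroup F] [Module ℝ F]

/-- The barycentre of a nonempty tuple of points. -/
def bary {n : ℕ} (v : Fin (n + 1) → E) : E := ((n + 1 : ℝ)⁻¹) • ∑ i, v i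

lemma map_bary (f : E →ₗ[ℝ] F) {n : ℕ} (v : Fin (n + 1) → E) : f (bary v) = bary (f ∘ v) := by
  simp [bary, map_sum]

lemma bary_mem {K : Set E} (hK : Convex ℝ K) {n : ℕ} {v : Fin (n + 1) → E} (hv : ∀ i, v i ∈ K) :
    bary v ∈ K := by
  rw [bary, Finset.smul_sum]
  refine hK.sum_mem (fun i _ => by positivity) ?_ (fun i _ => hv i)
  simp
  field_simp

/-- Barycentric subdivision of affine chains. -/
def sd : (n : ℕ) → LC n E →ₗ[ℤ] LC n E
  | 0 => LinearMap.id
  | n + 1 => Finsupp.linearCombination ℤ fun v : Fin (n + 1) → E =>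
      cone (bary v) n (sd n (ld n (Finsupp.single v 1)))

lemma sd_single (n : ℕ) (v : Fin (n + 1) → E) :
    sd (n + 1) (Finsupp.single v 1) = cone (bary v) n (sd n (ld n (Finsupp.single v 1))) := by
  simp [sd]

lemma sd_zero (x : LC 0 E) : sd 0 x = x := rfl

attribute [irreducible] sd

lemma ld_sd (n : ℕ) (x : LC (n + 1) E) : ld n (sd (n + 1) x) = sd n (ld n x) := by
  induction n with
  | zero =>
    refine lin_ext (F := ld 0 ∘ₗ sd (0 + 1)) (G := sd 0 ∘ₗ ld 0) (fun v => ?_) x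
    rw [LinearMap.comp_apply, sd_single, ld_cone_zero, LinearMap.comp_apply]
  | succ n ih =>
    refine lin_ext (F := ld (n + 1) ∘ₗ sd (n + 2)) (G := sd (n + 1) ∘ₗ ld (n + 1))
      (fun v => ?_) x
    rw [LinearMap.comp_apply, sd_single, ld_cone, ih, ld_ld]
    simp

lemma lmap_sd (f : E →ₗ[ℝ] F) (n : ℕ) (x : LC n E) :
    lmap f n (sd n x) = sd n (lmap f n x) := by
  induction n with
  | zero => simp only [sd_zero]
  | succ n ih =>
    refine lin_ext (F := lmap f (n + 1) ∘ₗ sd (n + 1)) (G := sd (n + 1) ∘ₗ lmap f (n + 1))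
      (fun v => ?_) x
    rw [LinearMap.comp_apply, sd_single, lmap_cone, ih, LinearMap.comp_apply, lmap_single,
      sd_single, ← map_bary, ← ld_lmap, lmap_single]

/-- The inclusion of `E` in `E × ℝ` at height `s`, on affine chains. -/
abbrev level (s : ℝ) (n : ℕ) : LC n E →ₗ[ℤ] LC n (E × ℝ) := lmap (fun x => (x, s)) n

/-- The prism operator: a natural chain homotopy, in `E × ℝ`, between an affine chain at height `0`
and its barycentric subdivision at height `1`. -/
def prism : (n : ℕ) → LC n E →ₗ[ℤ] LC (n + 1) (E × ℝ)
  | 0 => 0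
  | n + 1 => Finsupp.linearCombination ℤ fun v : Fin (n + 1) → E =>
      cone (bary v, (0 : ℝ)) (n + 1) (level 1 (n + 1) (sd (n + 1) (Finsupp.single v 1)) -
        level 0 (n + 1) (Finsupp.single v 1) - prism n (ld n (Finsupp.single v 1)))

lemma prism_single (n : ℕ) (v : Fin (n + 1) → E) :
    prism (n + 1) (Finsupp.single v 1) =
      cone (bary v, (0 : ℝ)) (n + 1) (level 1 (n + 1) (sd (n + 1) (Finsupp.single v 1)) -
        level 0 (n + 1) (Finsupp.single v 1) - prism n (ld n (Finsupp.single v 1))) := by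
  simp [prism]

lemma prism_zero (x : LC 0 E) : prism 0 x = 0 := rfl

attribute [irreducible] prism

lemma ld_prism_zero (x : LC 0 E) :
    ld 0 (prism 0 x) = level 1 0 (sd 0 x) - level 0 0 x := by
  refine lin_ext (F := ld 0 ∘ₗ prism 0) (G := level 1 0 ∘ₗ sd 0 - level 0 0) (fun v => ?_) x
  simp only [LinearMap.comp_apply, prism_zero, sd_zero, LinearMap.sub_apply, lmap_single,
    map_zero]
  rw [eq_comm, sub_eq_zero]
  congr 1
  exact Subsingleton.elim _ _

lemma ld_prism (n : ℕ) (x : LC (n + 1) E) :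
    ld (n + 1) (prism (n + 1) x) =
      level 1 (n + 1) (sd (n + 1) x) - level 0 (n + 1) x - prism n (ld n x) := by
  induction n with
  | zero =>
    refine lin_ext (F := ld (0 + 1) ∘ₗ prism (0 + 1))
      (G := level 1 (0 + 1) ∘ₗ sd (0 + 1) - level 0 (0 + 1) - prism 0 ∘ₗ ld 0) (fun v => ?_) x
    rw [LinearMap.comp_apply, prism_single, ld_cone]
    simp only [map_sub, ld_lmap, ld_sd, ld_prism_zero]
    simp
  | succ n ih =>
    refine lin_ext (F := ld (n + 2) ∘ₗ prism (n + 2))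
      (G := level 1 (n + 2) ∘ₗ sd (n + 2) - level 0 (n + 2) - prism (n + 1) ∘ₗ ld (n + 1))
      (fun v => ?_) x
    rw [LinearMap.comp_apply, prism_single, ld_cone]
    simp only [map_sub, ld_lmap, ld_sd, ih, ld_ld]
    simp

lemma lmap_prism (f : E →ₗ[ℝ] F) (n : ℕ) (x : LC n E) :
    lmap (Prod.map f id) (n + 1) (prism n x) = prism n (lmap f n x) := by
  induction n with
  | zero => simp [prism_zero]
  | succ n ih =>
    refine lin_ext (F := lmap (Prod.map f id) (n + 2) ∘ₗ prism (n + 1))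
      (G := prism (n + 1) ∘ₗ lmap f (n + 1)) (fun v => ?_) x
    rw [LinearMap.comp_apply, prism_single, lmap_cone, LinearMap.comp_apply]
    simp only [map_sub, ih]
    rw [lmap_lmap, lmap_lmap, lmap_single f, prism_single]
    have h1 : (Prod.map f id ∘ fun x : E => (x, (1 : ℝ))) = (fun x : F => (x, (1 : ℝ))) ∘ f := rfl
    have h0 : (Prod.map f id ∘ fun x : E => (x, (0 : ℝ))) = (fun x : F => (x, (0 : ℝ))) ∘ f := rfl
    rw [h1, h0, ← lmap_lmap, ← lmap_lmap, lmap_sd]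
    simp only [map_sub, lmap_single, Prod.map, id, map_bary, ← ld_lmap]

end Subdivision

lemma supported_induction {α M : Type*} [AddCommGroup M] {s : Set α} (F : (α →₀ ℤ) →ₗ[ℤ] M)
    {P : Submodule ℤ M} (h : ∀ a ∈ s, F (Finsupp.single a 1) ∈ P) {x : α →₀ ℤ}
    (hx : x ∈ Finsupp.supported ℤ ℤ s) : F x ∈ P := by
  rw [Finsupp.supported_eq_span_single] at hx
  have : Submodule.span ℤ ((fun i => Finsupp.single i (1 : ℤ)) '' s) ≤ P.comap F := by
    rw [Submodule.span_le]
    rintro _ ⟨a, ha, rfl⟩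
    exact h a ha
  exact this hx

lemma supported_ext {α M : Type*} [AddCommGroup M] {s : Set α} {F G : (α →₀ ℤ) →ₗ[ℤ] M}
    (h : ∀ a ∈ s, F (Finsupp.single a 1) = G (Finsupp.single a 1)) {x : α →₀ ℤ}
    (hx : x ∈ Finsupp.supported ℤ ℤ s) : F x = G x := by
  have := supported_induction (F - G) (P := ⊥) (fun a ha => by simp [h a ha]) hx
  rwa [Submodule.mem_bot, LinearMap.sub_apply, sub_eq_zero] at this

lemma single_mem_supported {α : Type*} {s : Set α} {a : α} (h : a ∈ s) (b : ℤ) :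
    Finsupp.single a b ∈ Finsupp.supported ℤ ℤ s := Finsupp.single_mem_supported ℤ b h

section SubdivisionSupport

variable {E : Type*} [AddCommGroup E] [Module ℝ E]

/-- The tuples with all entries in `K`. -/
def tuplesIn (n : ℕ) {E : Type*} (K : Set E) : Set (Fin n → E) := {v | ∀ i, v i ∈ K}

lemma ld_mem {E : Type*} {K : Set E} (n : ℕ) {x : LC (n + 1) E}
    (hx : x ∈ Finsupp.supported ℤ ℤ (tuplesIn (n + 1) K)) :
    ld n x ∈ Finsupp.supported ℤ ℤ (tuplesIn n K) := by
  refine supported_induction (ld n) (fun v hv => ?_) hx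
  rw [ld_single]
  exact Submodule.sum_mem _ fun i _ => Submodule.smul_mem _ _
    (single_mem_supported (by exact fun k => hv _) _)

lemma cone_mem {E : Type*} {K : Set E} {b : E} (hb : b ∈ K) (n : ℕ) {x : LC n E}
    (hx : x ∈ Finsupp.supported ℤ ℤ (tuplesIn n K)) :
    cone b n x ∈ Finsupp.supported ℤ ℤ (tuplesIn (n + 1) K) := by
  refine supported_induction (cone b n) (fun v hv => ?_) hx
  rw [cone_single]
  refine single_mem_supported (fun i => ?_) _
  refine Fin.cases ?_ (fun j => ?_) i
  · simpa using hb
  · simpa using hv j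

lemma lmap_mem {E F : Type*} {K : Set E} {K' : Set F} {f : E → F} (hf : ∀ x ∈ K, f x ∈ K')
    (n : ℕ) {x : LC n E} (hx : x ∈ Finsupp.supported ℤ ℤ (tuplesIn n K)) :
    lmap f n x ∈ Finsupp.supported ℤ ℤ (tuplesIn n K') := by
  refine supported_induction (lmap f n) (fun v hv => ?_) hx
  rw [lmap_single]
  exact single_mem_supported (by exact fun i => hf _ (hv i)) _

lemma sd_mem {K : Set E} (hK : Convex ℝ K) (n : ℕ) {x : LC n E}
    (hx : x ∈ Finsupp.supported ℤ ℤ (tuplesIn n K)) :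
    sd n x ∈ Finsupp.supported ℤ ℤ (tuplesIn n K) := by
  induction n with
  | zero => rwa [sd_zero]
  | succ n ih =>
    refine supported_induction (sd (n + 1)) (fun v hv => ?_) hx
    rw [sd_single]
    exact cone_mem (bary_mem hK hv) _ (ih (ld_mem _ (single_mem_supported hv _)))

lemma prism_mem {K : Set E} (hK : Convex ℝ K) (n : ℕ) {x : LC n E}
    (hx : x ∈ Finsupp.supported ℤ ℤ (tuplesIn n K)) :
    prism n x ∈ Finsupp.supported ℤ ℤ (tuplesIn (n + 1) (K ×ˢ Set.Icc (0 : ℝ) 1)) := by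
  induction n with
  | zero => simp [prism_zero]
  | succ n ih =>
    refine supported_induction (prism (n + 1)) (fun v hv => ?_) hx
    have hv1 := single_mem_supported hv (1 : ℤ)
    rw [prism_single]
    refine cone_mem (Set.mk_mem_prod (bary_mem hK hv) (by simp)) _ ?_
    refine Submodule.sub_mem _ (Submodule.sub_mem _ ?_ ?_) (ih (ld_mem _ hv1))
    · exact lmap_mem (fun x hx => Set.mk_mem_prod hx (by simp)) _ (sd_mem hK _ hv1)
    · exact lmap_mem (fun x hx => Set.mk_mem_prod hx (by simp)) _ hv1

end SubdivisionSupport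

section Diameter

variable {E : Type*} [NormedAddCommGroup E] [NormedSpace ℝ E]

/-- The tuples whose entries are pairwise at distance at most `r`. -/
def smallTuples (n : ℕ) (E : Type*) [NormedAddCommGroup E] (r : ℝ) : Set (Fin n → E) :=
  {v | ∀ i j, dist (v i) (v j) ≤ r}

lemma dist_bary_le {n : ℕ} {v : Fin (n + 1) → E} {r : ℝ}
    (hv : v ∈ smallTuples (n + 1) E r) (i : Fin (n + 1)) :
    dist (bary v) (v i) ≤ (n / (n + 1) : ℝ) * r := by
  have h1 : bary v - v i = ((n + 1 : ℝ)⁻¹) • ∑ j ∈ Finset.univ.erase i, (v j - v i) := by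
    rw [Finset.sum_erase _ (by simp), Finset.sum_sub_distrib, bary, smul_sub]
    simp only [Finset.sum_const, Finset.card_univ, Fintype.card_fin]
    rw [← Nat.cast_smul_eq_nsmul ℝ, smul_smul]
    push_cast
    rw [inv_mul_cancel₀ (by positivity), one_smul]
  rw [dist_eq_norm, h1, norm_smul, norm_inv]
  have h2 : ‖∑ j ∈ Finset.univ.erase i, (v j - v i)‖ ≤ n * r := by
    refine (norm_sum_le _ _).trans ?_
    calc ∑ j ∈ Finset.univ.erase i, ‖v j - v i‖ ≤ ∑ j ∈ Finset.univ.erase i, r :=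
          Finset.sum_le_sum fun j _ => by rw [← dist_eq_norm]; exact hv j i
      _ = n * r := by simp
  have h3 : ‖(n + 1 : ℝ)‖ = n + 1 := by
    rw [Real.norm_eq_abs, abs_of_pos (by positivity)]
  rw [h3, div_mul_eq_mul_div, div_eq_inv_mul]
  gcongr

/-- Each simplex in the barycentric subdivision of a `k`-simplex of diameter at most `r` has
diameter at most `k / (k + 1) * r`, here relaxed to a common ratio for all dimensions `k < n`. -/
lemma sd_small {r : ℝ} (hr : 0 ≤ r) (N n : ℕ) (hn : n ≤ N + 1) (v : Fin n → E)
    (hs : v ∈ smallTuples n E r) :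
    sd n (Finsupp.single v 1) ∈ Finsupp.supported ℤ ℤ
      (smallTuples n E ((N / (N + 1) : ℝ) * r)) := by
  induction n with
  | zero =>
    rw [sd_zero]
    exact single_mem_supported (by exact fun i => i.elim0) _
  | succ n ih =>
    rw [sd_single]
    have key : ∀ y : LC n E, y ∈ Finsupp.supported ℤ ℤ
        (smallTuples n E ((N / (N + 1) : ℝ) * r) ∩
          tuplesIn n (Metric.closedBall (bary v) ((N / (N + 1) : ℝ) * r))) →
        cone (bary v) n y ∈ Finsupp.supported ℤ ℤ
          (smallTuples (n + 1) E ((N / (N + 1) : ℝ) * r)) := by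
      intro y hy
      refine supported_induction (cone (bary v) n) (fun w hw => ?_) hy
      rw [cone_single]
      refine single_mem_supported (fun i j => ?_) _
      have h0 : (0 : ℝ) ≤ (N / (N + 1) : ℝ) * r := by positivity
      refine Fin.cases ?_ (fun i => ?_) i <;> refine Fin.cases ?_ (fun j => ?_) j
      · simpa using h0
      · simpa [dist_comm] using hw.2 j
      · simpa using hw.2 i
      · simpa using hw.1 i j
    have hle : (n / (n + 1) : ℝ) ≤ (N / (N + 1) : ℝ) := by
      have : (n : ℝ) ≤ N := by exact_mod_cast (by omega : n ≤ N)
      rw [div_le_div_iff₀ (by positivity) (by positivity)]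
      nlinarith
    have hball : ∀ i, v i ∈ Metric.closedBall (bary v) ((N / (N + 1) : ℝ) * r) := fun i => by
      rw [Metric.mem_closedBall, dist_comm]
      exact (dist_bary_le hs i).trans (by gcongr)
    refine key _ ?_
    rw [ld_single, map_sum]
    refine Submodule.sum_mem _ fun i _ => ?_
    rw [map_smul]
    refine Submodule.smul_mem _ _ ?_
    rw [Finsupp.supported_inter]
    refine ⟨ih (by omega) _ (fun k l => hs _ _), ?_⟩
    exact sd_mem (convex_closedBall _ _) n (single_mem_supported (by exact fun k => hball _) _)

/-- Iterated subdivision makes affine chains in a convex set arbitrarily fine. -/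
lemma sd_iterate_small {K : Set E} (hK : Convex ℝ K) {r : ℝ} (hr : 0 ≤ r) (n m : ℕ)
    {x : LC (n + 1) E}
    (hx : x ∈ Finsupp.supported ℤ ℤ (tuplesIn (n + 1) K ∩ smallTuples (n + 1) E r)) :
    (sd (n + 1))^[m] x ∈ Finsupp.supported ℤ ℤ
      (tuplesIn (n + 1) K ∩ smallTuples (n + 1) E ((n / (n + 1) : ℝ) ^ m * r)) := by
  induction m with
  | zero => simpa using hx
  | succ m ih =>
    rw [Function.iterate_succ_apply']
    refine supported_induction (sd (n + 1)) (fun v hv => ?_) ih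
    rw [Finsupp.supported_inter]
    refine ⟨sd_mem hK _ (single_mem_supported hv.1 _), ?_⟩
    rw [pow_succ', mul_assoc]
    exact sd_small (by positivity) n (n + 1) le_rfl v hv.2

end Diameter

end RelHom

set_option linter.unusedSectionVars false

namespace RelHom

/-! ### Singular chains -/

/-- The standard topological `n`-simplex. -/
abbrev Δ (n : ℕ) : Type := stdSimplex ℝ (Fin (n + 1))

/-- The group of singular `n`-chains of `X`. -/
abbrev Chain (n : ℕ) (X : Type*) [TopologicalSpace X] : Type _ := C(Δ n, X) →₀ ℤ

/-- The inclusion of the `i`-th face in the standard simplex. -/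
def faceMap (n : ℕ) (i : Fin (n + 2)) : C(Δ n, Δ (n + 1)) :=
  ⟨stdSimplex.map i.succAbove, stdSimplex.continuous_map _⟩

section Basic

variable {X X' X'' : Type*} [TopologicalSpace X] [TopologicalSpace X'] [TopologicalSpace X'']

/-- The boundary operator on singular chains of positive degree. -/
def dd (n : ℕ) : Chain (n + 1) X →ₗ[ℤ] Chain n X :=
  Finsupp.linearCombination ℤ fun σ : C(Δ (n + 1), X) =>
    ∑ i : Fin (n + 2), (-1 : ℤ) ^ (i : ℕ) • Finsupp.single (σ.comp (faceMap n i)) (1 : ℤ)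

lemma dd_single (n : ℕ) (σ : C(Δ (n + 1), X)) :
    dd n (Finsupp.single σ 1) = ∑ i : Fin (n + 2), (-1 : ℤ) ^ (i : ℕ) •
      Finsupp.single (σ.comp (faceMap n i)) (1 : ℤ) := by
  simp [dd]

/-- The chains of `X` that are supported in the subset `B`. -/
def sub (n : ℕ) (B : Set X) : Submodule ℤ (Chain n X) :=
  Finsupp.supported ℤ ℤ {σ : C(Δ n, X) | ∀ t, σ t ∈ B}

lemma single_mem_sub {n : ℕ} {B : Set X} {σ : C(Δ n, X)} (h : ∀ t, σ t ∈ B) (a : ℤ) :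
    Finsupp.single σ a ∈ sub n B := Finsupp.single_mem_supported ℤ a h

lemma sub_mono (n : ℕ) {A B : Set X} (h : A ⊆ B) : sub n A ≤ sub n B :=
  Finsupp.supported_mono fun _ hσ t => h (hσ t)

lemma sub_inter (n : ℕ) (A B : Set X) : sub n (A ∩ B) = sub n A ⊓ sub n B := by
  rw [sub, sub, sub, ← Finsupp.supported_inter]
  congr 1
  ext σ
  exact forall_and

lemma sub_univ (n : ℕ) : sub n (Set.univ : Set X) = ⊤ := by
  rw [sub, ← Finsupp.supported_univ]
  congr 1
  ext σ
  simp

lemma sub_empty (n : ℕ) : sub n (∅ : Set X) = ⊥ := by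
  rw [sub, ← Finsupp.supported_empty]
  congr 1
  ext σ
  simp

lemma dd_mem {n : ℕ} {B : Set X} {x : Chain (n + 1) X} (hx : x ∈ sub (n + 1) B) :
    dd n x ∈ sub n B := by
  refine supported_induction (dd n) (fun σ hσ => ?_) hx
  rw [dd_single]
  exact Submodule.sum_mem _ fun i _ => Submodule.smul_mem _ _
    (single_mem_sub (by exact fun t => hσ _) _)

open Classical in
/-- The push-forward of singular chains along a map, where the simplices on which the map is not
continuous are sent to `0`. It is only applied to chains supported in a set on which the map is
continuous. -/
def push (f : X → X') (n : ℕ) : Chain n X →ₗ[ℤ] Chain n X' :=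
  Finsupp.linearCombination ℤ fun σ : C(Δ n, X) =>
    if h : Continuous (f ∘ σ) then Finsupp.single ⟨f ∘ σ, h⟩ (1 : ℤ) else 0

lemma push_single {f : X → X'} {n : ℕ} {σ : C(Δ n, X)} (h : Continuous (f ∘ σ)) :
    push f n (Finsupp.single σ 1) = Finsupp.single ⟨f ∘ σ, h⟩ 1 := by
  simp [push, h]

lemma continuous_comp {f : X → X'} {B : Set X} (hf : ContinuousOn f B) {n : ℕ} {σ : C(Δ n, X)}
    (hσ : ∀ t, σ t ∈ B) : Continuous (f ∘ σ) :=
  hf.comp_continuous σ.continuous hσ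

lemma push_mem {f : X → X'} {B : Set X} {B' : Set X'} (hf : ContinuousOn f B)
    (hB : Set.MapsTo f B B') {n : ℕ} {x : Chain n X} (hx : x ∈ sub n B) :
    push f n x ∈ sub n B' := by
  refine supported_induction (push f n) (fun σ hσ => ?_) hx
  rw [push_single (continuous_comp hf hσ)]
  exact single_mem_sub (fun t => hB (hσ t)) _

lemma push_congr {f g : X → X'} {B : Set X} (h : Set.EqOn f g B) {n : ℕ} {x : Chain n X}
    (hx : x ∈ sub n B) : push f n x = push g n x := by
  refine supported_ext (fun σ hσ => ?_) hx
  have : f ∘ σ = g ∘ σ := funext fun t => h (hσ t)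
  simp only [push, Finsupp.linearCombination_single, one_smul]
  by_cases hc : Continuous (f ∘ σ)
  · rw [dif_pos hc, dif_pos (this ▸ hc)]
    congr 1
    ext t
    exact congrFun this t
  · rw [dif_neg hc, dif_neg (this ▸ hc)]

lemma push_push {f : X → X'} {g : X' → X''} {B : Set X} {B' : Set X'} (hf : ContinuousOn f B)
    (hB : Set.MapsTo f B B') (hg : ContinuousOn g B') {n : ℕ} {x : Chain n X}
    (hx : x ∈ sub n B) : push g n (push f n x) = push (g ∘ f) n x := by
  refine supported_ext (F := push g n ∘ₗ push f n) (fun σ hσ => ?_) hx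
  rw [LinearMap.comp_apply, push_single (continuous_comp hf hσ),
    push_single (continuous_comp hg fun t => hB (hσ t)),
    push_single (continuous_comp (hg.comp hf hB) hσ)]
  rfl

lemma push_id {n : ℕ} (x : Chain n X) : push id n x = x := by
  refine lin_ext (F := push id n) (G := LinearMap.id) (fun σ => ?_) x
  rw [push_single (f := id) (σ := σ) (by simpa using σ.continuous)]
  rfl

lemma dd_push {f : X → X'} {B : Set X} (hf : ContinuousOn f B) {n : ℕ} {x : Chain (n + 1) X}
    (hx : x ∈ sub (n + 1) B) : dd n (push f (n + 1) x) = push f n (dd n x) := by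
  refine supported_ext (F := dd n ∘ₗ push f (n + 1)) (G := push f n ∘ₗ dd n)
    (fun σ hσ => ?_) hx
  rw [LinearMap.comp_apply, push_single (continuous_comp hf hσ), dd_single,
    LinearMap.comp_apply, dd_single, map_sum]
  refine Finset.sum_congr rfl fun i _ => ?_
  have h : Continuous (f ∘ σ.comp (faceMap n i)) := continuous_comp hf fun t => hσ _
  rw [map_smul, push_single h]
  rfl

end Basic

section Affine

variable {E F : Type*} [AddCommGroup E] [Module ℝ E] [TopologicalSpace E]
  [IsTopologicalAddGroup E] [ContinuousSMul ℝ E]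
  [AddCommGroup F] [Module ℝ F] [TopologicalSpace F] [IsTopologicalAddGroup F]
  [ContinuousSMul ℝ F]

/-- The affine singular simplex with given vertices. -/
def aff {n : ℕ} (v : Fin (n + 1) → E) : C(Δ n, E) where
  toFun t := ∑ i, t.1 i • v i
  continuous_toFun := continuous_finsetSum _ fun i _ =>
    ((continuous_apply i).comp continuous_subtype_val).smul continuous_const

/-- The singular chain of an affine chain. -/
def affC (n : ℕ) : LC (n + 1) E →ₗ[ℤ] Chain n E := Finsupp.lmapDomain ℤ ℤ aff

lemma affC_single (n : ℕ) (v : Fin (n + 1) → E) (a : ℤ) :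
    affC n (Finsupp.single v a) = Finsupp.single (aff v) a := by
  simp [affC]

lemma faceMap_apply_same (n : ℕ) (i : Fin (n + 2)) (t : Δ n) : (faceMap n i t).1 i = 0 := by
  change FunOnFinite.linearMap ℝ ℝ i.succAbove t.1 i = 0
  rw [FunOnFinite.linearMap_apply_apply]
  refine Finset.sum_eq_zero fun k hk => ?_
  simp [Fin.succAbove_ne] at hk

lemma faceMap_apply_succAbove (n : ℕ) (i : Fin (n + 2)) (t : Δ n) (k : Fin (n + 1)) :
    (faceMap n i t).1 (i.succAbove k) = t.1 k := by
  change FunOnFinite.linearMap ℝ ℝ i.succAbove t.1 _ = _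
  rw [FunOnFinite.linearMap_apply_apply]
  rw [Finset.sum_eq_single k]
  · intro b hb hbk
    simp at hb
    exact absurd hb hbk
  · simp

lemma aff_comp_faceMap (n : ℕ) (v : Fin (n + 2) → E) (i : Fin (n + 2)) :
    (aff v).comp (faceMap n i) = aff (fun k => v (i.succAbove k)) := by
  ext t
  change ∑ j, (faceMap n i t).1 j • v j = ∑ k, t.1 k • v (i.succAbove k)
  rw [Fin.sum_univ_succAbove _ i, faceMap_apply_same]
  simp [faceMap_apply_succAbove]

lemma dd_affC (n : ℕ) (x : LC (n + 2) E) : dd n (affC (n + 1) x) = affC n (ld (n + 1) x) := by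
  refine lin_ext (F := dd n ∘ₗ affC (n + 1)) (G := affC n ∘ₗ ld (n + 1)) (fun v => ?_) x
  simp only [LinearMap.comp_apply, affC_single, dd_single, ld_single, map_sum, map_smul,
    aff_comp_faceMap]

lemma aff_mem {K : Set E} (hK : Convex ℝ K) {n : ℕ} {v : Fin (n + 1) → E} (hv : ∀ i, v i ∈ K)
    (t : Δ n) : aff v t ∈ K :=
  hK.sum_mem (fun i _ => t.2.1 i) t.2.2 (fun i _ => hv i)

lemma affC_mem {K : Set E} (hK : Convex ℝ K) {n : ℕ} {x : LC (n + 1) E}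
    (hx : x ∈ Finsupp.supported ℤ ℤ (tuplesIn (n + 1) K)) : affC n x ∈ sub n K := by
  refine supported_induction (affC n) (fun v hv => ?_) hx
  rw [affC_single]
  exact single_mem_sub (aff_mem hK hv) _

lemma push_affC {f : E → F} (hc : Continuous f)
    (hf : ∀ (n : ℕ) (v : Fin (n + 1) → E) (t : Δ n), f (aff v t) = aff (f ∘ v) t) (n : ℕ)
    (x : LC (n + 1) E) : push f n (affC n x) = affC n (lmap f (n + 1) x) := by
  refine lin_ext (F := push f n ∘ₗ affC n) (G := affC n ∘ₗ lmap f (n + 1)) (fun v => ?_) x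
  rw [LinearMap.comp_apply, affC_single, push_single (hc.comp (aff v).continuous),
    LinearMap.comp_apply, lmap_single, affC_single]
  congr 1
  ext t
  exact hf n v t

lemma linear_aff (f : E →ₗ[ℝ] F) (n : ℕ) (v : Fin (n + 1) → E) (t : Δ n) :
    f (aff v t) = aff (f ∘ v) t := by
  simp [aff, map_sum]

lemma level_aff (s : ℝ) (n : ℕ) (v : Fin (n + 1) → E) (t : Δ n) :
    ((aff v t, s) : E × ℝ) = aff ((fun x => (x, s)) ∘ v) t := by
  have h1 : ∑ i, t.1 i = 1 := t.2.2
  refine Prod.ext ?_ ?_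
  · simp [aff, Prod.fst_sum]
  · simp [aff, Prod.snd_sum, ← Finset.sum_mul, h1]

end Affine

/-- The vertices of the standard simplex. -/
def stdV (n : ℕ) : Fin (n + 1) → (Fin (n + 1) → ℝ) := fun i => Pi.single i 1

/-- The standard simplex as an affine chain. -/
abbrev stdC (n : ℕ) : LC (n + 1) (Fin (n + 1) → ℝ) := Finsupp.single (stdV n) 1

lemma stdC_mem (n : ℕ) : stdC n ∈
    Finsupp.supported ℤ ℤ (tuplesIn (n + 1) (stdSimplex ℝ (Fin (n + 1)))) :=
  single_mem_supported (by exact fun i => single_mem_stdSimplex ℝ i) _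

lemma aff_stdV (n : ℕ) (t : Δ n) : aff (stdV n) t = t.1 := by
  funext k
  simp [aff, stdV, Finset.sum_apply, Pi.single_apply]

lemma convex_std (n : ℕ) : Convex ℝ (stdSimplex ℝ (Fin (n + 1))) := convex_stdSimplex ℝ _

section Operators

variable {X X' : Type*} [TopologicalSpace X] [TopologicalSpace X']

open Classical in
/-- An extension of a singular simplex to the vector space spanned by the standard simplex; the
values off the standard simplex are irrelevant. -/
def extS {n : ℕ} (σ : C(Δ n, X)) : (Fin (n + 1) → ℝ) → X := fun x =>
  if h : x ∈ stdSimplex ℝ (Fin (n + 1)) then σ ⟨x, h⟩ else σ (stdSimplex.vertex 0)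

lemma extS_coe {n : ℕ} (σ : C(Δ n, X)) (t : Δ n) : extS σ t.1 = σ t := by
  simp [extS]

lemma continuousOn_extS {n : ℕ} (σ : C(Δ n, X)) :
    ContinuousOn (extS σ) (stdSimplex ℝ (Fin (n + 1))) := by
  rw [continuousOn_iff_continuous_domRestrict]
  convert σ.continuous using 1
  funext t
  exact extS_coe σ t

lemma extS_mapsTo {n : ℕ} {σ : C(Δ n, X)} {B : Set X} (hσ : ∀ t, σ t ∈ B) :
    Set.MapsTo (extS σ) (stdSimplex ℝ (Fin (n + 1))) B := fun x hx => by
  rw [← Subtype.coe_mk x hx, extS_coe]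
  exact hσ _

lemma push_extS {n : ℕ} (σ : C(Δ n, X)) :
    push (extS σ) n (affC n (stdC n)) = Finsupp.single σ 1 := by
  rw [affC_single, push_single (continuous_comp (continuousOn_extS σ) fun t => by
    rw [aff_stdV]; exact t.2)]
  congr 1
  ext t
  change extS σ (aff (stdV n) t) = σ t
  rw [aff_stdV, extS_coe]

/-- Barycentric subdivision of singular chains. -/
def Sd (n : ℕ) : Chain n X →ₗ[ℤ] Chain n X :=
  Finsupp.linearCombination ℤ fun σ : C(Δ n, X) =>
    push (extS σ) n (affC n (sd (n + 1) (stdC n)))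

lemma Sd_single (n : ℕ) (σ : C(Δ n, X)) :
    Sd n (Finsupp.single σ 1) = push (extS σ) n (affC n (sd (n + 1) (stdC n))) := by
  simp [Sd]

/-- The prism operator of a homotopy `k`, which also subdivides one end of the prism. -/
def Pr (k : X × ℝ → X') (n : ℕ) : Chain n X →ₗ[ℤ] Chain (n + 1) X' :=
  Finsupp.linearCombination ℤ fun σ : C(Δ n, X) =>
    push (fun p : (Fin (n + 1) → ℝ) × ℝ => k (extS σ p.1, p.2)) (n + 1)
      (affC (n + 1) (prism (n + 1) (stdC n)))

lemma Pr_single (k : X × ℝ → X') (n : ℕ) (σ : C(Δ n, X)) :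
    Pr k n (Finsupp.single σ 1) =
      push (fun p : (Fin (n + 1) → ℝ) × ℝ => k (extS σ p.1, p.2)) (n + 1)
        (affC (n + 1) (prism (n + 1) (stdC n))) := by
  simp [Pr]

variable {E : Type*} [AddCommGroup E] [Module ℝ E] [TopologicalSpace E]
  [IsTopologicalAddGroup E] [ContinuousSMul ℝ E]

/-- The linear map that takes the standard basis to a given tuple of vectors. -/
def comb {n : ℕ} (v : Fin (n + 1) → E) : (Fin (n + 1) → ℝ) →ₗ[ℝ] E :=
  Fintype.linearCombination ℝ v

lemma comb_apply {n : ℕ} (v : Fin (n + 1) → E) (x : Fin (n + 1) → ℝ) :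
    comb v x = ∑ i, x i • v i := rfl

lemma continuous_comb {n : ℕ} (v : Fin (n + 1) → E) : Continuous (comb v) := by
  change Continuous fun x : Fin (n + 1) → ℝ => ∑ i, x i • v i
  fun_prop

lemma comb_comp_stdV {n : ℕ} (v : Fin (n + 1) → E) : comb v ∘ stdV n = v := by
  funext i
  simp [comb_apply, stdV, Pi.single_apply]

lemma comb_mem {K : Set E} (hK : Convex ℝ K) {n : ℕ} {v : Fin (n + 1) → E} (hv : ∀ i, v i ∈ K) :
    Set.MapsTo (comb v) (stdSimplex ℝ (Fin (n + 1))) K := fun x hx => aff_mem hK hv ⟨x, hx⟩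

/-- Subdivision of singular chains is compatible with subdivision of affine chains. -/
lemma Sd_push {K : Set E} (hK : Convex ℝ K) {f : E → X} (hf : ContinuousOn f K) {n : ℕ}
    {y : LC (n + 1) E} (hy : y ∈ Finsupp.supported ℤ ℤ (tuplesIn (n + 1) K)) :
    Sd n (push f n (affC n y)) = push f n (affC n (sd (n + 1) y)) := by
  refine supported_ext (F := Sd n ∘ₗ push f n ∘ₗ affC n)
    (G := push f n ∘ₗ affC n ∘ₗ sd (n + 1)) (fun v hv => ?_) hy
  simp only [LinearMap.comp_apply]
  have h1 : sd (n + 1) (Finsupp.single v (1 : ℤ)) =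
      lmap (comb v) (n + 1) (sd (n + 1) (stdC n)) := by
    rw [lmap_sd, lmap_single, comb_comp_stdV]
  have h2 := affC_mem (convex_std n) (sd_mem (convex_std n) _ (stdC_mem n))
  rw [affC_single, push_single (continuous_comp hf (aff_mem hK hv)), Sd_single, h1,
    ← push_affC (continuous_comb v) (linear_aff (comb v)),
    push_push (continuous_comb v).continuousOn (comb_mem hK hv) hf h2]
  refine push_congr (fun x hx => ?_) h2
  exact extS_coe _ (⟨x, hx⟩ : Δ n)

/-- On affine chains the homotopy operator is computed by the prism operator; this is naturality. -/
lemma Pr_push {K : Set E} (hK : Convex ℝ K) {f : E → X} (hf : ContinuousOn f K) {B : Set X}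
    (hB : Set.MapsTo f K B) {k : X × ℝ → X'} (hk : ContinuousOn k (B ×ˢ Set.Icc (0 : ℝ) 1)) {n : ℕ}
    {y : LC (n + 1) E} (hy : y ∈ Finsupp.supported ℤ ℤ (tuplesIn (n + 1) K)) :
    Pr k n (push f n (affC n y)) =
      push (fun p : E × ℝ => k (f p.1, p.2)) (n + 1) (affC (n + 1) (prism (n + 1) y)) := by
  refine supported_ext (F := Pr k n ∘ₗ push f n ∘ₗ affC n)
    (G := push (fun p : E × ℝ => k (f p.1, p.2)) (n + 1) ∘ₗ affC (n + 1) ∘ₗ prism (n + 1))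
    (fun v hv => ?_) hy
  simp only [LinearMap.comp_apply]
  have h1 : prism (n + 1) (Finsupp.single v (1 : ℤ)) =
      lmap ((comb v).prodMap LinearMap.id) (n + 2) (prism (n + 1) (stdC n)) := by
    have := lmap_prism (comb v) (n + 1) (stdC n)
    rw [lmap_single, comb_comp_stdV] at this
    exact this.symm
  have h2 := affC_mem ((convex_std n).prod (convex_Icc 0 1))
    (prism_mem (convex_std n) _ (stdC_mem n))
  have h3 : Continuous ((comb v).prodMap (LinearMap.id : ℝ →ₗ[ℝ] ℝ)) :=
    (continuous_comb v).prodMap continuous_id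
  have h4 : ContinuousOn (fun p : E × ℝ => k (f p.1, p.2)) (K ×ˢ Set.Icc (0 : ℝ) 1) :=
    hk.comp ((hf.comp continuous_fst.continuousOn fun p hp => hp.1).prodMk
      continuous_snd.continuousOn) fun p hp => ⟨hB hp.1, hp.2⟩
  rw [affC_single, push_single (continuous_comp hf (aff_mem hK hv)), Pr_single, h1,
    ← push_affC h3 (linear_aff _),
    push_push h3.continuousOn (B' := K ×ˢ Set.Icc (0 : ℝ) 1)
      (fun p hp => ⟨comb_mem hK hv hp.1, hp.2⟩) h4 h2]
  refine push_congr (fun p hp => ?_) h2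
  have := extS_coe (X := X) ⟨f ∘ aff v, continuous_comp hf (aff_mem hK hv)⟩ (⟨p.1, hp.1⟩ : Δ n)
  simp only [this]
  rfl

lemma Sd_mem {n : ℕ} {B : Set X} {x : Chain n X} (hx : x ∈ sub n B) : Sd n x ∈ sub n B := by
  refine supported_induction (Sd n) (fun σ hσ => ?_) hx
  rw [Sd_single]
  exact push_mem (continuousOn_extS σ) (extS_mapsTo hσ)
    (affC_mem (convex_std n) (sd_mem (convex_std n) _ (stdC_mem n)))

lemma dd_single_eq (n : ℕ) (σ : C(Δ (n + 1), X)) :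
    dd n (Finsupp.single σ 1) = push (extS σ) n (affC n (ld (n + 1) (stdC (n + 1)))) := by
  rw [← push_extS σ, dd_push (continuousOn_extS σ) (affC_mem (convex_std _) (stdC_mem _)), dd_affC]

lemma dd_Sd (n : ℕ) (x : Chain (n + 1) X) : dd n (Sd (n + 1) x) = Sd n (dd n x) := by
  refine lin_ext (F := dd n ∘ₗ Sd (n + 1)) (G := Sd n ∘ₗ dd n) (fun σ => ?_) x
  have h := convex_std (n + 1)
  rw [LinearMap.comp_apply, Sd_single, dd_push (continuousOn_extS σ)
    (affC_mem h (sd_mem h _ (stdC_mem _))), dd_affC, ld_sd, LinearMap.comp_apply, dd_single_eq,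
    Sd_push h (continuousOn_extS σ) (ld_mem _ (stdC_mem _))]

lemma dd_dd (n : ℕ) (x : Chain (n + 2) X) : dd n (dd (n + 1) x) = 0 := by
  refine lin_ext (F := dd n ∘ₗ dd (n + 1)) (G := 0) (fun σ => ?_) x
  rw [LinearMap.comp_apply, dd_single_eq, dd_push (continuousOn_extS σ)
    (affC_mem (convex_std _) (ld_mem _ (stdC_mem _))), dd_affC, ld_ld]
  simp

lemma continuousOn_prism {B : Set X} {k : X × ℝ → X'}
    (hk : ContinuousOn k (B ×ˢ Set.Icc (0 : ℝ) 1)) {n : ℕ} {σ : C(Δ n, X)} (hσ : ∀ t, σ t ∈ B) :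
    ContinuousOn (fun p : (Fin (n + 1) → ℝ) × ℝ => k (extS σ p.1, p.2))
      (stdSimplex ℝ (Fin (n + 1)) ×ˢ Set.Icc (0 : ℝ) 1) :=
  hk.comp (((continuousOn_extS σ).comp continuous_fst.continuousOn fun _ hp => hp.1).prodMk
    continuous_snd.continuousOn) fun _ hp => ⟨extS_mapsTo hσ hp.1, hp.2⟩

lemma Pr_mem {B : Set X} {B' : Set X'} {k : X × ℝ → X'}
    (hk : ContinuousOn k (B ×ˢ Set.Icc (0 : ℝ) 1))
    (hB : Set.MapsTo k (B ×ˢ Set.Icc (0 : ℝ) 1) B') {n : ℕ} {x : Chain n X} (hx : x ∈ sub n B) :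
    Pr k n x ∈ sub (n + 1) B' := by
  refine supported_induction (Pr k n) (fun σ hσ => ?_) hx
  rw [Pr_single]
  exact push_mem (continuousOn_prism hk hσ) (fun p hp => hB ⟨extS_mapsTo hσ hp.1, hp.2⟩)
    (affC_mem ((convex_std n).prod (convex_Icc 0 1)) (prism_mem (convex_std n) _ (stdC_mem n)))

lemma push_level {B : Set X} {k : X × ℝ → X'} (hk : ContinuousOn k (B ×ˢ Set.Icc (0 : ℝ) 1))
    {s : ℝ} (hs : s ∈ Set.Icc (0 : ℝ) 1) {n : ℕ} {σ : C(Δ n, X)} (hσ : ∀ t, σ t ∈ B)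
    {y : LC (n + 1) (Fin (n + 1) → ℝ)}
    (hy : y ∈ Finsupp.supported ℤ ℤ (tuplesIn (n + 1) (stdSimplex ℝ (Fin (n + 1))))) :
    push (fun p : (Fin (n + 1) → ℝ) × ℝ => k (extS σ p.1, p.2)) n (affC n (level s (n + 1) y)) =
      push (fun x => k (x, s)) n (push (extS σ) n (affC n y)) := by
  have hc : Continuous fun x : Fin (n + 1) → ℝ => (x, s) := by fun_prop
  have h2 := affC_mem (convex_std n) hy
  have hks : ContinuousOn (fun x => k (x, s)) B :=
    hk.comp (f := fun x => (x, s)) (by fun_prop) fun x hx => ⟨hx, hs⟩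
  rw [← push_affC hc (level_aff s), push_push hc.continuousOn
    (B' := stdSimplex ℝ (Fin (n + 1)) ×ˢ Set.Icc (0 : ℝ) 1) (fun x hx => ⟨hx, hs⟩)
    (continuousOn_prism hk hσ) h2,
    push_push (continuousOn_extS σ) (extS_mapsTo hσ) hks h2]
  rfl

lemma dd_Pr_single {B : Set X} {k : X × ℝ → X'} (hk : ContinuousOn k (B ×ˢ Set.Icc (0 : ℝ) 1))
    {n : ℕ} {σ : C(Δ n, X)} (hσ : ∀ t, σ t ∈ B) :
    dd n (Pr k n (Finsupp.single σ 1)) =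
      push (fun x => k (x, 1)) n (Sd n (Finsupp.single σ 1)) -
      push (fun x => k (x, 0)) n (Finsupp.single σ 1) -
      push (fun p : (Fin (n + 1) → ℝ) × ℝ => k (extS σ p.1, p.2)) n
        (affC n (prism n (ld n (stdC n)))) := by
  have h := (convex_std n).prod (convex_Icc (0 : ℝ) 1)
  have hm := stdC_mem n
  rw [Pr_single, dd_push (continuousOn_prism hk hσ) (affC_mem h (prism_mem (convex_std n) _ hm)),
    dd_affC, ld_prism, map_sub, map_sub, map_sub, map_sub,
    push_level hk (by simp) hσ (sd_mem (convex_std n) _ hm), push_level hk (by simp) hσ hm,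
    push_extS, Sd_single]

lemma dd_Pr_zero {B : Set X} {k : X × ℝ → X'} (hk : ContinuousOn k (B ×ˢ Set.Icc (0 : ℝ) 1))
    {x : Chain 0 X} (hx : x ∈ sub 0 B) :
    dd 0 (Pr k 0 x) = push (fun x => k (x, 1)) 0 (Sd 0 x) - push (fun x => k (x, 0)) 0 x := by
  refine supported_ext (F := dd 0 ∘ₗ Pr k 0)
    (G := push (fun x => k (x, 1)) 0 ∘ₗ Sd 0 - push (fun x => k (x, 0)) 0) (fun σ hσ => ?_) hx
  rw [LinearMap.comp_apply, dd_Pr_single hk hσ, prism_zero]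
  simp

lemma dd_Pr {B : Set X} {k : X × ℝ → X'} (hk : ContinuousOn k (B ×ˢ Set.Icc (0 : ℝ) 1))
    {n : ℕ} {x : Chain (n + 1) X} (hx : x ∈ sub (n + 1) B) :
    dd (n + 1) (Pr k (n + 1) x) = push (fun x => k (x, 1)) (n + 1) (Sd (n + 1) x) -
      push (fun x => k (x, 0)) (n + 1) x - Pr k n (dd n x) := by
  refine supported_ext (F := dd (n + 1) ∘ₗ Pr k (n + 1))
    (G := push (fun x => k (x, 1)) (n + 1) ∘ₗ Sd (n + 1) - push (fun x => k (x, 0)) (n + 1) -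
      Pr k n ∘ₗ dd n) (fun σ hσ => ?_) hx
  rw [LinearMap.comp_apply, dd_Pr_single hk hσ]
  simp only [LinearMap.sub_apply, LinearMap.comp_apply]
  rw [dd_single_eq, Pr_push (convex_std (n + 1)) (continuousOn_extS σ) (extS_mapsTo hσ) hk
    (ld_mem _ (stdC_mem _))]

/-- Singular chains that are sums of chains supported in one of two open sets covering them: every
chain has this property after sufficiently many subdivisions. -/
lemma exists_Sd_iterate_mem {U V : Set X} (hU : IsOpen U) (hV : IsOpen V) {n : ℕ} {x : Chain n X}
    (hx : x ∈ sub n (U ∪ V)) : ∃ m₀, ∀ m ≥ m₀, (Sd n)^[m] x ∈ sub n U ⊔ sub n V := by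
  have hstep : ∀ y : Chain n X, y ∈ sub n U ⊔ sub n V → Sd n y ∈ sub n U ⊔ sub n V := by
    intro y hy
    obtain ⟨a, ha, b, hb, rfl⟩ := Submodule.mem_sup.1 hy
    rw [map_add]
    exact Submodule.add_mem_sup (Sd_mem ha) (Sd_mem hb)
  have hmono : ∀ (y : Chain n X) (m₀ : ℕ), (Sd n)^[m₀] y ∈ sub n U ⊔ sub n V →
      ∀ m ≥ m₀, (Sd n)^[m] y ∈ sub n U ⊔ sub n V := by
    intro y m₀ hy m hm
    induction m, hm using Nat.le_induction with
    | base => exact hy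
    | succ m _ ih =>
      rw [Function.iterate_succ_apply']
      exact hstep _ ih
  have hsingle : ∀ σ : C(Δ n, X), (∀ t, σ t ∈ U ∪ V) →
      ∃ m, (Sd n)^[m] (Finsupp.single σ 1) ∈ sub n U ⊔ sub n V := by
    intro σ hσ
    have hiter : ∀ m, (Sd n)^[m] (Finsupp.single σ 1) =
        push (extS σ) n (affC n ((sd (n + 1))^[m] (stdC n))) ∧ (sd (n + 1))^[m] (stdC n) ∈
          Finsupp.supported ℤ ℤ (tuplesIn (n + 1) (stdSimplex ℝ (Fin (n + 1)))) := by
      intro m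
      induction m with
      | zero => exact ⟨(push_extS σ).symm, stdC_mem n⟩
      | succ m ih =>
        rw [Function.iterate_succ_apply', Function.iterate_succ_apply', ih.1]
        exact ⟨Sd_push (convex_std n) (continuousOn_extS σ) ih.2, sd_mem (convex_std n) _ ih.2⟩
    have hcov : (Set.univ : Set (Δ n)) ⊆ ⋃ b : Bool, σ ⁻¹' (cond b U V) := by
      intro t _
      rw [Set.mem_iUnion]
      rcases hσ t with h | h
      · exact ⟨true, h⟩
      · exact ⟨false, h⟩
    obtain ⟨δ, hδ, hleb⟩ := lebesgue_number_lemma_of_metric (isCompact_univ (X := Δ n))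
      (fun b : Bool => (show IsOpen (σ ⁻¹' (cond b U V)) by
        cases b
        · exact hV.preimage σ.continuous
        · exact hU.preimage σ.continuous)) hcov
    obtain ⟨r, hr0, hr⟩ : ∃ r : ℝ, 0 ≤ r ∧ stdV n ∈ smallTuples (n + 1) (Fin (n + 1) → ℝ) r := by
      refine ⟨∑ i, ∑ j, dist (stdV n i) (stdV n j), by positivity, fun i j => ?_⟩
      refine (Finset.single_le_sum (f := fun j => dist (stdV n i) (stdV n j))
        (fun _ _ => dist_nonneg) (Finset.mem_univ j)).trans ?_
      exact Finset.single_le_sum (f := fun i => ∑ j, dist (stdV n i) (stdV n j))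
        (fun _ _ => Finset.sum_nonneg fun _ _ => dist_nonneg) (Finset.mem_univ i)
    obtain ⟨m, hm⟩ : ∃ m : ℕ, (n / (n + 1) : ℝ) ^ m * r < δ := by
      have h0 : (0 : ℝ) ≤ n / (n + 1) := by positivity
      have h1 : (n / (n + 1) : ℝ) < 1 := by
        rw [div_lt_one (by positivity)]
        linarith
      have := (tendsto_pow_atTop_nhds_zero_of_lt_one h0 h1).mul_const r
      rw [zero_mul] at this
      exact (this.eventually (gt_mem_nhds hδ)).exists
    refine ⟨m, ?_⟩
    have hs := sd_iterate_small (convex_std n) hr0 n m (x := stdC n)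
      (single_mem_supported (by exact ⟨fun i => single_mem_stdSimplex ℝ i, hr⟩) _)
    rw [(hiter m).1]
    refine supported_induction (push (extS σ) n ∘ₗ affC n) (fun v hv => ?_) hs
    have hvK : ∀ t, aff v t ∈ stdSimplex ℝ (Fin (n + 1)) := aff_mem (convex_std n) hv.1
    rw [LinearMap.comp_apply, affC_single, push_single (continuous_comp (continuousOn_extS σ) hvK)]
    obtain ⟨b, hb⟩ := hleb ⟨v 0, hv.1 0⟩ (Set.mem_univ _)
    have hin : ∀ t, (⟨aff v t, hvK t⟩ : Δ n) ∈ Metric.ball (⟨v 0, hv.1 0⟩ : Δ n) δ := by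
      intro t
      have : aff v t ∈ Metric.ball (v 0) δ := by
        refine aff_mem (convex_ball _ _) (fun i => ?_) t
        exact (hv.2 i 0).trans_lt hm
      exact this
    have hin' : ∀ t, extS σ (aff v t) ∈ cond b U V := by
      intro t
      have := hb (hin t)
      rwa [Set.mem_preimage, ← extS_coe] at this
    cases b
    · exact Submodule.mem_sup_right (single_mem_sub hin' _)
    · exact Submodule.mem_sup_left (single_mem_sub hin' _)
  rw [sub, Finsupp.supported_eq_span_single] at hx
  induction hx using Submodule.span_induction with
  | mem y hy =>
    obtain ⟨σ, hσ, rfl⟩ := hy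
    obtain ⟨m, hm⟩ := hsingle σ hσ
    exact ⟨m, hmono _ m hm⟩
  | zero =>
    refine ⟨0, fun m _ => ?_⟩
    rw [iterate_map_zero]
    exact Submodule.zero_mem _
  | add y z _ _ hy hz =>
    obtain ⟨a, ha⟩ := hy
    obtain ⟨b, hb⟩ := hz
    refine ⟨max a b, fun m hm => ?_⟩
    rw [iterate_map_add]
    exact Submodule.add_mem _ (ha m (le_of_max_le_left hm)) (hb m (le_of_max_le_right hm))
  | smul c y _ hy =>
    obtain ⟨a, ha⟩ := hy
    refine ⟨a, fun m hm => ?_⟩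
    rw [iterate_map_zsmul]
    exact Submodule.smul_mem _ _ (ha m hm)

end Operators


/-! ### Relative singular homology of pairs of subsets -/

section Defs

variable {X X' : Type*} [TopologicalSpace X] [TopologicalSpace X']

/-- The boundary operator on singular chains, zero in degree `0`. -/
def bd : (n : ℕ) → Chain n X →ₗ[ℤ] Chain (n - 1) X
  | 0 => 0
  | n + 1 => dd n

lemma bd_succ (n : ℕ) (x : Chain (n + 1) X) : bd (n + 1) x = dd n x := rfl

lemma bd_zero (x : Chain 0 X) : bd 0 x = 0 := rfl

/-- The relative cycles of the pair `(B, A)`. -/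
def Z (n : ℕ) (B A : Set X) : Submodule ℤ (Chain n X) :=
  sub n B ⊓ (sub (n - 1) A).comap (bd n)

/-- The relative boundaries of the pair `(B, A)`, including all chains of `A`. -/
def Bd (n : ℕ) (B A : Set X) : Submodule ℤ (Chain n X) :=
  sub n A ⊔ (sub (n + 1) B).map (dd n)

/-- The relative singular homology `H_n(B, A)` of subsets `A ⊆ B` of `X`. -/
abbrev H (n : ℕ) (B A : Set X) : Type _ := Z n B A ⧸ (Bd n B A).comap (Z n B A).subtype

/-- The vanishing of `H_n(B, A)`. -/
def Triv (n : ℕ) (B A : Set X) : Prop := Z n B A ≤ Bd n B A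

lemma mem_Z {n : ℕ} {B A : Set X} {x : Chain n X} :
    x ∈ Z n B A ↔ x ∈ sub n B ∧ bd n x ∈ sub (n - 1) A := Iff.rfl

lemma mem_Z_succ {n : ℕ} {B A : Set X} {x : Chain (n + 1) X} :
    x ∈ Z (n + 1) B A ↔ x ∈ sub (n + 1) B ∧ dd n x ∈ sub n A := Iff.rfl

lemma mem_Z_zero {B A : Set X} {x : Chain 0 X} : x ∈ Z 0 B A ↔ x ∈ sub 0 B := by
  rw [mem_Z, bd_zero]
  simp

lemma mem_Bd {n : ℕ} {B A : Set X} {x : Chain n X} :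
    x ∈ Bd n B A ↔ ∃ a ∈ sub n A, ∃ b ∈ sub (n + 1) B, a + dd n b = x := by
  rw [Bd, Submodule.mem_sup]
  simp only [Submodule.mem_map, exists_exists_and_eq_and]

lemma sub_le_Bd (n : ℕ) (B A : Set X) : sub n A ≤ Bd n B A := le_sup_left

lemma dd_mem_Bd {n : ℕ} {B : Set X} (A : Set X) {b : Chain (n + 1) X} (hb : b ∈ sub (n + 1) B) :
    dd n b ∈ Bd n B A := Submodule.mem_sup_right ⟨b, hb, rfl⟩

lemma Bd_mono (n : ℕ) {B A B' A' : Set X} (hB : B ⊆ B') (hA : A ⊆ A') : Bd n B A ≤ Bd n B' A' :=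
  sup_le_sup (sub_mono n hA) (Submodule.map_mono (sub_mono _ hB))

lemma Z_mono (n : ℕ) {B A B' A' : Set X} (hB : B ⊆ B') (hA : A ⊆ A') : Z n B A ≤ Z n B' A' :=
  inf_le_inf (sub_mono n hB) (Submodule.comap_mono (sub_mono _ hA))

lemma bd_dd (n : ℕ) (x : Chain (n + 1) X) : bd n (dd n x) = 0 := by
  cases n with
  | zero => rfl
  | succ n => exact dd_dd n x

lemma bd_mem {n : ℕ} {B : Set X} {x : Chain n X} (hx : x ∈ sub n B) : bd n x ∈ sub (n - 1) B := by
  cases n with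
  | zero => rw [bd_zero]; exact Submodule.zero_mem _
  | succ n => exact dd_mem hx

lemma Bd_le_Z (n : ℕ) {B A : Set X} (h : A ⊆ B) : Bd n B A ≤ Z n B A := by
  intro x hx
  obtain ⟨a, ha, b, hb, rfl⟩ := mem_Bd.1 hx
  refine mem_Z.2 ⟨Submodule.add_mem _ (sub_mono n h ha) (dd_mem hb), ?_⟩
  rw [map_add, bd_dd, add_zero]
  exact bd_mem ha

lemma bd_push {f : X → X'} {B : Set X} (hf : ContinuousOn f B) {n : ℕ} {x : Chain n X}
    (hx : x ∈ sub n B) : bd n (push f n x) = push f (n - 1) (bd n x) := by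
  cases n with
  | zero => simp [bd_zero]
  | succ n => exact dd_push hf hx

lemma push_Z {f : X → X'} {B A : Set X} {B' A' : Set X'} (hf : ContinuousOn f B) (hA : A ⊆ B)
    (hfB : Set.MapsTo f B B') (hfA : Set.MapsTo f A A') {n : ℕ} {x : Chain n X}
    (hx : x ∈ Z n B A) : push f n x ∈ Z n B' A' := by
  refine mem_Z.2 ⟨push_mem hf hfB hx.1, ?_⟩
  rw [bd_push hf hx.1]
  exact push_mem (hf.mono hA) hfA hx.2

lemma push_Bd {f : X → X'} {B A : Set X} {B' A' : Set X'} (hf : ContinuousOn f B) (hA : A ⊆ B)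
    (hfB : Set.MapsTo f B B') (hfA : Set.MapsTo f A A') {n : ℕ} {x : Chain n X}
    (hx : x ∈ Bd n B A) : push f n x ∈ Bd n B' A' := by
  obtain ⟨a, ha, b, hb, rfl⟩ := mem_Bd.1 hx
  rw [map_add, ← dd_push hf hb]
  exact Submodule.add_mem _ (sub_le_Bd _ _ _ (push_mem (hf.mono hA) hfA ha))
    (dd_mem_Bd _ (push_mem hf hfB hb))

/-- A homomorphism on chains that respects relative cycles and boundaries, and is injective and
surjective up to boundaries, gives an isomorphism in homology. -/
lemma equiv_of_chain {n m : ℕ} {B A : Set X} {B' A' : Set X'} (F : Chain n X →ₗ[ℤ] Chain m X')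
    (hZ : ∀ x ∈ Z n B A, F x ∈ Z m B' A') (hB : ∀ x ∈ Z n B A, x ∈ Bd n B A → F x ∈ Bd m B' A')
    (inj : ∀ x ∈ Z n B A, F x ∈ Bd m B' A' → x ∈ Bd n B A)
    (surj : ∀ y ∈ Z m B' A', ∃ x ∈ Z n B A, F x - y ∈ Bd m B' A') :
    Nonempty (H n B A ≃ₗ[ℤ] H m B' A') := by
  let G : Z n B A →ₗ[ℤ] Z m B' A' := F.restrict hZ
  let K : H n B A →ₗ[ℤ] H m B' A' := Submodule.mapQ _ _ G (by
    rintro ⟨x, hx⟩ hx'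
    exact hB x hx hx')
  refine ⟨LinearEquiv.ofBijective K ⟨?_, ?_⟩⟩
  · rw [← LinearMap.ker_eq_bot, LinearMap.ker_eq_bot']
    intro z hz
    obtain ⟨⟨x, hx⟩, rfl⟩ := Submodule.Quotient.mk_surjective _ z
    rw [Submodule.mapQ_apply, Submodule.Quotient.mk_eq_zero] at hz
    rw [Submodule.Quotient.mk_eq_zero]
    exact inj x hx hz
  · intro z
    obtain ⟨⟨y, hy⟩, rfl⟩ := Submodule.Quotient.mk_surjective _ z
    obtain ⟨x, hx, hxy⟩ := surj y hy
    refine ⟨Submodule.Quotient.mk ⟨x, hx⟩, ?_⟩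
    rw [Submodule.mapQ_apply, Submodule.Quotient.eq]
    exact hxy

lemma triv_iff {n : ℕ} {B A : Set X} : Triv n B A ↔ Subsingleton (H n B A) := by
  rw [Submodule.Quotient.subsingleton_iff, Submodule.comap_subtype_eq_top]
  rfl

lemma Triv.congr {n m : ℕ} {B A : Set X} {B' A' : Set X'}
    (h : Nonempty (H n B A ≃ₗ[ℤ] H m B' A')) : Triv n B A ↔ Triv m B' A' := by
  obtain ⟨e⟩ := h
  rw [triv_iff, triv_iff]
  exact e.toEquiv.subsingleton_congr

end Defs

section LongExact

variable {X : Type*} [TopologicalSpace X] {A B C : Set X}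

/-- The boundary map of a triple is an isomorphism where the homology of the big pair vanishes. -/
lemma equiv_boundary (hBC : B ⊆ C) {n : ℕ} (h0 : Triv n C A) (h1 : Triv (n + 1) C A)
    (hAB : A ⊆ B) : Nonempty (H (n + 1) C B ≃ₗ[ℤ] H n B A) := by
  refine equiv_of_chain (dd n) (fun x hx => mem_Z.2 ⟨hx.2, ?_⟩) (fun x _ hx => ?_)
    (fun x hx hd => ?_)
    (fun y hy => ?_)
  · rw [bd_dd]
    exact Submodule.zero_mem _
  · obtain ⟨b, hb, e, -, rfl⟩ := mem_Bd.1 hx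
    rw [map_add, dd_dd, add_zero]
    exact dd_mem_Bd _ hb
  · obtain ⟨a, ha, b, hb, hab⟩ := mem_Bd.1 hd
    have hz : x - b ∈ Z (n + 1) C A := by
      rw [mem_Z_succ]
      refine ⟨Submodule.sub_mem _ hx.1 (sub_mono _ hBC hb), ?_⟩
      rw [map_sub, ← hab, add_sub_cancel_right]
      exact ha
    have := Submodule.add_mem _ (Bd_mono _ subset_rfl hAB (h1 hz)) (sub_le_Bd _ C B hb)
    rwa [sub_add_cancel] at this
  · obtain ⟨a, ha, e, he, rfl⟩ := mem_Bd.1 (h0 (Z_mono n hBC subset_rfl hy))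
    refine ⟨e, mem_Z_succ.2 ⟨he, ?_⟩, ?_⟩
    · have := Submodule.sub_mem _ hy.1 (sub_mono _ hAB ha)
      rwa [add_sub_cancel_left] at this
    · rw [sub_add_cancel_right]
      exact Submodule.neg_mem _ (sub_le_Bd _ _ _ ha)

/-- The long exact sequence of a triple `A ⊆ B ⊆ C` near two vanishing groups of `(C, B)`. -/
lemma equiv_sub (hBC : B ⊆ C) {n : ℕ} (h0 : Triv n C B) (h1 : Triv (n + 1) C B) (hAB : A ⊆ B) :
    Nonempty (H n B A ≃ₗ[ℤ] H n C A) := by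
  refine equiv_of_chain LinearMap.id (fun x hx => Z_mono n hBC subset_rfl hx)
    (fun x _ hx => Bd_mono n hBC subset_rfl hx) (fun x hx hd => ?_) (fun y hy => ?_)
  · obtain ⟨a, ha, e, he, hae⟩ := mem_Bd.1 hd
    have hz : e ∈ Z (n + 1) C B := by
      refine mem_Z_succ.2 ⟨he, ?_⟩
      rw [eq_sub_of_add_eq' hae]
      exact Submodule.sub_mem _ hx.1 (sub_mono _ hAB ha)
    obtain ⟨b, hb, g, -, rfl⟩ := mem_Bd.1 (h1 hz)
    rw [map_add, dd_dd, add_zero] at hae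
    exact mem_Bd.2 ⟨a, ha, b, hb, hae⟩
  · obtain ⟨b, hb, e, he, rfl⟩ := mem_Bd.1 (h0 (Z_mono n subset_rfl hAB hy))
    refine ⟨b, mem_Z.2 ⟨hb, ?_⟩, ?_⟩
    · have := (mem_Z.1 hy).2
      rwa [map_add, bd_dd, add_zero] at this
    · rw [LinearMap.id_apply, sub_add_cancel_left, ← map_neg]
      exact dd_mem_Bd _ (Submodule.neg_mem _ he)

/-- The long exact sequence of a triple `A ⊆ B ⊆ C` near two vanishing groups of `(B, A)`. -/
lemma equiv_quot (hBC : B ⊆ C) {n : ℕ} (h0 : Triv n B A) (h1 : ∀ m, n = m + 1 → Triv m B A)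
    (hAB : A ⊆ B) : Nonempty (H n C A ≃ₗ[ℤ] H n C B) := by
  refine equiv_of_chain LinearMap.id (fun x hx => Z_mono n subset_rfl hAB hx)
    (fun x _ hx => Bd_mono n subset_rfl hAB hx) (fun x hx hd => ?_) (fun y hy => ?_)
  · obtain ⟨b, hb, e, he, rfl⟩ := mem_Bd.1 hd
    have hz : b ∈ Z n B A := by
      refine mem_Z.2 ⟨hb, ?_⟩
      have := (mem_Z.1 hx).2
      rwa [map_add, bd_dd, add_zero] at this
    exact Submodule.add_mem _ (Bd_mono n hBC subset_rfl (h0 hz)) (dd_mem_Bd _ he)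
  · cases n with
    | zero =>
      refine ⟨y, mem_Z_zero.2 hy.1, ?_⟩
      simp
    | succ m =>
      have hz : dd m y ∈ Z m B A := by
        refine mem_Z.2 ⟨hy.2, ?_⟩
        rw [bd_dd]
        exact Submodule.zero_mem _
      obtain ⟨a, ha, b, hb, hab⟩ := mem_Bd.1 (h1 m rfl hz)
      refine ⟨y - b, mem_Z_succ.2 ⟨Submodule.sub_mem _ hy.1 (sub_mono _ hBC hb), ?_⟩, ?_⟩
      · rw [map_sub, ← hab, add_sub_cancel_right]
        exact ha
      · rw [LinearMap.id_apply, sub_sub_cancel_left]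
        exact Submodule.neg_mem _ (sub_le_Bd _ _ _ hb)

/-- Exactness of the long exact sequence of a triple `A ⊆ B ⊆ C` at the group of `(C, A)`. -/
lemma triv_of_triv (hBC : B ⊆ C) {n : ℕ} (h0 : Triv n B A) (h1 : Triv n C B) (hAB : A ⊆ B) :
    Triv n C A := by
  intro x hx
  obtain ⟨b, hb, e, he, rfl⟩ := mem_Bd.1 (h1 (Z_mono n subset_rfl hAB hx))
  have hz : b ∈ Z n B A := by
    refine mem_Z.2 ⟨hb, ?_⟩
    have := (mem_Z.1 hx).2
    rwa [map_add, bd_dd, add_zero] at this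
  exact Submodule.add_mem _ (Bd_mono n hBC subset_rfl (h0 hz)) (dd_mem_Bd _ he)

/-- In degree zero, `H_0(C, B)` is a quotient of `H_0(C, A)`. -/
lemma triv_zero_quot (h : Triv 0 C A) (hAB : A ⊆ B) : Triv 0 C B := fun _ hx =>
  Bd_mono 0 subset_rfl hAB (h (mem_Z_zero.2 hx.1))

end LongExact

section Homotopy

variable {X X' : Type*} [TopologicalSpace X] [TopologicalSpace X']

lemma push_Sd_sub_push {B A : Set X} {B' A' : Set X'} {k : X × ℝ → X'} (hA : A ⊆ B)
    (hk : ContinuousOn k (B ×ˢ Set.Icc (0 : ℝ) 1))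
    (hB : Set.MapsTo k (B ×ˢ Set.Icc (0 : ℝ) 1) B')
    (hkA : Set.MapsTo k (A ×ˢ Set.Icc (0 : ℝ) 1) A') {n : ℕ} {x : Chain n X}
    (hx : x ∈ Z n B A) :
    push (fun x => k (x, 1)) n (Sd n x) - push (fun x => k (x, 0)) n x ∈ Bd n B' A' := by
  cases n with
  | zero =>
    rw [← dd_Pr_zero hk hx.1]
    exact dd_mem_Bd _ (Pr_mem hk hB hx.1)
  | succ n =>
    rw [eq_add_of_sub_eq (dd_Pr hk hx.1).symm]
    exact Submodule.add_mem _ (dd_mem_Bd _ (Pr_mem hk hB hx.1)) (sub_le_Bd _ _ _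
      (Pr_mem (hk.mono (Set.prod_mono hA subset_rfl)) hkA hx.2))

lemma Sd_sub_mem {B A : Set X} (hA : A ⊆ B) {n : ℕ} {x : Chain n X} (hx : x ∈ Z n B A) :
    Sd n x - x ∈ Bd n B A := by
  have := push_Sd_sub_push (k := Prod.fst) hA continuousOn_fst (fun p hp => hp.1)
    (fun p hp => hp.1) hx
  change push id n (Sd n x) - push id n x ∈ _ at this
  rwa [push_id, push_id] at this

lemma Sd_iterate_sub_mem {B A : Set X} (hA : A ⊆ B) {n : ℕ} {x : Chain n X} (hx : x ∈ Z n B A)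
    (m : ℕ) : (Sd n)^[m] x - x ∈ Bd n B A := by
  induction m with
  | zero => simp
  | succ m ih =>
    have hz : (Sd n)^[m] x ∈ Z n B A := by
      have := Submodule.add_mem _ (Bd_le_Z n hA ih) hx
      rwa [sub_add_cancel] at this
    rw [Function.iterate_succ_apply']
    have := Submodule.add_mem _ (Sd_sub_mem hA hz) ih
    rwa [sub_add_sub_cancel] at this

/-- Homotopic maps of pairs agree in homology. -/
lemma homotopy_invariance {B A : Set X} {B' A' : Set X'} {k : X × ℝ → X'} (hA : A ⊆ B)
    (hk : ContinuousOn k (B ×ˢ Set.Icc (0 : ℝ) 1))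
    (hB : Set.MapsTo k (B ×ˢ Set.Icc (0 : ℝ) 1) B')
    (hkA : Set.MapsTo k (A ×ˢ Set.Icc (0 : ℝ) 1) A') {n : ℕ} {x : Chain n X}
    (hx : x ∈ Z n B A) :
    push (fun x => k (x, 1)) n x - push (fun x => k (x, 0)) n x ∈ Bd n B' A' := by
  have h1 : (1 : ℝ) ∈ Set.Icc (0 : ℝ) 1 := by simp
  have hc : ContinuousOn (fun x => k (x, 1)) B :=
    hk.comp (f := fun x => (x, (1 : ℝ))) (by fun_prop) fun x hx => ⟨hx, h1⟩
  have h := push_Bd hc hA (fun x hx => hB ⟨hx, h1⟩) (fun x hx => hkA ⟨hx, h1⟩) (Sd_sub_mem hA hx)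
  have := Submodule.sub_mem _ (push_Sd_sub_push hA hk hB hkA hx) h
  rw [map_sub] at this
  convert this using 1
  abel

/-- An equivalence of pairs `(B, A)` and `(B', A')`: maps in both directions that are inverse to
each other on homology. -/
structure HEquiv (B A : Set X) (B' A' : Set X') where
  /-- the map from `B` to `B'` -/
  f : X → X'
  /-- the map from `B'` to `B` -/
  g : X' → X
  hA : A ⊆ B
  hA' : A' ⊆ B'
  hf : ContinuousOn f B
  hg : ContinuousOn g B'
  fB : Set.MapsTo f B B'
  fA : Set.MapsTo f A A'
  gB : Set.MapsTo g B' B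
  gA : Set.MapsTo g A' A
  left : ∀ (n : ℕ) (x : Chain n X), x ∈ Z n B A → push g n (push f n x) - x ∈ Bd n B A
  right : ∀ (n : ℕ) (x : Chain n X'), x ∈ Z n B' A' → push f n (push g n x) - x ∈ Bd n B' A'

/-- A map `g ∘ f` that is homotopic to the identity, through maps of the pair, acts trivially on
homology. -/
lemma homotopic_id {B A : Set X} {B' : Set X'} (hA : A ⊆ B) {f : X → X'} {g : X' → X}
    (hf : ContinuousOn f B) (hg : ContinuousOn g B') (fB : Set.MapsTo f B B')
    (k : X × ℝ → X) (hk : ContinuousOn k (B ×ˢ Set.Icc (0 : ℝ) 1))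
    (kB : Set.MapsTo k (B ×ˢ Set.Icc (0 : ℝ) 1) B) (kA : Set.MapsTo k (A ×ˢ Set.Icc (0 : ℝ) 1) A)
    (k0 : ∀ x ∈ B, k (x, 0) = x) (k1 : ∀ x ∈ B, k (x, 1) = g (f x)) (n : ℕ) (x : Chain n X)
    (hx : x ∈ Z n B A) : push g n (push f n x) - x ∈ Bd n B A := by
  have := homotopy_invariance hA hk kB kA hx
  rw [push_congr (g := g ∘ f) (fun x hx => k1 x hx) hx.1,
    push_congr (g := id) (fun x hx => k0 x hx) hx.1, push_id] at this
  rwa [push_push hf fB hg hx.1]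

lemma HEquiv.equiv {B A : Set X} {B' A' : Set X'} (e : HEquiv B A B' A') (n : ℕ) :
    Nonempty (H n B A ≃ₗ[ℤ] H n B' A') := by
  refine equiv_of_chain (push e.f n) (fun x hx => push_Z e.hf e.hA e.fB e.fA hx)
    (fun x _ hx => push_Bd e.hf e.hA e.fB e.fA hx) (fun x hx hd => ?_) (fun y hy => ?_)
  · have := Submodule.sub_mem _ (push_Bd e.hg e.hA' e.gB e.gA hd) (e.left n x hx)
    rwa [sub_sub_cancel] at this
  · exact ⟨push e.g n y, push_Z e.hg e.hA' e.gB e.gA hy, e.right n y hy⟩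

/-- A homeomorphism of pairs, as an equivalence. -/
def HEquiv.ofInverse {B A : Set X} {B' A' : Set X'} (f : X → X') (g : X' → X) (hA : A ⊆ B)
    (hA' : A' ⊆ B') (hf : ContinuousOn f B) (hg : ContinuousOn g B') (fB : Set.MapsTo f B B')
    (fA : Set.MapsTo f A A') (gB : Set.MapsTo g B' B) (gA : Set.MapsTo g A' A)
    (gf : ∀ x ∈ B, g (f x) = x) (fg : ∀ y ∈ B', f (g y) = y) : HEquiv B A B' A' where
  f := f
  g := g
  hA := hA
  hA' := hA'
  hf := hf
  hg := hg
  fB := fB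
  fA := fA
  gB := gB
  gA := gA
  left n x hx := by
    rw [push_push hf fB hg hx.1, push_congr (f := g ∘ f) (g := id) (fun x hx => gf x hx) hx.1,
      push_id, sub_self]
    exact Submodule.zero_mem _
  right n x hx := by
    rw [push_push hg gB hf hx.1, push_congr (f := f ∘ g) (g := id) (fun x hx => fg x hx) hx.1,
      push_id, sub_self]
    exact Submodule.zero_mem _

end Homotopy

section Excision

variable {X : Type*} [TopologicalSpace X]

/-- Excision, for a union of two open subsets. -/
theorem excision {U V : Set X} (hU : IsOpen U) (hV : IsOpen V) (n : ℕ) :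
    Nonempty (H n U (U ∩ V) ≃ₗ[ℤ] H n (U ∪ V) V) := by
  refine equiv_of_chain LinearMap.id
    (fun x hx => Z_mono n Set.subset_union_left Set.inter_subset_right hx)
    (fun x _ hx => Bd_mono n Set.subset_union_left Set.inter_subset_right hx)
    (fun x hx hd => ?_) (fun y hy => ?_)
  · obtain ⟨v, hv, e, he, hve⟩ := mem_Bd.1 hd
    obtain ⟨m, hm⟩ := exists_Sd_iterate_mem hU hV he
    obtain ⟨eU, heU, eV, heV, hsum⟩ := Submodule.mem_sup.1 (hm m le_rfl)
    have hSdV : ∀ m, (Sd n)^[m] v ∈ sub n V := fun m => by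
      induction m with
      | zero => exact hv
      | succ m ih =>
        rw [Function.iterate_succ_apply']
        exact Sd_mem ih
    have hSdU : ∀ m, (Sd n)^[m] x ∈ sub n U := fun m => by
      induction m with
      | zero => exact hx.1
      | succ m ih =>
        rw [Function.iterate_succ_apply']
        exact Sd_mem ih
    have hcomm : ∀ m, (Sd n)^[m] (dd n e) = dd n ((Sd (n + 1))^[m] e) := fun m => by
      induction m with
      | zero => rfl
      | succ m ih => rw [Function.iterate_succ_apply', Function.iterate_succ_apply', ih, dd_Sd]
    have heq : (Sd n)^[m] x - dd n eU = (Sd n)^[m] v + dd n eV := by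
      have : (Sd n)^[m] x = (Sd n)^[m] v + (Sd n)^[m] (dd n e) := by
        rw [← iterate_map_add, hve]
        rfl
      rw [this, hcomm, ← hsum, map_add]
      abel
    have hmem : (Sd n)^[m] x - dd n eU ∈ sub n (U ∩ V) := by
      rw [sub_inter]
      refine ⟨Submodule.sub_mem _ (hSdU m) (dd_mem heU), ?_⟩
      rw [heq]
      exact Submodule.add_mem _ (hSdV m) (dd_mem heV)
    have h1 := Submodule.add_mem _ (sub_le_Bd n U _ hmem) (dd_mem_Bd (U ∩ V) heU)
    rw [sub_add_cancel] at h1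
    have h2 := Submodule.sub_mem _ h1 (Sd_iterate_sub_mem Set.inter_subset_left hx m)
    rwa [sub_sub_cancel] at h2
  · obtain ⟨m, hm⟩ := exists_Sd_iterate_mem hU hV hy.1
    obtain ⟨a, ha, b, hb, hsum⟩ := Submodule.mem_sup.1 (hm m le_rfl)
    have hVU : V ⊆ U ∪ V := Set.subset_union_right
    have h1 := Sd_iterate_sub_mem hVU hy m
    have hz : (Sd n)^[m] y ∈ Z n (U ∪ V) V := by
      have := Submodule.add_mem _ (Bd_le_Z n hVU h1) hy
      rwa [sub_add_cancel] at this
    refine ⟨a, mem_Z.2 ⟨ha, ?_⟩, ?_⟩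
    · rw [sub_inter]
      refine ⟨bd_mem ha, ?_⟩
      have := Submodule.sub_mem _ (mem_Z.1 hz).2 (bd_mem hb)
      rwa [← hsum, map_add, add_sub_cancel_right] at this
    · rw [LinearMap.id_apply, eq_sub_of_add_eq hsum]
      have := Submodule.sub_mem _ h1 (sub_le_Bd n (U ∪ V) _ hb)
      convert this using 1
      abel

end Excision


/-! ### Comparison with the singular homology of Mathlib -/

/-- The homology of a short complex of modules, computed in a module isomorphic to its middle
term. -/
lemma homology_equiv_quotient {R : Type} [Ring R] (S : ShortComplex (ModuleCat.{0} R)) {M : Type}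
    [AddCommGroup M] [Module R M] (e : M ≃ₗ[R] S.X₂) (Z B : Submodule R M)
    (hZ : ∀ x, x ∈ Z ↔ S.g.hom (e x) = 0) (hB : ∀ x, x ∈ B ↔ ∃ y, S.f.hom y = e x) :
    Nonempty (S.homology ≃ₗ[R] Z ⧸ B.comap Z.subtype) := by
  let φ : Z →ₗ[R] LinearMap.ker S.g.hom :=
    LinearMap.codRestrict (LinearMap.ker S.g.hom) (e.toLinearMap ∘ₗ Z.subtype)
      fun x => LinearMap.mem_ker.2 ((hZ x.1).1 x.2)
  let ψ : Z →ₗ[R] (LinearMap.ker S.g.hom ⧸ LinearMap.range S.moduleCatToCycles) :=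
    (LinearMap.range S.moduleCatToCycles).mkQ ∘ₗ φ
  have hsurj : Function.Surjective ψ := by
    refine (Submodule.mkQ_surjective _).comp ?_
    rintro ⟨y, hy⟩
    refine ⟨⟨e.symm y, (hZ _).2 ?_⟩, Subtype.ext (e.apply_symm_apply y)⟩
    rw [e.apply_symm_apply]
    exact hy
  have hker : B.comap Z.subtype = LinearMap.ker ψ := by
    ext ⟨x, hx⟩
    rw [LinearMap.mem_ker, LinearMap.comp_apply, Submodule.mkQ_apply,
      Submodule.Quotient.mk_eq_zero, LinearMap.mem_range, Submodule.mem_comap]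
    refine (hB x).trans ⟨?_, ?_⟩
    · rintro ⟨y, hy⟩
      exact ⟨y, Subtype.ext hy⟩
    · rintro ⟨y, hy⟩
      exact ⟨y, congrArg Subtype.val hy⟩
  exact ⟨S.moduleCatHomologyIso.toLinearEquiv.trans
    ((Submodule.quotEquivOfEq _ _ hker).trans (ψ.quotKerEquivOfSurjective hsurj)).symm⟩

section Comparison

open Simplicial Opposite

variable (X : Type) [TopologicalSpace X]

/-- The singular chain complex of `X` with integral coefficients. -/
abbrev singC : ChainComplex (ModuleCat.{0} ℤ) ℕ :=
  ((singularChainComplexFunctor (ModuleCat.{0} ℤ)).obj (ModuleCat.of ℤ ℤ)).obj (TopCat.of X)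

/-- The singular simplicial set of `X`. -/
abbrev singS : SSet.{0} := TopCat.toSSet.obj (TopCat.of X)

/-- The singular simplices of `X`, as simplices of the singular simplicial set. -/
abbrev simpEquiv (n : ℕ) : (singS X) _⦋n⦌ ≃ C(Δ n, X) :=
  TopCat.toSSetObjEquiv (TopCat.of X) (op ⦋n⦌)

variable {X}

lemma simpEquiv_delta (n : ℕ) (s : (singS X) _⦋n + 1⦌) (i : Fin (n + 2)) :
    simpEquiv X n ((singS X).δ i s) = (simpEquiv X (n + 1) s).comp (faceMap n i) := by
  rfl

/-- The generator of the singular chain group given by a simplex. -/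
abbrev gen (n : ℕ) (s : (singS X) _⦋n⦌) : ModuleCat.of ℤ ℤ ⟶ (singC X).X n :=
  SSet.ιChainComplex (R := ModuleCat.of ℤ ℤ) (singS X) s

/-- The comparison map from the free group on singular simplices to Mathlib's chain group. -/
def toSing (n : ℕ) : Chain n X →ₗ[ℤ] (singC X).X n :=
  Finsupp.linearCombination ℤ fun σ => (gen n ((simpEquiv X n).symm σ)).hom (1 : ℤ)

/-- The inverse of the comparison map. -/
def ofSing (n : ℕ) : (singC X).X n ⟶ ModuleCat.of ℤ (Chain n X) :=
  Limits.Cofan.IsColimit.desc (SSet.isColimitChainComplexXCofan (singS X) (ModuleCat.of ℤ ℤ) n)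
    fun s => ModuleCat.ofHom (Finsupp.lsingle (simpEquiv X n s))

lemma gen_ofSing (n : ℕ) (s : (singS X) _⦋n⦌) :
    gen n s ≫ ofSing n = ModuleCat.ofHom (Finsupp.lsingle (simpEquiv X n s)) :=
  Limits.Cofan.IsColimit.fac
    (SSet.isColimitChainComplexXCofan (singS X) (ModuleCat.of ℤ ℤ) n) _ _

lemma toSing_single (n : ℕ) (σ : C(Δ n, X)) :
    toSing n (Finsupp.single σ 1) = (gen n ((simpEquiv X n).symm σ)).hom (1 : ℤ) := by
  rw [toSing, Finsupp.linearCombination_single]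
  exact @one_smul ℤ ((singC X).X n) _ ((singC X).X n).isModule.toMulAction _

lemma ofSing_toSing (n : ℕ) (x : Chain n X) : (ofSing n).hom (toSing n x) = x := by
  refine lin_ext (F := (ofSing n).hom ∘ₗ toSing n) (G := LinearMap.id) (fun σ => ?_) x
  rw [LinearMap.comp_apply, toSing_single]
  have := congrArg (fun f => f.hom (1 : ℤ)) (gen_ofSing n ((simpEquiv X n).symm σ))
  simpa using this

lemma toSing_ofSing (n : ℕ) (x : (singC X).X n) : toSing n ((ofSing n).hom x) = x := by
  have h : ofSing n ≫ ModuleCat.ofHom (toSing n) = 𝟙 ((singC X).X n) := by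
    refine SSet.chainComplex_hom_ext (X := singS X) (R := ModuleCat.of ℤ ℤ) fun s => ?_
    change gen n s ≫ ofSing n ≫ ModuleCat.ofHom (toSing n) = gen n s ≫ 𝟙 _
    rw [← Category.assoc, gen_ofSing, Category.comp_id]
    ext
    change toSing n (Finsupp.single (simpEquiv X n s) 1) = _
    rw [toSing_single, Equiv.symm_apply_apply]
  exact congrArg (fun f => f.hom x) h

lemma hom_zsmul_apply {M N : ModuleCat.{0} ℤ} (f : M ⟶ N) (k : ℤ) (x : M) :
    (k • f).hom x = N.isModule.toSMul.smul k (f.hom x) := by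
  rw [ModuleCat.hom_zsmul]
  change k • f.hom x = _
  exact (int_smul_eq_zsmul N.isModule k (f.hom x)).symm

lemma d_toSing (n : ℕ) (x : Chain (n + 1) X) :
    ((singC X).d (n + 1) n).hom (toSing (n + 1) x) = toSing n (dd n x) := by
  refine lin_ext (F := ((singC X).d (n + 1) n).hom ∘ₗ toSing (n + 1)) (G := toSing n ∘ₗ dd n)
    (fun σ => ?_) x
  rw [LinearMap.comp_apply, toSing_single, LinearMap.comp_apply, dd_single, map_sum]
  have := congrArg (fun f => f.hom (1 : ℤ))
    (SSet.ιChainComplex_d (R := ModuleCat.of ℤ ℤ) (singS X) ((simpEquiv X (n + 1)).symm σ))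
  refine Eq.trans this ?_
  simp only [ModuleCat.hom_sum, LinearMap.sum_apply]
  refine Finset.sum_congr rfl fun i _ => ?_
  rw [LinearMap.map_smul, toSing_single]
  have h : (simpEquiv X n).symm (σ.comp (faceMap n i)) =
      (singS X).δ i ((simpEquiv X (n + 1)).symm σ) := by
    rw [Equiv.symm_apply_eq, simpEquiv_delta, Equiv.apply_symm_apply]
  rw [h]
  exact hom_zsmul_apply _ _ _

lemma d_toSing' (n : ℕ) (x : Chain n X) :
    ((singC X).d n (n - 1)).hom (toSing n x) = toSing (n - 1) (bd n x) := by
  cases n with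
  | zero =>
    rw [bd_zero, HomologicalComplex.shape _ _ _ (by simp)]
    simp
  | succ n => exact d_toSing n x

lemma toSing_injective (n : ℕ) : Function.Injective (toSing (X := X) n) :=
  Function.LeftInverse.injective (ofSing_toSing n)

lemma mem_Z_univ {n : ℕ} {x : Chain n X} : x ∈ Z n Set.univ ∅ ↔ bd n x = 0 := by
  rw [mem_Z, sub_univ, sub_empty]
  simp

lemma mem_Bd_univ {n : ℕ} {x : Chain n X} : x ∈ Bd n Set.univ ∅ ↔ ∃ b, dd n b = x := by
  rw [mem_Bd, sub_univ, sub_empty]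
  simp

/-- The comparison map as an equivalence. -/
def toSingEquiv (n : ℕ) : Chain n X ≃ₗ[ℤ] (singC X).X n :=
  { toSing n with
    invFun := (ofSing n).hom
    left_inv := ofSing_toSing n
    right_inv := toSing_ofSing n }

/-- The homology of the concrete singular chain groups is Mathlib's singular homology. -/
theorem nonempty_equiv_integralHomology (n : ℕ) :
    Nonempty (QuatThom.integralHomology n X ≃ₗ[ℤ] H n (Set.univ : Set X) ∅) := by
  have hprev : (ComplexShape.down ℕ).prev n = n + 1 := by simp
  have hnext : (ComplexShape.down ℕ).next n = n - 1 := by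
    cases n with
    | zero => simp
    | succ n => simp
  obtain ⟨e⟩ := homology_equiv_quotient ((singC X).sc' (n + 1) n (n - 1)) (toSingEquiv n)
    (Z n Set.univ ∅) (Bd n Set.univ ∅) (fun x => by
      rw [mem_Z_univ, ← (toSing_injective (n - 1)).eq_iff, ← d_toSing', map_zero]
      rfl) (fun x => by
      rw [mem_Bd_univ]
      constructor
      · rintro ⟨b, rfl⟩
        exact ⟨toSing (n + 1) b, d_toSing n b⟩
      · rintro ⟨b, hb⟩
        refine ⟨(ofSing (n + 1)).hom b, ?_⟩
        apply toSing_injective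
        rw [← d_toSing]
        exact (congrArg ((singC X).d (n + 1) n).hom (toSing_ofSing (n + 1) b)).trans hb)
  exact ⟨(ShortComplex.homologyMapIso
    ((singC X).isoSc' (n + 1) n (n - 1) hprev hnext)).toLinearEquiv.trans e⟩

end Comparison


/-! ### Degree zero and contractible sets -/

section DegreeZero

variable {X X' : Type} [TopologicalSpace X] [TopologicalSpace X']

/-- The augmentation on `0`-chains. -/
def aug : Chain 0 X →ₗ[ℤ] ℤ := Finsupp.linearCombination ℤ fun _ => (1 : ℤ)

lemma aug_single (σ : C(Δ 0, X)) : aug (Finsupp.single σ 1) = 1 := by simp [aug]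

lemma aug_dd (x : Chain 1 X) : aug (dd 0 x) = 0 := by
  refine lin_ext (F := aug ∘ₗ dd 0) (G := 0) (fun σ => ?_) x
  rw [LinearMap.comp_apply, dd_single, map_sum, Fin.sum_univ_two, map_smul, map_smul, aug_single,
    aug_single]
  simp

lemma aug_push {f : X → X'} {B : Set X} (hf : ContinuousOn f B) {x : Chain 0 X}
    (hx : x ∈ sub 0 B) : aug (push f 0 x) = aug x := by
  refine supported_ext (F := aug ∘ₗ push f 0) (G := aug) (fun σ hσ => ?_) hx
  rw [LinearMap.comp_apply, push_single (continuous_comp hf hσ), aug_single, aug_single]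

/-- The `0`-simplex at a point. -/
def pt (x : X) : C(Δ 0, X) := ContinuousMap.const _ x

lemma eq_pt (σ : C(Δ 0, X)) : σ = pt (σ default) := by
  ext t
  rw [Subsingleton.elim t default]
  rfl

lemma path_chain {B : Set X} {x y : X} (h : JoinedIn B x y) :
    ∃ b ∈ sub 1 B, dd 0 b = Finsupp.single (pt y) 1 - Finsupp.single (pt x) 1 := by
  obtain ⟨γ, hγ⟩ := h
  let σ : C(Δ 1, X) := ⟨fun t => γ (Set.projIcc 0 1 zero_le_one (t.1 1)), by
    have : Continuous fun t : Δ 1 => t.1 1 := (continuous_apply 1).comp continuous_subtype_val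
    exact γ.continuous.comp (continuous_projIcc.comp this)⟩
  refine ⟨Finsupp.single σ 1, single_mem_sub (fun t => hγ _) _, ?_⟩
  have h0 : σ.comp (faceMap 0 0) = pt y := by
    ext t
    have h1 : (faceMap 0 0 t).1 1 = 1 :=
      (faceMap_apply_succAbove 0 0 t 0).trans (by simpa using t.2.2)
    change γ (Set.projIcc 0 1 zero_le_one ((faceMap 0 0 t).1 1)) = y
    rw [h1, Set.projIcc_right]
    exact γ.target
  have h1 : σ.comp (faceMap 0 1) = pt x := by
    ext t
    change γ (Set.projIcc 0 1 zero_le_one ((faceMap 0 1 t).1 1)) = x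
    rw [faceMap_apply_same 0 1 t, Set.projIcc_left]
    exact γ.source
  rw [dd_single, Fin.sum_univ_two, h0, h1]
  simp [sub_eq_add_neg]

lemma mem_Bd_of_aug {B : Set X} (hB : IsPathConnected B) {x : Chain 0 X} (hx : x ∈ sub 0 B)
    (h0 : aug x = 0) : x ∈ Bd 0 B ∅ := by
  obtain ⟨p, hp, hj⟩ := hB
  have key : x - aug x • Finsupp.single (pt p) 1 ∈ Bd 0 B ∅ := by
    refine supported_induction (P := Bd 0 B ∅)
      (LinearMap.id - aug.smulRight (Finsupp.single (pt p) (1 : ℤ))) (fun σ hσ => ?_) hx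
    rw [LinearMap.sub_apply, LinearMap.smulRight_apply, aug_single, one_smul, LinearMap.id_apply,
      eq_pt σ]
    obtain ⟨b, hb, hd⟩ := path_chain (hj (hσ default))
    rw [← hd]
    exact dd_mem_Bd _ hb
  rwa [h0, zero_smul, sub_zero] at key

lemma aug_eq_zero {B : Set X} {x : Chain 0 X} (hx : x ∈ Bd 0 B ∅) : aug x = 0 := by
  obtain ⟨a, ha, b, -, rfl⟩ := mem_Bd.1 hx
  rw [sub_empty, Submodule.mem_bot] at ha
  rw [map_add, aug_dd, ha, map_zero, add_zero]

/-- The zeroth homology of a path connected set. -/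
lemma equiv_int_of_isPathConnected {B : Set X} (hB : IsPathConnected B) :
    Nonempty (H 0 B ∅ ≃ₗ[ℤ] ℤ) := by
  let φ : Z 0 B ∅ →ₗ[ℤ] ℤ := aug ∘ₗ (Z 0 B ∅).subtype
  have hs : Function.Surjective φ := by
    intro k
    obtain ⟨p, hp, -⟩ := hB
    refine ⟨k • ⟨Finsupp.single (pt p) 1, mem_Z_zero.2 (single_mem_sub (fun _ => hp) _)⟩, ?_⟩
    rw [map_smul]
    change k • aug (Finsupp.single (pt p) 1) = k
    rw [aug_single]
    simp
  have hk : (Bd 0 B ∅).comap (Z 0 B ∅).subtype = LinearMap.ker φ := by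
    ext ⟨x, hx⟩
    exact ⟨fun h => aug_eq_zero h, fun h => mem_Bd_of_aug hB hx.1 h⟩
  exact ⟨(Submodule.quotEquivOfEq _ _ hk).trans (φ.quotKerEquivOfSurjective hs)⟩

lemma triv_unit (n : ℕ) : Triv (n + 1) (Set.univ : Set Unit) ∅ := by
  have huniq : ∀ (m : ℕ) (σ τ : C(Δ m, Unit)), σ = τ := fun m σ τ => by
    ext
  let u : ∀ m, C(Δ m, Unit) := fun m => ContinuousMap.const _ ()
  have hrep : ∀ (m : ℕ) (x : Chain m Unit), ∃ c : ℤ, x = c • Finsupp.single (u m) 1 := by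
    intro m x
    refine ⟨x (u m), ?_⟩
    ext σ
    rw [huniq m σ (u m)]
    simp
  have hdd : ∀ m, dd m (Finsupp.single (u (m + 1)) 1) =
      (if Even m then (0 : ℤ) else 1) • Finsupp.single (u m) (1 : ℤ) := by
    intro m
    have h1 : (∑ i : Fin (m + 2), (-1 : ℤ) ^ (i : ℕ)) = if Even m then 0 else 1 := by
      rw [Fin.sum_neg_one_pow]
      simp [Nat.even_add]
    rw [dd_single, ← h1, Finset.sum_smul]
    exact Finset.sum_congr rfl fun i _ => by rw [huniq m ((u (m + 1)).comp (faceMap m i)) (u m)]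
  intro x hx
  rw [mem_Z_univ] at hx
  rw [mem_Bd_univ]
  obtain ⟨c, rfl⟩ := hrep _ x
  rw [bd_succ, map_smul, hdd] at hx
  by_cases hn : Even n
  · refine ⟨c • Finsupp.single (u (n + 2)) 1, ?_⟩
    have : ¬ Even (n + 1) := by
      rw [Nat.even_add_one]
      simpa using hn
    rw [map_smul, hdd, if_neg this, one_smul]
  · rw [if_neg hn, one_smul] at hx
    have hc : c = 0 := by
      have := congrArg (fun y => y (u n)) hx
      simpa using this
    exact ⟨0, by simp [hc]⟩

/-- The homology of a set that contracts to one of its points. -/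
lemma contractible_homology {B : Set X} {p : X} (hp : p ∈ B) {k : X × ℝ → X}
    (hk : ContinuousOn k (B ×ˢ Set.Icc (0 : ℝ) 1))
    (kB : Set.MapsTo k (B ×ˢ Set.Icc (0 : ℝ) 1) B) (k0 : ∀ x ∈ B, k (x, 0) = x)
    (k1 : ∀ x ∈ B, k (x, 1) = p) :
    Nonempty (H 0 B ∅ ≃ₗ[ℤ] ℤ) ∧ ∀ n, Triv (n + 1) B ∅ := by
  let e : HEquiv B ∅ (Set.univ : Set Unit) ∅ :=
    { f := fun _ => ()
      g := fun _ => p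
      hA := Set.empty_subset _
      hA' := Set.empty_subset _
      hf := continuousOn_const
      hg := continuousOn_const
      fB := fun _ _ => trivial
      fA := fun _ h => h
      gB := fun _ _ => hp
      gA := fun _ h => h.elim
      left := homotopic_id (Set.empty_subset _) continuousOn_const continuousOn_const
        (Set.mapsTo_univ _ _) k hk kB (fun x hx => hx.1.elim) k0 k1
      right := homotopic_id (Set.empty_subset _) (g := fun _ => ()) continuousOn_const
        continuousOn_const (fun _ _ => hp) Prod.fst continuousOn_fst (Set.mapsTo_univ _ _)
        (fun x hx => hx.1) (fun _ _ => rfl) (fun _ _ => rfl) }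
  refine ⟨?_, fun n => (Triv.congr (e.equiv (n + 1))).2 (triv_unit n)⟩
  obtain ⟨e0⟩ := e.equiv 0
  obtain ⟨e1⟩ := equiv_int_of_isPathConnected (X := Unit) (B := Set.univ) isPathConnected_univ
  exact ⟨e0.trans e1⟩

end DegreeZero

/-! ### Suspension -/

section Suspension

variable {X : Type} [TopologicalSpace X]

/-- If a pair `(B, A)` can be deformed into `A`, then its homology vanishes. -/
lemma triv_of_deformation {B A : Set X} (hA : A ⊆ B) {k : X × ℝ → X}
    (hk : ContinuousOn k (B ×ˢ Set.Icc (0 : ℝ) 1))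
    (kB : Set.MapsTo k (B ×ˢ Set.Icc (0 : ℝ) 1) B) (kA : Set.MapsTo k (A ×ˢ Set.Icc (0 : ℝ) 1) A)
    (k0 : ∀ x ∈ B, k (x, 0) = x) (k1 : ∀ x ∈ B, k (x, 1) ∈ A) (n : ℕ) : Triv n B A := by
  intro x hx
  have h := homotopy_invariance hA hk kB kA hx
  rw [push_congr (f := fun x => k (x, 0)) (g := id) k0 hx.1, push_id] at h
  have hc : ContinuousOn (fun x => k (x, 1)) B :=
    hk.comp (f := fun x => (x, (1 : ℝ))) (by fun_prop) fun x hx => ⟨hx, by simp⟩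
  have := Submodule.sub_mem _ (sub_le_Bd n B A (push_mem hc k1 hx.1)) h
  rwa [sub_sub_cancel] at this

/-- The suspension isomorphism. Here `T` carries a flow `τ` along which the function `t` has unit
speed, and `W` is invariant under the flow, so that `T` is the product of `ℝ` with the zero set of
`t`. -/
theorem suspension {T W : Set X} (hT : IsOpen T) (hW : IsOpen W) (hWT : W ⊆ T) {t : X → ℝ}
    (ht : ContinuousOn t T) {τ : X × ℝ → X} (hτ : ContinuousOn τ (T ×ˢ Set.univ))
    (τT : ∀ x ∈ T, ∀ s, τ (x, s) ∈ T) (τW : ∀ x ∈ W, ∀ s, τ (x, s) ∈ W)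
    (tτ : ∀ x ∈ T, ∀ s, t (τ (x, s)) = t x + s) (τ0 : ∀ x ∈ T, τ (x, 0) = x) :
    (∀ n, Nonempty (H (n + 1) T ({x ∈ T | t x ≠ 0} ∪ W) ≃ₗ[ℤ] H n T W)) ∧
      Triv 0 T ({x ∈ T | t x ≠ 0} ∪ W) := by
  set P : Set X := {x ∈ T | 0 < t x} ∪ W with hP
  set M : Set X := {x ∈ T | t x < 0} ∪ W with hM
  have hPo : IsOpen P := (ht.isOpen_inter_preimage hT isOpen_Ioi).union hW
  have hMo : IsOpen M := (ht.isOpen_inter_preimage hT isOpen_Iio).union hW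
  have hPT : P ⊆ T := Set.union_subset (fun x hx => hx.1) hWT
  have hMT : M ⊆ T := Set.union_subset (fun x hx => hx.1) hWT
  have hMP : M ∪ P = {x ∈ T | t x ≠ 0} ∪ W := by
    ext x
    simp only [hP, hM, Set.mem_union, Set.mem_ofPred_eq, ne_iff_lt_or_gt]
    tauto
  have hMiP : M ∩ P = W := by
    ext x
    simp only [hP, hM, Set.mem_union, Set.mem_inter_iff, Set.mem_ofPred_eq]
    constructor
    · rintro ⟨h1 | h1, h2 | h2⟩
      · exact absurd h1.2 (not_lt.2 h2.2.le)
      all_goals assumption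
    · exact fun h => ⟨Or.inr h, Or.inr h⟩
  -- the deformation along the flow that moves the height from `t` to `c (|t| + 1)`
  let k : ℝ → X × ℝ → X := fun c p => τ (p.1, p.2 * (c * (|t p.1| + 1) - t p.1))
  have hk : ∀ c, ContinuousOn (k c) (T ×ˢ Set.Icc (0 : ℝ) 1) := by
    intro c
    have ht' : ContinuousOn (fun p : X × ℝ => t p.1) (T ×ˢ Set.Icc (0 : ℝ) 1) :=
      ht.comp continuousOn_fst fun p hp => hp.1
    refine hτ.comp (f := fun p : X × ℝ => (p.1, p.2 * (c * (|t p.1| + 1) - t p.1))) ?_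
      fun p hp => ⟨hp.1, trivial⟩
    exact continuousOn_fst.prodMk (continuousOn_snd.mul
      ((continuousOn_const.mul (ht'.abs.add continuousOn_const)).sub ht'))
  have kT : ∀ c, Set.MapsTo (k c) (T ×ˢ Set.Icc (0 : ℝ) 1) T := fun c p hp => τT _ hp.1 _
  have kW : ∀ c, Set.MapsTo (k c) (W ×ˢ Set.Icc (0 : ℝ) 1) W := fun c p hp => τW _ hp.1 _
  have k0 : ∀ c, ∀ x ∈ T, k c (x, 0) = x := fun c x hx => by
    simp only [k, zero_mul]
    exact τ0 x hx
  have tk : ∀ c, ∀ x ∈ T, ∀ s, t (k c (x, s)) = (1 - s) * t x + s * (c * (|t x| + 1)) := by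
    intro c x hx s
    rw [show k c (x, s) = τ (x, s * (c * (|t x| + 1) - t x)) from rfl, tτ x hx]
    ring
  have kP : Set.MapsTo (k 1) (P ×ˢ Set.Icc (0 : ℝ) 1) P := by
    rintro ⟨x, s⟩ ⟨hx | hx, hs⟩
    · refine Or.inl ⟨τT _ hx.1 _, ?_⟩
      rw [Set.mem_Icc] at hs
      have h2 : 0 < t x := hx.2
      rw [tk 1 x hx.1, abs_of_pos h2]
      nlinarith [hs.1, hs.2]
    · exact Or.inr (kW 1 ⟨hx, hs⟩)
  have kM : Set.MapsTo (k (-1)) (M ×ˢ Set.Icc (0 : ℝ) 1) M := by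
    rintro ⟨x, s⟩ ⟨hx | hx, hs⟩
    · refine Or.inl ⟨τT _ hx.1 _, ?_⟩
      rw [Set.mem_Icc] at hs
      have h2 : t x < 0 := hx.2
      rw [tk (-1) x hx.1, abs_of_neg h2]
      nlinarith [hs.1, hs.2]
    · exact Or.inr (kW (-1) ⟨hx, hs⟩)
  have k1P : ∀ x ∈ T, k 1 (x, 1) ∈ P := fun x hx => by
    refine Or.inl ⟨τT _ hx _, ?_⟩
    rw [tk 1 x hx]
    have := abs_nonneg (t x)
    linarith
  have k1M : ∀ x ∈ T, k (-1) (x, 1) ∈ M := fun x hx => by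
    refine Or.inl ⟨τT _ hx _, ?_⟩
    rw [tk (-1) x hx]
    have := abs_nonneg (t x)
    linarith
  have htriv : ∀ n, Triv n T P := triv_of_deformation hPT (hk 1) (kT 1) kP (k0 1) k1P
  have hPQ : P ⊆ {x ∈ T | t x ≠ 0} ∪ W := hMP ▸ Set.subset_union_right
  refine ⟨fun n => ?_, triv_zero_quot (htriv 0) hPQ⟩
  have hQT : {x ∈ T | t x ≠ 0} ∪ W ⊆ T := hMP ▸ Set.union_subset hMT hPT
  obtain ⟨e1⟩ := equiv_boundary hQT (htriv n) (htriv (n + 1)) hPQ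
  obtain ⟨e2⟩ := excision hMo hPo n
  rw [hMiP, hMP] at e2
  have hk1 : ContinuousOn (fun x => k (-1) (x, 1)) T :=
    (hk (-1)).comp (f := fun x => (x, (1 : ℝ))) (by fun_prop) fun x hx => ⟨hx, by simp⟩
  have hW1 : Set.MapsTo (fun x => k (-1) (x, 1)) W W := fun x hx => τW _ hx _
  let e3 : HEquiv M W T W :=
    { f := id
      g := fun x => k (-1) (x, 1)
      hA := Set.subset_union_right
      hA' := hWT
      hf := continuousOn_id
      hg := hk1
      fB := hMT
      fA := fun _ h => h
      gB := k1M
      gA := hW1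
      left := homotopic_id Set.subset_union_right continuousOn_id hk1 hMT (k (-1))
        ((hk (-1)).mono (Set.prod_mono hMT subset_rfl)) kM (kW (-1))
        (fun x hx => k0 (-1) x (hMT hx)) (fun _ _ => rfl)
      right := homotopic_id (B' := M) hWT hk1 continuousOn_id k1M (k (-1)) (hk (-1)) (kT (-1))
        (kW (-1)) (k0 (-1)) (fun _ _ => rfl) }
  obtain ⟨e3⟩ := e3.equiv n
  exact ⟨e1.trans (e2.symm.trans e3)⟩

/-- The iterated suspension isomorphism, for a set `T` with commuting flows `τ i` along which the
functions `t i` are coordinates. -/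
theorem iterated_suspension {ι : Type} [DecidableEq ι] {T W : Set X} (hT : IsOpen T)
    (hW : IsOpen W) (hWT : W ⊆ T) {t : ι → X → ℝ} (ht : ∀ i, ContinuousOn (t i) T)
    {τ : ι → X × ℝ → X} (hτ : ∀ i, ContinuousOn (τ i) (T ×ˢ Set.univ))
    (τT : ∀ i, ∀ x ∈ T, ∀ s, τ i (x, s) ∈ T) (τW : ∀ i, ∀ x ∈ W, ∀ s, τ i (x, s) ∈ W)
    (tτ : ∀ i j, ∀ x ∈ T, ∀ s, t j (τ i (x, s)) = t j x + if i = j then s else 0)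
    (τ0 : ∀ i, ∀ x ∈ T, τ i (x, 0) = x) (S : Finset ι) :
    (∀ n, Nonempty (H (n + S.card) T ({x ∈ T | ∃ i ∈ S, t i x ≠ 0} ∪ W) ≃ₗ[ℤ] H n T W)) ∧
      ∀ n < S.card, Triv n T ({x ∈ T | ∃ i ∈ S, t i x ≠ 0} ∪ W) := by
  induction S using Finset.induction_on with
  | empty =>
    refine ⟨fun n => ?_, fun n hn => absurd hn (by simp)⟩
    have : {x ∈ T | ∃ i ∈ (∅ : Finset ι), t i x ≠ 0} ∪ W = W := by simp
    rw [this]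
    exact ⟨LinearEquiv.refl _ _⟩
  | insert i S hi ih =>
    set V : Set X := {x ∈ T | ∃ j ∈ S, t j x ≠ 0} ∪ W with hV
    have hVW : {x ∈ T | ∃ j ∈ insert i S, t j x ≠ 0} ∪ W = {x ∈ T | t i x ≠ 0} ∪ V := by
      ext x
      simp only [hV, Set.mem_union, Set.mem_ofPred_eq, Finset.mem_insert, exists_eq_or_imp]
      rw [and_or_left, or_assoc]
    have hVo : IsOpen V := by
      refine IsOpen.union ?_ hW
      have : {x ∈ T | ∃ j ∈ S, t j x ≠ 0} = ⋃ j ∈ S, T ∩ (t j) ⁻¹' {0}ᶜ := by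
        ext x
        simp only [Set.mem_ofPred_eq, Set.mem_iUnion, Set.mem_inter_iff, Set.mem_preimage,
          Set.mem_compl_iff, Set.mem_singleton_iff, exists_prop]
        tauto
      rw [this]
      exact isOpen_biUnion fun j _ => (ht j).isOpen_inter_preimage hT isOpen_compl_singleton
    have hVT : V ⊆ T := Set.union_subset (fun x hx => hx.1) hWT
    have hτV : ∀ x ∈ V, ∀ s, τ i (x, s) ∈ V := by
      rintro x (⟨hx, j, hj, hne⟩ | hx) s
      · refine Or.inl ⟨τT i x hx s, j, hj, ?_⟩
        have hij : i ≠ j := fun h => hi (h ▸ hj)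
        rwa [tτ i j x hx, if_neg hij, add_zero]
      · exact Or.inr (τW i x hx s)
    obtain ⟨h1, h2⟩ := suspension hT hVo hVT (ht i) (hτ i) (τT i) hτV
      (fun x hx s => by rw [tτ i i x hx, if_pos rfl]) (τ0 i)
    rw [Finset.card_insert_of_notMem hi, hVW]
    refine ⟨fun n => ?_, fun n hn => ?_⟩
    · obtain ⟨e1⟩ := ih.1 n
      obtain ⟨e2⟩ := h1 (n + S.card)
      exact ⟨e2.trans e1⟩
    · cases n with
      | zero => exact h2
      | succ n => exact (Triv.congr (h1 n)).2 (ih.2 n (by omega))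

end Suspension

/-! ### Local homology of Euclidean spaces -/

section Euclidean

variable (E : Type) [NormedAddCommGroup E] [NormedSpace ℝ E]

lemma univ_homology : Nonempty (H 0 (Set.univ : Set E) ∅ ≃ₗ[ℤ] ℤ) ∧
    ∀ n, Triv (n + 1) (Set.univ : Set E) ∅ :=
  contractible_homology (p := 0) trivial (k := fun p => (1 - p.2) • p.1)
    (by fun_prop) (fun _ _ => trivial) (by simp) (by simp)

/-- The local homology of a finite-dimensional real vector space at the origin. -/
theorem local_homology [FiniteDimensional ℝ E] (n : ℕ) :
    (n = Module.finrank ℝ E → Nonempty (H n (Set.univ : Set E) {0}ᶜ ≃ₗ[ℤ] ℤ)) ∧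
      (n ≠ Module.finrank ℝ E → Triv n (Set.univ : Set E) {0}ᶜ) := by
  classical
  let b := Module.finBasis ℝ E
  have hb : ∀ i, Continuous (b.coord i) := fun i => LinearMap.continuous_of_finiteDimensional _
  obtain ⟨h1, h2⟩ := iterated_suspension (X := E) (T := Set.univ) (W := ∅) isOpen_univ isOpen_empty
    (Set.empty_subset _) (t := fun i x => b.coord i x) (fun i => (hb i).continuousOn)
    (τ := fun i p => p.1 + p.2 • b i) (fun i => by fun_prop) (fun _ _ _ _ => trivial)
    (fun _ _ h => h.elim) (fun i j x _ s => by
      simp [Finsupp.single_apply]) (by simp) Finset.univ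
  have hset : {x ∈ (Set.univ : Set E) | ∃ i ∈ Finset.univ, b.coord i x ≠ 0} ∪ ∅ = {0}ᶜ := by
    ext x
    simp only [Set.union_empty, Set.mem_ofPred_eq, Set.mem_univ, Finset.mem_univ, true_and,
      Set.mem_compl_iff, Set.mem_singleton_iff]
    rw [← b.forall_coord_eq_zero_iff]
    push Not
    rfl
  rw [hset, Finset.card_univ, Fintype.card_fin] at h1 h2
  obtain ⟨h3, h4⟩ := univ_homology E
  refine ⟨?_, fun hn => ?_⟩
  · rintro rfl
    obtain ⟨e1⟩ := h1 0
    obtain ⟨e2⟩ := h3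
    rw [zero_add] at e1
    exact ⟨e1.trans e2⟩
  · rcases lt_or_gt_of_ne hn with h | h
    · exact h2 n h
    · obtain ⟨m, rfl⟩ : ∃ m, n = (m + 1) + Module.finrank ℝ E :=
        ⟨n - Module.finrank ℝ E - 1, by omega⟩
      exact (Triv.congr (h1 (m + 1))).2 (h4 m)

end Euclidean


/-! ### Winding numbers and the punctured plane -/

section Winding

/-- The logarithms of a singular simplex of `ℂ`: the continuous maps `θ` with `exp ∘ θ = σ`. -/
def IsLog {n : ℕ} (σ : C(Δ n, ℂ)) (θ : C(Δ n, ℂ)) : Prop := ∀ t, Complex.exp (θ t) = σ t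

lemma exists_isLog {n : ℕ} {σ : C(Δ n, ℂ)} (h : ∀ t, σ t ≠ 0) : ∃ θ, IsLog σ θ := by
  have hcov := Complex.isCoveringMap_exp
  let v : Δ n := stdSimplex.vertex 0
  -- the contraction of the simplex to a vertex
  let c : C(unitInterval × Δ n, Δ n) :=
    ⟨fun p => ⟨(1 - (p.1 : ℝ)) • v.1 + (p.1 : ℝ) • p.2.1, convex_stdSimplex ℝ _ v.2 p.2.2
      (sub_nonneg.2 p.1.2.2) p.1.2.1 (by ring)⟩, by
        refine Continuous.subtype_mk ?_ _
        fun_prop⟩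
  let H : C(unitInterval × Δ n, {z : ℂ // z ≠ 0}) := ⟨fun p => ⟨σ (c p), h _⟩, by fun_prop⟩
  have c0 : ∀ a, c (0, a) = v := fun a => Subtype.ext (by simp [c])
  have c1 : ∀ a, c (1, a) = a := fun a => Subtype.ext (by simp [c])
  let f : C(Δ n, ℂ) := ContinuousMap.const _ (Complex.log (σ v))
  have H0 : ∀ a, H (0, a) = ⟨_, (f a).exp_ne_zero⟩ := fun a => Subtype.ext (by
    change σ (c (0, a)) = Complex.exp (Complex.log (σ v))
    rw [c0, Complex.exp_log (h v)])
  let F := hcov.liftHomotopy H f H0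
  refine ⟨F.comp ((ContinuousMap.const _ 1).prodMk (ContinuousMap.id _)), fun t => ?_⟩
  have := congrArg Subtype.val (congrFun (hcov.liftHomotopy_lifts H f H0) (1, t))
  change Complex.exp (F (1, t)) = σ (c (1, t)) at this
  rw [c1] at this
  exact this

instance (n : ℕ) : PreconnectedSpace (Δ n) :=
  isPreconnected_iff_preconnectedSpace.1 (convex_stdSimplex ℝ _).isPreconnected

lemma IsLog.sub_eq {n : ℕ} {σ θ θ' : C(Δ n, ℂ)} (h : IsLog σ θ) (h' : IsLog σ θ') (s t : Δ n) :
    θ s - θ t = θ' s - θ' t := by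
  have hcov := Complex.isCoveringMap_exp
  have := hcov.eq_of_comp_eq (g₁ := fun u => θ u - θ t) (g₂ := fun u => θ' u - θ' t)
    (by fun_prop) (by fun_prop) (funext fun u => Subtype.ext (by
      change Complex.exp _ = Complex.exp _
      rw [Complex.exp_sub, Complex.exp_sub, h, h, h', h'])) t (by simp)
  exact congrFun this s

open Classical in
/-- The change of the argument along the edges of a chain of `ℂ ∖ 0`, extended by `0`. -/
def winding : Chain 1 ℂ →ₗ[ℤ] ℝ := Finsupp.linearCombination ℤ fun σ =>
  if h : ∃ θ, IsLog σ θ then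
    (h.choose (stdSimplex.vertex 1) - h.choose (stdSimplex.vertex 0)).im else 0

lemma winding_single {σ θ : C(Δ 1, ℂ)} (h : IsLog σ θ) : winding (Finsupp.single σ 1) =
    (θ (stdSimplex.vertex 1) - θ (stdSimplex.vertex 0)).im := by
  have h' : ∃ θ, IsLog σ θ := ⟨θ, h⟩
  rw [winding, Finsupp.linearCombination_single, one_smul, dif_pos h',
    h'.choose_spec.sub_eq h]

lemma winding_dd {b : Chain 2 ℂ} (hb : b ∈ sub 2 ({0}ᶜ : Set ℂ)) : winding (dd 1 b) = 0 := by
  refine supported_ext (F := winding ∘ₗ dd 1) (G := 0) (fun σ hσ => ?_) hb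
  obtain ⟨θ, hθ⟩ := exists_isLog (σ := σ) fun t => hσ t
  have key : ∀ i, winding (Finsupp.single (σ.comp (faceMap 1 i)) 1) =
      (θ (stdSimplex.vertex (i.succAbove 1)) - θ (stdSimplex.vertex (i.succAbove 0))).im := by
    intro i
    rw [winding_single (θ := θ.comp (faceMap 1 i)) (fun t => hθ _)]
    have hv : ∀ k, faceMap 1 i (stdSimplex.vertex k) = stdSimplex.vertex (i.succAbove k) :=
      fun k => stdSimplex.map_vertex _ _
    rw [ContinuousMap.comp_apply, ContinuousMap.comp_apply, hv, hv]
  rw [LinearMap.comp_apply, dd_single, map_sum, Fin.sum_univ_three]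
  simp only [map_smul, key]
  have e1 : (0 : Fin 3).succAbove (1 : Fin 2) = 2 := rfl
  have e2 : (0 : Fin 3).succAbove (0 : Fin 2) = 1 := rfl
  have e3 : (1 : Fin 3).succAbove (1 : Fin 2) = 2 := rfl
  have e4 : (1 : Fin 3).succAbove (0 : Fin 2) = 0 := rfl
  have e5 : (2 : Fin 3).succAbove (1 : Fin 2) = 1 := rfl
  have e6 : (2 : Fin 3).succAbove (0 : Fin 2) = 0 := rfl
  rw [e1, e2, e3, e4, e5, e6]
  simp

lemma winding_eq_zero {x : Chain 1 ℂ} (hx : x ∈ Bd 1 ({0}ᶜ : Set ℂ) ∅) : winding x = 0 := by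
  obtain ⟨a, ha, b, hb, rfl⟩ := mem_Bd.1 hx
  rw [sub_empty, Submodule.mem_bot] at ha
  rw [map_add, winding_dd hb, ha, map_zero, add_zero]

lemma winding_push {f : ℂ → ℂ} (hf : ContinuousOn f {0}ᶜ) (hsq : ∀ u ≠ 0, f u = (u / ‖u‖) ^ 2)
    {x : Chain 1 ℂ} (hx : x ∈ sub 1 ({0}ᶜ : Set ℂ)) :
    winding (push f 1 x) = 2 * winding x := by
  refine supported_ext (F := winding ∘ₗ push f 1) (G := (2 : ℤ) • winding) (fun σ hσ => ?_) hx
    |>.trans (by simp)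
  obtain ⟨θ, hθ⟩ := exists_isLog (σ := σ) fun t => hσ t
  let η : C(Δ 1, ℂ) := ⟨fun t => (2 * (θ t).im : ℝ) * Complex.I, by fun_prop⟩
  rw [LinearMap.comp_apply, push_single (continuous_comp hf hσ), LinearMap.smul_apply,
    winding_single hθ, winding_single (θ := η)]
  · simp [η]
    ring
  · intro t
    change Complex.exp _ = f (σ t)
    rw [hsq _ (hσ t), ← hθ t, Complex.norm_exp, Complex.ofReal_exp, ← Complex.exp_sub,
      ← Complex.exp_nat_mul]
    congr 1
    apply Complex.ext <;> simp [η]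

/-- The loop that runs once around the origin. -/
def circleLoop : C(Δ 1, ℂ) :=
  ⟨fun t => Complex.exp ((2 * Real.pi * t.1 1 : ℝ) * Complex.I), by
    have : Continuous fun t : Δ 1 => t.1 1 := (continuous_apply 1).comp continuous_subtype_val
    exact Complex.continuous_exp.comp
      ((Complex.continuous_ofReal.comp (continuous_const.mul this)).mul continuous_const)⟩

lemma winding_circleLoop : winding (Finsupp.single circleLoop 1) = 2 * Real.pi := by
  let θ : C(Δ 1, ℂ) := ⟨fun t => (2 * Real.pi * t.1 1 : ℝ) * Complex.I, by
    have : Continuous fun t : Δ 1 => t.1 1 := (continuous_apply 1).comp continuous_subtype_val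
    exact (Complex.continuous_ofReal.comp (continuous_const.mul this)).mul continuous_const⟩
  rw [winding_single (θ := θ) (fun _ => rfl)]
  simp [θ]

lemma circleLoop_mem : Finsupp.single circleLoop 1 ∈ Z 1 ({0}ᶜ : Set ℂ) ∅ := by
  refine mem_Z_succ.2 ⟨single_mem_sub (fun t => Complex.exp_ne_zero _) _, ?_⟩
  have : circleLoop.comp (faceMap 0 0) = circleLoop.comp (faceMap 0 1) := by
    ext t
    have h1 : (faceMap 0 0 t).1 1 = 1 :=
      (faceMap_apply_succAbove 0 0 t 0).trans (by simpa using t.2.2)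
    change Complex.exp ((2 * Real.pi * (faceMap 0 0 t).1 1 : ℝ) * Complex.I) =
      Complex.exp ((2 * Real.pi * (faceMap 0 1 t).1 1 : ℝ) * Complex.I)
    rw [h1, faceMap_apply_same 0 1 t]
    simp
  rw [dd_single, Fin.sum_univ_two, this]
  simp

lemma isPathConnected_punctured : IsPathConnected ({0}ᶜ : Set ℂ) :=
  isPathConnected_compl_singleton_of_one_lt_rank (by simp) 0

lemma triv_punctured (n : ℕ) : Triv (n + 2) ({0}ᶜ : Set ℂ) ∅ := by
  obtain ⟨-, h⟩ := univ_homology ℂ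
  have e := equiv_boundary (Set.subset_univ ({0}ᶜ : Set ℂ)) (h (n + 1)) (h (n + 2))
    (Set.empty_subset _)
  exact (Triv.congr e).1 ((local_homology ℂ (n + 3)).2 (by simp))

/-- A generator of the first homology of the punctured plane. -/
lemma exists_generator : ∃ z ∈ Z 1 ({0}ᶜ : Set ℂ) ∅, winding z ≠ 0 ∧
    ∀ x ∈ Z 1 ({0}ᶜ : Set ℂ) ∅, ∃ k : ℤ, x - k • z ∈ Bd 1 ({0}ᶜ : Set ℂ) ∅ := by
  obtain ⟨-, h⟩ := univ_homology ℂ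
  obtain ⟨e1⟩ := equiv_boundary (Set.subset_univ ({0}ᶜ : Set ℂ)) (h 0) (h 1)
    (Set.empty_subset _)
  obtain ⟨e2⟩ := (local_homology ℂ 2).1 (by simp)
  let e := e1.symm.trans e2
  obtain ⟨⟨z, hz⟩, hze⟩ := Submodule.Quotient.mk_surjective _ (e.symm 1)
  have hgen : ∀ x ∈ Z 1 ({0}ᶜ : Set ℂ) ∅, ∃ k : ℤ, x - k • z ∈ Bd 1 ({0}ᶜ : Set ℂ) ∅ := by
    intro x hx
    let q : H 1 ({0}ᶜ : Set ℂ) ∅ := Submodule.Quotient.mk ⟨x, hx⟩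
    refine ⟨e q, ?_⟩
    have hq : q = e q • (Submodule.Quotient.mk ⟨z, hz⟩ : H 1 ({0}ᶜ : Set ℂ) ∅) := by
      rw [hze, ← map_smul, smul_eq_mul, mul_one, LinearEquiv.symm_apply_apply]
    rw [← Submodule.Quotient.mk_smul] at hq
    exact (Submodule.Quotient.eq (p := (Bd 1 ({0}ᶜ : Set ℂ) ∅).comap
      (Z 1 ({0}ᶜ : Set ℂ) ∅).subtype)).1 hq
  refine ⟨z, hz, fun h0 => ?_, hgen⟩
  obtain ⟨k, hk⟩ := hgen _ circleLoop_mem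
  have := winding_eq_zero hk
  rw [map_sub, map_smul, h0, smul_zero, sub_zero, winding_circleLoop] at this
  exact absurd this (by positivity)

/-- A cycle of the punctured plane is a boundary if its winding number vanishes. -/
lemma mem_Bd_of_winding {x : Chain 1 ℂ} (hx : x ∈ Z 1 ({0}ᶜ : Set ℂ) ∅) (h0 : winding x = 0) :
    x ∈ Bd 1 ({0}ᶜ : Set ℂ) ∅ := by
  obtain ⟨z, hz, hw, hgen⟩ := exists_generator
  obtain ⟨k, hk⟩ := hgen x hx
  have := winding_eq_zero hk
  rw [map_sub, h0, zero_sub, neg_eq_zero, map_smul, smul_eq_zero] at this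
  rwa [this.resolve_right hw, zero_smul, sub_zero] at hk

end Winding

/-! ### Pairs of homotopy circles -/

section Squaring

variable {X X' : Type} [TopologicalSpace X] [TopologicalSpace X']

lemma HEquiv.mem_Bd_of_push {B A : Set X} {B' A' : Set X'} (e : HEquiv B A B' A') {n : ℕ}
    {x : Chain n X} (hx : x ∈ Z n B A) (h : push e.f n x ∈ Bd n B' A') : x ∈ Bd n B A := by
  have := Submodule.sub_mem _ (push_Bd e.hg e.hA' e.gB e.gA h) (e.left n x hx)
  rwa [sub_sub_cancel] at this

/-- A homotopy equivalence of two sets. -/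
def HEquiv.ofHomotopies {B : Set X} {B' : Set X'} (f : X → X') (g : X' → X)
    (hf : ContinuousOn f B) (hg : ContinuousOn g B') (fB : Set.MapsTo f B B')
    (gB : Set.MapsTo g B' B) (k : X × ℝ → X) (hk : ContinuousOn k (B ×ˢ Set.Icc (0 : ℝ) 1))
    (kB : Set.MapsTo k (B ×ˢ Set.Icc (0 : ℝ) 1) B) (k0 : ∀ x ∈ B, k (x, 0) = x)
    (k1 : ∀ x ∈ B, k (x, 1) = g (f x)) (k' : X' × ℝ → X')
    (hk' : ContinuousOn k' (B' ×ˢ Set.Icc (0 : ℝ) 1))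
    (kB' : Set.MapsTo k' (B' ×ˢ Set.Icc (0 : ℝ) 1) B') (k0' : ∀ x ∈ B', k' (x, 0) = x)
    (k1' : ∀ x ∈ B', k' (x, 1) = f (g x)) : HEquiv B ∅ B' ∅ where
  f := f
  g := g
  hA := Set.empty_subset _
  hA' := Set.empty_subset _
  hf := hf
  hg := hg
  fB := fB
  fA := fun _ h => h.elim
  gB := gB
  gA := fun _ h => h.elim
  left := homotopic_id (Set.empty_subset _) hf hg fB k hk kB (fun _ hx => hx.1.elim) k0 k1
  right := homotopic_id (Set.empty_subset _) hg hf gB k' hk' kB' (fun _ hx => hx.1.elim) k0' k1'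

/-- The exchange of the two maps of a homotopy equivalence. -/
def HEquiv.symm {B A : Set X} {B' A' : Set X'} (e : HEquiv B A B' A') : HEquiv B' A' B A where
  f := e.g
  g := e.f
  hA := e.hA'
  hA' := e.hA
  hf := e.hg
  hg := e.hf
  fB := e.gB
  fA := e.gA
  gB := e.fB
  gA := e.fA
  left := e.right
  right := e.left

/-- The homology of a pair of homotopy circles whose inclusion has degree two. -/
theorem homology_of_squaring {V V0 : Set X} (hV : V0 ⊆ V) (e0 : HEquiv ({0}ᶜ : Set ℂ) ∅ V0 ∅)
    (e1 : HEquiv V ∅ ({0}ᶜ : Set ℂ) ∅) (hsq : ∀ u ≠ 0, e1.f (e0.f u) = (u / ‖u‖) ^ 2) :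
    Nonempty (H 1 V V0 ≃ₗ[ℤ] ZMod 2) ∧ ∀ n ≠ 1, Triv n V V0 := by
  obtain ⟨z, hz, hw, hgen⟩ := exists_generator
  have hfg : ContinuousOn (fun u => e1.f (e0.f u)) {0}ᶜ :=
    e1.hf.comp e0.hf fun u hu => hV (e0.fB hu)
  have hfgB : Set.MapsTo (fun u => e1.f (e0.f u)) {0}ᶜ {0}ᶜ :=
    fun u hu => e1.fB (hV (e0.fB hu))
  -- the winding number of the image of a cycle of `V0`
  have hwind : ∀ a ∈ Z 1 V0 ∅, winding (push e1.f 1 a) = 2 * winding (push e0.g 1 a) := by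
    intro a ha
    have ha' := push_Z e0.hg e0.hA' e0.gB e0.gA ha
    rw [← winding_push hfg hsq ha'.1]
    have h1 := push_Bd (e1.hf.mono hV) e0.hA' (fun x hx => e1.fB (hV hx)) e1.fA
      (e0.right 1 a ha)
    rw [map_sub, push_push e0.hf e0.fB (e1.hf.mono hV) ha'.1] at h1
    have h2 := winding_eq_zero h1
    rw [map_sub, sub_eq_zero] at h2
    exact h2.symm
  have hV0 : ∀ a ∈ Z 1 V0 ∅, winding (push e1.f 1 a) = 0 → a ∈ Bd 1 V0 ∅ := by
    intro a ha h
    rw [hwind a ha] at h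
    exact e0.symm.mem_Bd_of_push ha (mem_Bd_of_winding (push_Z e0.hg e0.hA' e0.gB e0.gA ha)
      ((mul_eq_zero_iff_left two_ne_zero).1 h))
  have hT : ∀ n, Triv (n + 2) V ∅ := fun n => (Triv.congr (e1.equiv _)).2 (triv_punctured n)
  have hT0 : ∀ n, Triv (n + 2) V0 ∅ := fun n => (Triv.congr (e0.equiv _)).1 (triv_punctured n)
  have haug : ∀ x ∈ sub 0 V, aug x = 0 → x ∈ Bd 0 V ∅ := fun x hx h =>
    e1.mem_Bd_of_push (mem_Z_zero.2 hx) (mem_Bd_of_aug isPathConnected_punctured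
      (push_mem e1.hf e1.fB hx) ((aug_push e1.hf hx).trans h))
  have haug0 : ∀ x ∈ sub 0 V0, aug x = 0 → x ∈ Bd 0 V0 ∅ := fun x hx h =>
    e0.symm.mem_Bd_of_push (mem_Z_zero.2 hx) (mem_Bd_of_aug isPathConnected_punctured
      (push_mem e0.hg e0.gB hx) ((aug_push e0.hg hx).trans h))
  have hBd : ∀ {n : ℕ} {B : Set X} {x : Chain n X}, x ∈ Bd n B ∅ →
      ∃ b ∈ sub (n + 1) B, dd n b = x := by
    intro n B x hx
    obtain ⟨a, ha, b, hb, rfl⟩ := mem_Bd.1 hx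
    rw [sub_empty, Submodule.mem_bot] at ha
    exact ⟨b, hb, by rw [ha, zero_add]⟩
  refine ⟨?_, fun n hn => ?_⟩
  · let y := push e1.g 1 z
    have hy : y ∈ Z 1 V ∅ := push_Z e1.hg e1.hA' e1.gB e1.gA hz
    have hyw : winding (push e1.f 1 y) = winding z := by
      have := winding_eq_zero (e1.right 1 z hz)
      rwa [map_sub, sub_eq_zero] at this
    have hyV : y ∈ Z 1 V V0 := Z_mono 1 subset_rfl (Set.empty_subset _) hy
    let φ : ℤ →ₗ[ℤ] H 1 V V0 := LinearMap.toSpanSingleton ℤ _ (Submodule.Quotient.mk ⟨y, hyV⟩)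
    have hφ : ∀ (k : ℤ) (x : Chain 1 X) (hx : x ∈ Z 1 V V0),
        φ k = Submodule.Quotient.mk ⟨x, hx⟩ ↔ k • y - x ∈ Bd 1 V V0 := by
      intro k x hx
      rw [LinearMap.toSpanSingleton_apply, ← Submodule.Quotient.mk_smul]
      exact Submodule.Quotient.eq _
    have hsurj : Function.Surjective φ := by
      intro q
      obtain ⟨⟨x, hx⟩, rfl⟩ := Submodule.Quotient.mk_surjective _ q
      obtain ⟨v, hv, hvx⟩ := hBd (haug0 (dd 0 x) (mem_Z_succ.1 hx).2 (aug_dd x))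
      have hxv : x - v ∈ Z 1 V ∅ := mem_Z_succ.2
        ⟨Submodule.sub_mem _ hx.1 (sub_mono 1 hV hv), by rw [map_sub, hvx, sub_self]; simp⟩
      obtain ⟨k, hk⟩ := hgen _ (push_Z e1.hf e1.hA e1.fB e1.fA hxv)
      refine ⟨k, (hφ k x hx).2 ?_⟩
      have h1 : k • y - (x - v) ∈ Bd 1 V ∅ := by
        refine e1.mem_Bd_of_push (Submodule.sub_mem _ (Submodule.smul_mem _ _ hy) hxv) ?_
        have h2 := Submodule.smul_mem _ k (e1.right 1 z hz)
        rw [map_sub, map_smul]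
        convert Submodule.sub_mem _ h2 hk using 1
        simp only [y, smul_sub]
        abel
      have h2 := Submodule.sub_mem _ (Bd_mono 1 subset_rfl (Set.empty_subset V0) h1)
        (sub_le_Bd 1 V V0 hv)
      convert h2 using 1
      abel
    have hker : ∀ k : ℤ, φ k = 0 ↔ (2 : ℤ) ∣ k := by
      intro k
      rw [← Submodule.Quotient.mk_zero]
      rw [show (0 : Z 1 V V0) = ⟨0, Submodule.zero_mem _⟩ from rfl, hφ, sub_zero]
      constructor
      · intro h
        obtain ⟨a, ha, b, hb, hab⟩ := mem_Bd.1 h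
        have haZ : a ∈ Z 1 V0 ∅ := by
          refine mem_Z_succ.2 ⟨ha, ?_⟩
          have h1 := congrArg (dd 0) hab
          rw [map_add, dd_dd, add_zero, map_smul] at h1
          rw [h1]
          exact Submodule.smul_mem _ _ (mem_Z_succ.1 hy).2
        have h2 : winding (push e1.f 1 (k • y - a)) = 0 := by
          refine winding_eq_zero (push_Bd e1.hf e1.hA e1.fB e1.fA ?_)
          rw [← hab, add_sub_cancel_left]
          exact dd_mem_Bd _ hb
        obtain ⟨m, hm⟩ := hgen _ (push_Z e0.hg e0.hA' e0.gB e0.gA haZ)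
        have h3 := winding_eq_zero hm
        rw [map_sub, map_smul] at h2
        rw [map_sub, map_smul, sub_eq_zero] at h3
        rw [map_sub, map_smul, hyw, hwind a haZ, h3, sub_eq_zero] at h2
        simp only [zsmul_eq_mul] at h2
        refine ⟨m, ?_⟩
        have h4 : ((k : ℤ) : ℝ) * winding z = ((2 * m : ℤ) : ℝ) * winding z := by
          rw [h2]; push_cast; ring
        exact_mod_cast mul_right_cancel₀ hw h4
      · rintro ⟨m, rfl⟩
        have hgz : push e0.f 1 z ∈ Z 1 V0 ∅ := push_Z e0.hf e0.hA e0.fB e0.fA hz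
        have h1 : (2 : ℤ) • y - push e0.f 1 z ∈ Bd 1 V ∅ := by
          have hZ : (2 : ℤ) • y - push e0.f 1 z ∈ Z 1 V ∅ :=
            Submodule.sub_mem _ (Submodule.smul_mem _ _ hy) (Z_mono 1 hV subset_rfl hgz)
          refine e1.mem_Bd_of_push hZ (mem_Bd_of_winding (push_Z e1.hf e1.hA e1.fB e1.fA hZ) ?_)
          rw [map_sub, map_sub, map_smul, map_smul, hyw,
            push_push e0.hf e0.fB (e1.hf.mono hV) hz.1]
          change (2 : ℤ) • winding z - winding (push (fun u => e1.f (e0.f u)) 1 z) = 0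
          rw [winding_push hfg hsq hz.1]
          simp
        have h2 : (2 : ℤ) • y ∈ Bd 1 V V0 := by
          have := Submodule.add_mem _ (Bd_mono 1 subset_rfl (Set.empty_subset V0) h1)
            (sub_le_Bd 1 V V0 hgz.1)
          rwa [sub_add_cancel] at this
        rw [mul_comm, mul_smul]
        exact Submodule.smul_mem _ _ h2
    let ψ : ℤ →ₗ[ℤ] ZMod 2 := (Int.castAddHom (ZMod 2)).toIntLinearMap
    have hψ : Function.Surjective ψ := ZMod.intCast_surjective
    have hk : LinearMap.ker φ = LinearMap.ker ψ := by
      ext k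
      rw [LinearMap.mem_ker, LinearMap.mem_ker, hker]
      exact (ZMod.intCast_zmod_eq_zero_iff_dvd k 2).symm
    exact ⟨(φ.quotKerEquivOfSurjective hsurj).symm.trans
      ((Submodule.quotEquivOfEq _ _ hk).trans (ψ.quotKerEquivOfSurjective hψ))⟩
  · match n, hn with
    | 0, _ =>
      intro x hx
      have h1 : (1 : ℂ) ∈ ({0}ᶜ : Set ℂ) := one_ne_zero
      let p : Chain 0 X := Finsupp.single (pt (e0.f 1)) 1
      have hp : p ∈ sub 0 V0 := single_mem_sub (fun _ => e0.fB h1) _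
      have h2 := haug (x - aug x • p)
        (Submodule.sub_mem _ hx.1 (Submodule.smul_mem _ _ (sub_mono 0 hV hp))) (by
          rw [map_sub, map_smul, aug_single]
          simp)
      have := Submodule.add_mem _ (Bd_mono 0 subset_rfl (Set.empty_subset V0) h2)
        (sub_le_Bd 0 V V0 (Submodule.smul_mem _ (aug x) hp))
      rwa [sub_add_cancel] at this
    | 2, _ =>
      intro x hx
      obtain ⟨hx1, hx2⟩ := mem_Z_succ.1 hx
      have ha : dd 1 x ∈ Z 1 V0 ∅ := mem_Z_succ.2 ⟨hx2, by rw [dd_dd]; simp⟩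
      obtain ⟨v, hv, hvx⟩ := hBd (hV0 _ ha (winding_eq_zero
        (push_Bd e1.hf e1.hA e1.fB e1.fA (dd_mem_Bd _ hx1))))
      have h1 : x - v ∈ Bd 2 V ∅ := hT 0 (mem_Z_succ.2
        ⟨Submodule.sub_mem _ hx1 (sub_mono 2 hV hv), by rw [map_sub, hvx, sub_self]; simp⟩)
      have := Submodule.add_mem _ (Bd_mono 2 subset_rfl (Set.empty_subset V0) h1)
        (sub_le_Bd 2 V V0 hv)
      rwa [sub_add_cancel] at this
    | n + 3, _ =>
      refine (Triv.congr (equiv_quot hV (hT0 (n + 1)) (fun m hm => ?_)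
        (Set.empty_subset _))).1 (hT (n + 1))
      obtain rfl : m = n + 2 := by omega
      exact hT0 n

end Squaring

end RelHom

namespace QuatThom

/-! ### The orbit space as a quotient of a punctured vector space -/

section Proj

open Topology Filter OnePoint

variable {q : ℕ}

/-- The action of a complex number on `ℍ^q × ℂ`, with weight two on the second factor. -/
def act (z : ℂ) (x : HSpace q × ℂ) : HSpace q × ℂ := ((z : Quaternion ℝ) • x.1, z ^ 2 * x.2)

/-- The action of `j` on `ℍ^q × ℂ`. -/
def conjJ (x : HSpace q × ℂ) : HSpace q × ℂ := (quatJ • x.1, starRingEnd ℂ x.2)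

lemma coeComplex_ne_zero {z : ℂ} (hz : z ≠ 0) : (z : Quaternion ℝ) ≠ 0 := by
  intro h
  apply hz
  have h1 := congrArg QuaternionAlgebra.re h
  have h2 := congrArg QuaternionAlgebra.imI h
  exact Complex.ext h1 h2

lemma norm_coeComplex (z : ℂ) : ‖(z : Quaternion ℝ)‖ = ‖z‖ := by
  have h : ‖(z : Quaternion ℝ)‖ * ‖(z : Quaternion ℝ)‖ = ‖z‖ * ‖z‖ := by
    rw [← Quaternion.normSq_eq_norm_mul_self, Quaternion.normSq_def', ← pow_two ‖z‖,
      ← Complex.normSq_eq_norm_sq, Complex.normSq_apply]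
    simp
    ring
  exact (mul_self_inj (norm_nonneg _) (norm_nonneg _)).1 h

lemma continuous_act (z : ℂ) : Continuous (act z : HSpace q × ℂ → _) := by
  unfold act
  fun_prop

lemma continuous_conjJ : Continuous (conjJ : HSpace q × ℂ → _) := by
  unfold conjJ
  have := Complex.continuous_conj
  fun_prop

/-- The quotient map to the total space of the line bundle. -/
def o2Mk (a : NonzeroVec q × ℂ) : O2 q := Quotient.mk (o2Setoid q) a

lemma continuous_o2Mk : Continuous (o2Mk (q := q)) := continuous_quotient_mk'

/-- The quotient map to the orbit space. -/
def mkY (y : Q q) : Y q := Quotient.mk (orbitSetoid q) y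

lemma continuous_mkY : Continuous (mkY (q := q)) := continuous_quotient_mk'

lemma eq_or_of_mkY_eq {y y' : Q q} (h : mkY y = mkY y') : y' = y ∨ y' = realStr y :=
  Quotient.exact (s := orbitSetoid q) h

lemma o2Mk_eq {a b : NonzeroVec q × ℂ} (h : o2Mk a = o2Mk b) :
    ∃ z : ℂ, z ≠ 0 ∧ b.1.1 = (z : Quaternion ℝ) • a.1.1 ∧ b.2 = z ^ 2 * a.2 :=
  Quotient.exact (s := o2Setoid q) h

lemma mkY_coe_ne_infty (a : O2 q) : mkY (a : Q q) ≠ mkY ∞ := by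
  intro h
  rcases eq_or_of_mkY_eq h with h | h
  · exact infty_ne_coe _ h
  · exact infty_ne_coe _ (h.trans (OnePoint.map_some _ _))

open Classical in
/-- The map from `ℍ^q × ℂ` to the orbit space `Y q` that sends `(v, c)` to the class of the form
with value `c` at `v ⊗ v`, and `(0, c)` to the point at infinity. Only its restriction to the
nonzero vectors matters; its fibres there are the orbits of the group generated by `ℂ^×` and `j`. -/
def proj (x : HSpace q × ℂ) : Y q :=
  if h : x.1 ≠ 0 then mkY (o2Mk (⟨x.1, h⟩, x.2) : O2 q) else mkY ∞

lemma proj_of_ne {v : HSpace q} (h : v ≠ 0) (c : ℂ) :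
    proj (v, c) = mkY (o2Mk (⟨v, h⟩, c) : O2 q) := dif_pos h

lemma proj_zero (c : ℂ) : proj ((0, c) : HSpace q × ℂ) = mkY ∞ :=
  dif_neg (by simp)

lemma proj_act {z : ℂ} (hz : z ≠ 0) (x : HSpace q × ℂ) : proj (act z x) = proj x := by
  obtain ⟨v, c⟩ := x
  by_cases h : v = 0
  · subst h
    rw [act, smul_zero, proj_zero, proj_zero]
  · have h' : (z : Quaternion ℝ) • v ≠ 0 := smul_ne_zero (coeComplex_ne_zero hz) h
    rw [act, proj_of_ne h', proj_of_ne h]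
    exact congrArg _ (congrArg OnePoint.some
      (Quotient.sound (s := o2Setoid q) (Setoid.symm' _ ⟨z, hz, rfl, rfl⟩)))

lemma proj_conjJ (x : HSpace q × ℂ) : proj (conjJ x) = proj x := by
  obtain ⟨v, c⟩ := x
  by_cases h : v = 0
  · subst h
    rw [conjJ, smul_zero, proj_zero, proj_zero]
  · have h' : quatJ • v ≠ 0 := smul_ne_zero quatJ_ne_zero h
    rw [conjJ, proj_of_ne h', proj_of_ne h]
    exact (Quotient.sound (s := orbitSetoid q) (a := ((o2Mk (⟨v, h⟩, c) : O2 q) : Q q))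
      (Or.inr rfl)).symm

lemma orbit_of_proj_eq {x x' : HSpace q × ℂ} (hx : x ≠ 0) (hx' : x' ≠ 0) (h : proj x = proj x') :
    ∃ z : ℂ, z ≠ 0 ∧ (x' = act z x ∨ x' = act z (conjJ x)) := by
  obtain ⟨v, c⟩ := x
  obtain ⟨v', c'⟩ := x'
  by_cases hv : v = 0 <;> by_cases hv' : v' = 0
  · subst hv hv'
    have hc : c ≠ 0 := fun h => hx (by rw [h]; rfl)
    have hc' : c' ≠ 0 := fun h => hx' (by rw [h]; rfl)
    obtain ⟨z, hz⟩ := IsAlgClosed.exists_pow_nat_eq (c' / c) two_pos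
    refine ⟨z, ?_, Or.inl ?_⟩
    · rintro rfl
      rw [zero_pow two_ne_zero] at hz
      exact div_ne_zero hc' hc hz.symm
    · rw [act, hz, div_mul_cancel₀ _ hc, smul_zero]
  · subst hv
    rw [proj_zero, proj_of_ne hv'] at h
    exact absurd h.symm (mkY_coe_ne_infty _)
  · subst hv'
    rw [proj_zero, proj_of_ne hv] at h
    exact absurd h (mkY_coe_ne_infty _)
  · rw [proj_of_ne hv, proj_of_ne hv'] at h
    rcases eq_or_of_mkY_eq h with h | h
    · obtain ⟨z, hz, h1, h2⟩ := o2Mk_eq (OnePoint.coe_injective h).symm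
      exact ⟨z, hz, Or.inl (Prod.ext h1 h2)⟩
    · have h' : o2Mk (⟨v', hv'⟩, c') = o2Mk (jVec ⟨v, hv⟩, starRingEnd ℂ c) :=
        OnePoint.coe_injective (h.trans (OnePoint.map_some _ _))
      obtain ⟨z, hz, h1, h2⟩ := o2Mk_eq h'.symm
      exact ⟨z, hz, Or.inr (Prod.ext h1 h2)⟩

lemma exists_proj_eq (y : Y q) : ∃ x : HSpace q × ℂ, x ≠ 0 ∧ proj x = y := by
  induction y using Quotient.inductionOn with
  | h y =>
    induction y using OnePoint.rec with
    | infty => exact ⟨(0, 1), fun h => one_ne_zero (congrArg Prod.snd h), proj_zero 1⟩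
    | coe y =>
      induction y using Quotient.inductionOn with
      | h y =>
        exact ⟨(y.1.1, y.2), fun h => y.1.2 (congrArg Prod.fst h), proj_of_ne y.1.2 y.2⟩

/-- The square norm of a form, with respect to the norm of `ℍ^q`. -/
def o2Norm : O2 q → ℝ := Quotient.lift (s := o2Setoid q) (fun a => ‖a.2‖ / ‖a.1.1‖ ^ 2) (by
  rintro a b ⟨z, hz, h1, h2⟩
  have hz' : ‖z‖ ≠ 0 := norm_ne_zero_iff.2 hz
  change _ = ‖b.2‖ / ‖b.1.1‖ ^ 2
  rw [h1, h2, norm_smul, norm_coeComplex, norm_mul, norm_pow, mul_pow,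
    mul_div_mul_left _ _ (pow_ne_zero 2 hz')])

lemma continuous_o2Norm : Continuous (o2Norm (q := q)) := by
  refine Continuous.quotient_lift ?_ _
  refine Continuous.div (by fun_prop) (by fun_prop) fun a => ?_
  exact pow_ne_zero 2 (norm_ne_zero_iff.2 a.1.2)

/-- Every form is represented by a unit vector. -/
lemma exists_unit (y : O2 q) : ∃ a : NonzeroVec q × ℂ, ‖a.1.1‖ = 1 ∧ o2Mk a = y := by
  induction y using Quotient.inductionOn with
  | h a =>
    have hn : ‖a.1.1‖ ≠ 0 := norm_ne_zero_iff.2 a.1.2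
    have hz : ((‖a.1.1‖⁻¹ : ℝ) : ℂ) ≠ 0 := Complex.ofReal_ne_zero.2 (inv_ne_zero hn)
    refine ⟨(⟨(((‖a.1.1‖⁻¹ : ℝ) : ℂ) : Quaternion ℝ) • a.1.1, ?_⟩,
      ((‖a.1.1‖⁻¹ : ℝ) : ℂ) ^ 2 * a.2), ?_, ?_⟩
    · exact smul_ne_zero (coeComplex_ne_zero hz) a.1.2
    · change ‖(((‖a.1.1‖⁻¹ : ℝ) : ℂ) : Quaternion ℝ) • a.1.1‖ = 1
      rw [norm_smul, norm_coeComplex, Complex.norm_real, norm_inv, norm_norm, inv_mul_cancel₀ hn]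
    · exact (Quotient.sound (s := o2Setoid q) ⟨_, hz, rfl, rfl⟩).symm

lemma isCompact_o2Norm_le (m : ℝ) : IsCompact {y : O2 q | o2Norm y ≤ m} := by
  have h1 : IsCompact (Metric.sphere (0 : HSpace q) 1) := isCompact_sphere 0 1
  have h2 : IsCompact {v : NonzeroVec q | ‖v.1‖ = 1} := by
    rw [Topology.IsEmbedding.subtypeVal.isCompact_iff]
    convert h1 using 1
    ext v
    simp only [Set.mem_image, Subtype.exists, exists_and_right, exists_eq_right, Set.mem_ofPred_eq,
      mem_sphere_zero_iff_norm]
    exact ⟨fun ⟨_, h⟩ => h, fun h => ⟨fun h0 => by simp [h0] at h, h⟩⟩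
  have h3 : IsCompact (Metric.closedBall (0 : ℂ) m) := isCompact_closedBall 0 m
  convert (h2.prod h3).image continuous_o2Mk using 1
  ext y
  constructor
  · intro hy
    obtain ⟨a, ha, rfl⟩ := exists_unit y
    refine ⟨a, ⟨ha, ?_⟩, rfl⟩
    have : ‖a.2‖ / ‖a.1.1‖ ^ 2 ≤ m := hy
    rw [ha] at this
    simpa using this
  · rintro ⟨a, ⟨ha, hb⟩, rfl⟩
    change ‖a.2‖ / ‖a.1.1‖ ^ 2 ≤ m
    rw [show ‖a.1.1‖ = 1 from ha]
    simpa using hb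

lemma continuousAt_proj {x : HSpace q × ℂ} (hx : x ≠ 0) : ContinuousAt proj x := by
  obtain ⟨v, c⟩ := x
  have hq := continuous_mkY (q := q)
  by_cases hv : v = 0
  · subst hv
    have hc : c ≠ 0 := fun h => hx (by rw [h]; rfl)
    rw [ContinuousAt, proj_zero]
    intro U hU
    have hU' := hq.continuousAt.preimage_mem_nhds hU
    obtain ⟨W, hWU, hWo, hW⟩ := mem_nhds_iff.1 hU'
    have hcomp := ((isOpen_iff_of_mem hW).1 hWo).2
    obtain ⟨m, hm⟩ := (hcomp.image continuous_o2Norm).isBounded.bddAbove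
    have h1 : ∀ᶠ x : HSpace q × ℂ in 𝓝 (0, c), m * ‖x.1‖ ^ 2 < ‖x.2‖ := by
      refine ContinuousAt.eventually_lt (by fun_prop) (by fun_prop) ?_
      simpa using hc
    change ∀ᶠ x in 𝓝 (0, c), proj x ∈ U
    filter_upwards [h1] with x hx
    obtain ⟨v, c'⟩ := x
    by_cases hv : v = 0
    · subst hv
      rw [proj_zero]
      exact hWU hW
    · rw [proj_of_ne hv]
      refine hWU ?_
      by_contra hnot
      have h2 := hm ⟨o2Mk (⟨v, hv⟩, c'), hnot, rfl⟩
      change ‖c'‖ / ‖v‖ ^ 2 ≤ m at h2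
      rw [div_le_iff₀ (by have := norm_pos_iff.2 hv; positivity)] at h2
      exact absurd hx (not_lt.2 h2)
  · have hopen : IsOpen {x : HSpace q × ℂ | x.1 ≠ 0} :=
      isOpen_ne.preimage continuous_fst
    refine ContinuousOn.continuousAt (s := {x : HSpace q × ℂ | x.1 ≠ 0}) ?_ (hopen.mem_nhds hv)
    rw [continuousOn_iff_continuous_domRestrict]
    have h1 : Continuous fun x : {x : HSpace q × ℂ | x.1 ≠ 0} =>
        mkY (o2Mk (⟨x.1.1, x.2⟩, x.1.2) : Q q) := by
      refine hq.comp (continuous_coe.comp (continuous_o2Mk.comp ?_))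
      exact Continuous.prodMk (Continuous.subtype_mk (by fun_prop) _) (by fun_prop)
    exact h1.congr fun x => (proj_of_ne x.2 x.1.2).symm

/-- The image of an open set of nonzero vectors is open. -/
lemma isOpen_image_proj {U : Set (HSpace q × ℂ)} (hU : IsOpen U) (h0 : 0 ∉ U) :
    IsOpen (proj '' U) := by
  have hq := continuous_mkY (q := q)
  have hne : ∀ x ∈ U, x ≠ 0 := fun x hx h => h0 (h ▸ hx)
  have hcoe : IsOpen ((fun y : O2 q => mkY (y : Q q)) ⁻¹' (proj '' U)) := by
    refine isOpen_coinduced.2 ?_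
    -- the preimage is the union of the translates of `U`
    have : (o2Mk ⁻¹' ((fun y : O2 q => mkY (y : Q q)) ⁻¹' (proj '' U))) =
        (fun a : NonzeroVec q × ℂ => ((a.1.1, a.2) : HSpace q × ℂ)) ⁻¹'
          ⋃ z ∈ ({0}ᶜ : Set ℂ), (act z ⁻¹' U ∪ (fun x => act z (conjJ x)) ⁻¹' U) := by
      ext a
      have ha : ((a.1.1, a.2) : HSpace q × ℂ) ≠ 0 := fun h => a.1.2 (congrArg Prod.fst h)
      have hpa : proj (a.1.1, a.2) = mkY ((o2Mk a : O2 q) : Q q) :=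
        proj_of_ne a.1.2 a.2
      simp only [Set.mem_preimage, Set.mem_iUnion, Set.mem_union, exists_prop]
      rw [← hpa]
      constructor
      · rintro ⟨x, hx, h⟩
        obtain ⟨z, hz, h1 | h1⟩ := orbit_of_proj_eq ha (hne x hx) h.symm
        · exact ⟨z, hz, Or.inl (h1 ▸ hx)⟩
        · exact ⟨z, hz, Or.inr (h1 ▸ hx)⟩
      · rintro ⟨z, hz, h | h⟩
        · exact ⟨_, h, proj_act hz _⟩
        · exact ⟨_, h, (proj_act hz _).trans (proj_conjJ _)⟩
    change IsOpen (o2Mk ⁻¹' _)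
    rw [this]
    refine IsOpen.preimage (by fun_prop) (isOpen_biUnion fun z _ => IsOpen.union ?_ ?_)
    · exact hU.preimage (continuous_act z)
    · exact hU.preimage ((continuous_act z).comp continuous_conjJ)
  refine isOpen_coinduced.2 ?_
  change IsOpen (X := OnePoint (O2 q)) (mkY ⁻¹' _)
  by_cases hinf : (∞ : Q q) ∈ mkY ⁻¹' (proj '' U)
  · rw [isOpen_iff_of_mem hinf]
    have hclosed := isClosed_compl_iff.2 hcoe
    refine ⟨hclosed, ?_⟩
    obtain ⟨⟨v, c⟩, hx, hxinf⟩ := hinf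
    -- a neighbourhood of infinity contains all forms of large norm
    have hv : v = 0 := by
      by_contra hv
      rw [proj_of_ne hv] at hxinf
      exact mkY_coe_ne_infty _ hxinf
    subst hv
    have hc : c ≠ 0 := fun h => h0 (by rw [h] at hx; exact hx)
    obtain ⟨δ, hδ, hball⟩ := Metric.isOpen_iff.1 hU _ hx
    refine (isCompact_o2Norm_le (‖c‖ / δ ^ 2)).of_isClosed_subset hclosed fun y hy => ?_
    obtain ⟨a, ha, rfl⟩ := exists_unit y
    by_contra hlt
    apply hy
    have hlt' : ‖c‖ / δ ^ 2 < ‖a.2‖ / ‖a.1.1‖ ^ 2 := not_le.1 hlt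
    rw [ha, one_pow, div_one, div_lt_iff₀ (by positivity)] at hlt'
    have hpos : 0 < ‖a.2‖ := by
      rcases (norm_nonneg a.2).eq_or_lt with h | h
      · rw [← h, zero_mul] at hlt'
        exact absurd hlt' (not_lt.2 (norm_nonneg c))
      · exact h
    obtain ⟨z, hz⟩ := IsAlgClosed.exists_pow_nat_eq (c / a.2) two_pos
    have hz0 : z ≠ 0 := by
      rintro rfl
      rw [zero_pow two_ne_zero] at hz
      exact div_ne_zero hc (norm_pos_iff.1 hpos) hz.symm
    refine ⟨act z (a.1.1, a.2), hball ?_, (proj_act hz0 _).trans (proj_of_ne a.1.2 a.2)⟩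
    rw [act, hz, div_mul_cancel₀ _ (norm_pos_iff.1 hpos), Metric.mem_ball, Prod.dist_eq, dist_self,
      dist_zero_right, norm_smul, norm_coeComplex, ha, mul_one, max_lt_iff]
    refine ⟨?_, hδ⟩
    have h3 : ‖z‖ ^ 2 < δ ^ 2 := by
      rw [← norm_pow, hz, norm_div, div_lt_iff₀ hpos, mul_comm]
      exact hlt'
    exact lt_of_pow_lt_pow_left₀ 2 hδ.le h3
  · rw [isOpen_iff_of_notMem hinf]
    exact hcoe

end Proj


/-! ### Descent of maps to the orbit space -/

section Descent

open Topology Filter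

variable {E B C : Type*} [TopologicalSpace E] [TopologicalSpace B] [TopologicalSpace C]

/-- A map `p` that restricts on `E0` to the quotient by the group generated by the operators `a z`,
for `z ∈ ℂ^×`, and `j`. Continuity and openness are expressed by the equality of filters
`map p (𝓝 x) = 𝓝 (p x)`. -/
structure IsOrbitMap (p : E → B) (E0 : Set E) (a : ℂ → E → E) (j : E → E) : Prop where
  isOpen : IsOpen E0
  map_nhds : ∀ x ∈ E0, map p (𝓝 x) = 𝓝 (p x)
  surj : ∀ y, ∃ x ∈ E0, p x = y
  act : ∀ z ≠ 0, ∀ x, p (a z x) = p x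
  conj : ∀ x, p (j x) = p x
  orbit : ∀ x ∈ E0, ∀ x' ∈ E0, p x = p x' → ∃ z ≠ 0, x' = a z x ∨ x' = a z (j x)

/-- The invariant subsets of `E0`. -/
structure IsInvariant (E0 : Set E) (a : ℂ → E → E) (j : E → E) (P : Set E) : Prop where
  sub : P ⊆ E0
  act : ∀ z ≠ 0, ∀ x ∈ P, a z x ∈ P
  conj : ∀ x ∈ P, j x ∈ P

namespace IsOrbitMap

variable {p : E → B} {E0 : Set E} {a : ℂ → E → E} {j : E → E} {P : Set E}

/-- A representative in `E0` of a point of the orbit space. -/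
def rep (h : IsOrbitMap p E0 a j) (y : B) : E := (h.surj y).choose

lemma rep_mem (h : IsOrbitMap p E0 a j) (y : B) : h.rep y ∈ E0 := (h.surj y).choose_spec.1

lemma p_rep (h : IsOrbitMap p E0 a j) (y : B) : p (h.rep y) = y := (h.surj y).choose_spec.2

lemma mem_image_iff (h : IsOrbitMap p E0 a j) (hP : IsInvariant E0 a j P) {x : E} (hx : x ∈ E0) :
    p x ∈ p '' P ↔ x ∈ P := by
  refine ⟨?_, fun h => ⟨x, h, rfl⟩⟩
  rintro ⟨x', hx', he⟩
  obtain ⟨z, hz, rfl | rfl⟩ := h.orbit x' (hP.sub hx') x hx he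
  · exact hP.act z hz _ hx'
  · exact hP.act z hz _ (hP.conj _ hx')

lemma isOpen_image (h : IsOrbitMap p E0 a j) (hP : IsInvariant E0 a j P) (ho : IsOpen P) :
    IsOpen (p '' P) := by
  rw [isOpen_iff_mem_nhds]
  rintro _ ⟨x, hx, rfl⟩
  rw [← h.map_nhds x (hP.sub hx)]
  exact image_mem_map (ho.mem_nhds hx)

lemma desc_apply (h : IsOrbitMap p E0 a j) (hP : IsInvariant E0 a j P) {C : Type*} {F : E → C}
    (ha : ∀ z ≠ 0, ∀ x ∈ P, F (a z x) = F x) (hj : ∀ x ∈ P, F (j x) = F x) {x : E} (hx : x ∈ P) :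
    F (h.rep (p x)) = F x := by
  obtain ⟨z, hz, he | he⟩ := h.orbit x (hP.sub hx) _ (h.rep_mem _) (h.p_rep _).symm
  · rw [he, ha z hz x hx]
  · rw [he, ha z hz _ (hP.conj x hx), hj x hx]

lemma continuousOn_desc (h : IsOrbitMap p E0 a j) (hP : IsInvariant E0 a j P) (ho : IsOpen P)
    {F : E → C} (ha : ∀ z ≠ 0, ∀ x ∈ P, F (a z x) = F x) (hj : ∀ x ∈ P, F (j x) = F x)
    (hF : ContinuousOn F P) : ContinuousOn (fun y => F (h.rep y)) (p '' P) := by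
  rintro _ ⟨x, hx, rfl⟩
  refine ContinuousAt.continuousWithinAt ?_
  rw [ContinuousAt, ← h.map_nhds x (hP.sub hx), tendsto_map'_iff, h.desc_apply hP ha hj hx]
  refine (hF.continuousAt (ho.mem_nhds hx)).tendsto.congr' ?_
  filter_upwards [ho.mem_nhds hx] with x' hx'
  exact (h.desc_apply hP ha hj hx').symm

lemma continuousOn_desc_prod (h : IsOrbitMap p E0 a j) (hP : IsInvariant E0 a j P)
    (ho : IsOpen P) {F : E × ℝ → C} {T : Set ℝ}
    (ha : ∀ s ∈ T, ∀ z ≠ 0, ∀ x ∈ P, F (a z x, s) = F (x, s))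
    (hj : ∀ s ∈ T, ∀ x ∈ P, F (j x, s) = F (x, s)) (hF : ContinuousOn F (P ×ˢ T)) :
    ContinuousOn (fun y : B × ℝ => F (h.rep y.1, y.2)) ((p '' P) ×ˢ T) := by
  rintro ⟨_, s⟩ ⟨⟨x, hx, rfl⟩, hs⟩
  have hs : s ∈ T := hs
  have hdesc : ∀ s ∈ T, ∀ x ∈ P, F (h.rep (p x), s) = F (x, s) := fun s hs x hx =>
    h.desc_apply hP (F := fun x => F (x, s)) (ha s hs) (hj s hs) hx
  have h1 : 𝓝[(p '' P) ×ˢ T] (p x, s) = map (Prod.map p id) (𝓝[P ×ˢ T] (x, s)) := by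
    rw [nhdsWithin_prod_eq, nhdsWithin_prod_eq,
      (h.isOpen_image hP ho).nhdsWithin_eq ⟨x, hx, rfl⟩, ho.nhdsWithin_eq hx,
      ← h.map_nhds x (hP.sub hx), ← prod_map_map_eq', map_id]
  rw [ContinuousWithinAt, h1, tendsto_map'_iff]
  simp only [hdesc s hs x hx]
  refine (hF (x, s) ⟨hx, hs⟩).tendsto.congr' ?_
  filter_upwards [self_mem_nhdsWithin] with x' hx'
  exact (hdesc _ hx'.2 _ hx'.1).symm

end IsOrbitMap

lemma act_ne_zero {q : ℕ} {z : ℂ} (hz : z ≠ 0) {x : HSpace q × ℂ} (hx : x ≠ 0) : act z x ≠ 0 := by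
  intro h
  apply hx
  have h1 : (z : Quaternion ℝ) • x.1 = 0 := congrArg Prod.fst h
  have h2 : z ^ 2 * x.2 = 0 := congrArg Prod.snd h
  exact Prod.ext ((smul_eq_zero.1 h1).resolve_left (coeComplex_ne_zero hz))
    ((mul_eq_zero.1 h2).resolve_left (pow_ne_zero 2 hz))

lemma conjJ_ne_zero {q : ℕ} {x : HSpace q × ℂ} (hx : x ≠ 0) : conjJ x ≠ 0 := by
  intro h
  apply hx
  have h1 : quatJ • x.1 = 0 := congrArg Prod.fst h
  have h2 : starRingEnd ℂ x.2 = 0 := congrArg Prod.snd h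
  exact Prod.ext ((smul_eq_zero.1 h1).resolve_left quatJ_ne_zero) (by simpa using h2)

/-- The orbit space `Y q` is the quotient of the nonzero vectors of `ℍ^q × ℂ`, also as a space. -/
theorem isOrbitMap_proj (q : ℕ) : IsOrbitMap (proj (q := q)) {0}ᶜ act conjJ where
  isOpen := isOpen_compl_singleton
  map_nhds x hx := by
    refine le_antisymm (continuousAt_proj hx) fun s hs => ?_
    obtain ⟨U, hU, hUo, hxU⟩ := mem_nhds_iff.1 hs
    have h1 := isOpen_image_proj (hUo.inter (isOpen_compl_singleton (x := (0 : HSpace q × ℂ))))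
      fun h => h.2 rfl
    refine mem_of_superset (h1.mem_nhds ⟨x, ⟨hxU, hx⟩, rfl⟩) ?_
    rintro _ ⟨x', hx', rfl⟩
    exact hU hx'.1
  surj := exists_proj_eq
  act _ hz x := proj_act hz x
  conj := proj_conjJ
  orbit x hx x' hx' h := orbit_of_proj_eq hx hx' h

end Descent

/-! ### Coordinates -/

section Coordinates

open Filter

variable {q : ℕ}

/-- The space `ℍ^(q+1) × ℂ` in the coordinates `(a, b, v, c)`, where `a + b j` and `v` are the
first coordinate and the remaining coordinates of a vector of `ℍ^(q+1)`. -/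
abbrev Coord (q : ℕ) : Type := ℂ × ℂ × HSpace q × ℂ

/-- The quaternion `a + b j`. -/
def quat (a b : ℂ) : Quaternion ℝ := ⟨a.re, a.im, b.re, b.im⟩

lemma quat_smul (z a b : ℂ) : quat (z * a) (z * b) = (z : Quaternion ℝ) * quat a b := by
  apply Quaternion.ext <;>
    simp only [Quaternion.re_mul, Quaternion.imI_mul, Quaternion.imJ_mul, Quaternion.imK_mul,
      Quaternion.re_coeComplex, Quaternion.imI_coeComplex, Quaternion.imJ_coeComplex,
      Quaternion.imK_coeComplex] <;>
    simp [quat]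

lemma quat_conj (a b : ℂ) :
    quat (-starRingEnd ℂ b) (starRingEnd ℂ a) = quatJ * quat a b := by
  apply Quaternion.ext <;>
    simp only [Quaternion.re_mul, Quaternion.imI_mul, Quaternion.imJ_mul, Quaternion.imK_mul] <;>
    simp [quat, quatJ]

lemma quat_eq_zero {a b : ℂ} : quat a b = 0 ↔ a = 0 ∧ b = 0 := by
  constructor
  · intro h
    exact ⟨Complex.ext (congrArg QuaternionAlgebra.re h) (congrArg QuaternionAlgebra.imI h),
      Complex.ext (congrArg QuaternionAlgebra.imJ h) (congrArg QuaternionAlgebra.imK h)⟩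
  · rintro ⟨rfl, rfl⟩
    rfl

/-- The linear isomorphism `(a, b) ↦ a + b j`. -/
def quatEquiv : (ℂ × ℂ) ≃L[ℝ] Quaternion ℝ :=
  LinearEquiv.toContinuousLinearEquiv
    { toFun := fun x => quat x.1 x.2
      invFun := fun w => (⟨w.re, w.imI⟩, ⟨w.imJ, w.imK⟩)
      map_add' := fun x y => by apply Quaternion.ext <;> simp [quat] <;> rfl
      map_smul' := fun r x => by apply Quaternion.ext <;> simp [quat] <;> rfl
      left_inv := fun x => rfl
      right_inv := fun w => rfl }

lemma continuous_quat : Continuous fun x : ℂ × ℂ => quat x.1 x.2 := quatEquiv.continuous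

/-- The coordinates as a homeomorphism. -/
def coordHomeo (q : ℕ) : Coord q ≃ₜ HSpace (q + 1) × ℂ where
  toFun x := (Fin.cons (quat x.1 x.2.1) x.2.2.1, x.2.2.2)
  invFun y := ((quatEquiv.symm (y.1 0)).1, (quatEquiv.symm (y.1 0)).2, fun i => y.1 i.succ, y.2)
  left_inv x := rfl
  right_inv y := by
    refine Prod.ext (funext fun i => ?_) rfl
    refine Fin.cases ?_ (fun _ => rfl) i
    exact quatEquiv.apply_symm_apply (y.1 0)
  continuous_toFun := by
    refine Continuous.prodMk (continuous_pi fun i => ?_) (by fun_prop)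
    refine Fin.cases ?_ (fun i => ?_) i
    · exact continuous_quat.comp (by fun_prop : Continuous fun x : Coord q => (x.1, x.2.1))
    · exact (continuous_apply i).comp (by fun_prop : Continuous fun x : Coord q => x.2.2.1)
  continuous_invFun := by
    have := quatEquiv.symm.continuous
    fun_prop

/-- The action of a complex number, in coordinates. -/
def cact (z : ℂ) (x : Coord q) : Coord q :=
  (z * x.1, z * x.2.1, (z : Quaternion ℝ) • x.2.2.1, z ^ 2 * x.2.2.2)

/-- The action of `j`, in coordinates. -/
def cconj (x : Coord q) : Coord q :=
  (-starRingEnd ℂ x.2.1, starRingEnd ℂ x.1, quatJ • x.2.2.1, starRingEnd ℂ x.2.2.2)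

lemma coordHomeo_cact (z : ℂ) (x : Coord q) :
    coordHomeo q (cact z x) = act z (coordHomeo q x) := by
  refine Prod.ext (funext fun i => ?_) rfl
  refine Fin.cases ?_ (fun _ => rfl) i
  exact quat_smul z x.1 x.2.1

lemma coordHomeo_cconj (x : Coord q) :
    coordHomeo q (cconj x) = conjJ (coordHomeo q x) := by
  refine Prod.ext (funext fun i => ?_) rfl
  refine Fin.cases ?_ (fun _ => rfl) i
  exact quat_conj x.1 x.2.1

lemma coordHomeo_ne_zero {x : Coord q} (hx : x ≠ 0) : coordHomeo q x ≠ 0 := by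
  intro h
  apply hx
  apply (coordHomeo q).injective
  rw [h]
  refine Prod.ext (funext fun i => ?_) rfl
  refine Fin.cases ?_ (fun _ => rfl) i
  exact (quat_eq_zero.2 ⟨rfl, rfl⟩).symm

/-- The quotient map to the orbit space, in coordinates. -/
def cproj (x : Coord q) : Y (q + 1) := proj (coordHomeo q x)

lemma cproj_cact {z : ℂ} (hz : z ≠ 0) (x : Coord q) : cproj (cact z x) = cproj x := by
  rw [cproj, coordHomeo_cact, proj_act hz, cproj]

lemma cproj_cconj (x : Coord q) : cproj (cconj x) = cproj x := by
  rw [cproj, coordHomeo_cconj, proj_conjJ, cproj]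

theorem isOrbitMap_cproj (q : ℕ) : IsOrbitMap (cproj (q := q)) {0}ᶜ cact cconj where
  isOpen := isOpen_compl_singleton
  map_nhds x hx := by
    rw [show cproj = proj ∘ coordHomeo q from rfl, ← map_map, (coordHomeo q).map_nhds_eq]
    exact (isOrbitMap_proj (q + 1)).map_nhds _ (coordHomeo_ne_zero hx)
  surj y := by
    obtain ⟨x, hx, rfl⟩ := exists_proj_eq y
    refine ⟨(coordHomeo q).symm x, fun h => hx ?_, by
      rw [cproj, Homeomorph.apply_symm_apply]⟩
    have h1 : (coordHomeo q).symm x = (coordHomeo q).symm 0 := by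
      rw [show (coordHomeo q).symm x = 0 from h]
      rfl
    exact (coordHomeo q).symm.injective h1
  act _ hz x := cproj_cact hz x
  conj := cproj_cconj
  orbit x hx x' hx' h := by
    obtain ⟨z, hz, h1 | h1⟩ := orbit_of_proj_eq (coordHomeo_ne_zero hx) (coordHomeo_ne_zero hx') h
    · rw [← coordHomeo_cact] at h1
      exact ⟨z, hz, Or.inl ((coordHomeo q).injective h1)⟩
    · rw [← coordHomeo_cconj, ← coordHomeo_cact] at h1
      exact ⟨z, hz, Or.inr ((coordHomeo q).injective h1)⟩

end Coordinates


/-! ### The pieces of the orbit space -/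

section Pieces

open Topology Filter RelHom

variable {q : ℕ}

/-- The vectors with a nonzero component in `ℍ^q × ℂ`. -/
def setN (q : ℕ) : Set (Coord q) := {x | x.2.2.1 ≠ 0 ∨ x.2.2.2 ≠ 0}

/-- The vectors whose coordinates `a` and `b` are both nonzero. -/
def setV (q : ℕ) : Set (Coord q) := {x | x.1 ≠ 0 ∧ x.2.1 ≠ 0}

/-- The vectors for which `c / (a b)` has nonzero real part. -/
def setV0 (q : ℕ) : Set (Coord q) :=
  {x | (x.1 ≠ 0 ∧ x.2.1 ≠ 0) ∧ (x.2.2.2 / (x.1 * x.2.1)).re ≠ 0}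

/-- The vectors whose coordinates `a` and `b` have different absolute values. -/
def setD (q : ℕ) : Set (Coord q) := {x | ‖x.1‖ ≠ ‖x.2.1‖}

/-- The invariance under `ℂ^×` and `j` of a set of nonzero vectors. -/
abbrev Inv (P : Set (Coord q)) : Prop := IsInvariant {0}ᶜ cact cconj P

lemma inv_union {P P' : Set (Coord q)} (h : Inv P) (h' : Inv P') : Inv (P ∪ P') where
  sub := Set.union_subset h.sub h'.sub
  act z hz x hx := hx.imp (h.act z hz x) (h'.act z hz x)
  conj x hx := hx.imp (h.conj x) (h'.conj x)

lemma image_inter {P P' : Set (Coord q)} (h : Inv P) (h' : Inv P') :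
    cproj '' (P ∩ P') = cproj '' P ∩ cproj '' P' := by
  refine (Set.image_inter_subset _ _ _).antisymm ?_
  rintro _ ⟨⟨x, hx, rfl⟩, hx'⟩
  exact ⟨x, ⟨hx, ((isOrbitMap_cproj q).mem_image_iff h' (h.sub hx)).1 hx'⟩, rfl⟩

lemma inv_setN : Inv (setN q) where
  sub x hx h := by
    rw [show x = 0 from h] at hx
    exact hx.elim (fun h => h rfl) (fun h => h rfl)
  act z hz x hx := hx.imp (fun h => smul_ne_zero (coeComplex_ne_zero hz) h)
    (fun h => mul_ne_zero (pow_ne_zero 2 hz) h)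
  conj x hx := hx.imp (fun h => smul_ne_zero quatJ_ne_zero h)
    (fun h => (map_ne_zero (starRingEnd ℂ)).2 h)

lemma inv_setV : Inv (setV q) where
  sub _ hx h := hx.1 (congrArg Prod.fst h)
  act _ hz _ hx := ⟨mul_ne_zero hz hx.1, mul_ne_zero hz hx.2⟩
  conj _ hx := ⟨neg_ne_zero.2 ((map_ne_zero (starRingEnd ℂ)).2 hx.2),
    (map_ne_zero (starRingEnd ℂ)).2 hx.1⟩

lemma quotient_cact {z : ℂ} (hz : z ≠ 0) (x : Coord q) :
    (cact z x).2.2.2 / ((cact z x).1 * (cact z x).2.1) = x.2.2.2 / (x.1 * x.2.1) := by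
  change z ^ 2 * x.2.2.2 / (z * x.1 * (z * x.2.1)) = _
  rw [show z * x.1 * (z * x.2.1) = z ^ 2 * (x.1 * x.2.1) by ring,
    mul_div_mul_left _ _ (pow_ne_zero 2 hz)]

lemma quotient_cconj (x : Coord q) :
    (cconj x).2.2.2 / ((cconj x).1 * (cconj x).2.1) =
      -starRingEnd ℂ (x.2.2.2 / (x.1 * x.2.1)) := by
  change starRingEnd ℂ x.2.2.2 / (-starRingEnd ℂ x.2.1 * starRingEnd ℂ x.1) = _
  rw [map_div₀, map_mul, neg_mul, div_neg, mul_comm (starRingEnd ℂ x.1)]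

lemma inv_setV0 : Inv (setV0 q) where
  sub x hx := inv_setV.sub hx.1
  act z hz x hx := ⟨inv_setV.act z hz x hx.1, by rw [quotient_cact hz]; exact hx.2⟩
  conj x hx := ⟨inv_setV.conj x hx.1, by
    rw [quotient_cconj, Complex.neg_re, Complex.conj_re]
    exact neg_ne_zero.2 hx.2⟩

lemma inv_setD : Inv (setD q) where
  sub x hx h := by
    rw [show x = 0 from h] at hx
    exact hx rfl
  act z hz x hx := by
    change ‖z * x.1‖ ≠ ‖z * x.2.1‖
    rw [norm_mul, norm_mul]
    exact fun h => hx (mul_left_cancel₀ (norm_ne_zero_iff.2 hz) h)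
  conj x hx := by
    change ‖-starRingEnd ℂ x.2.1‖ ≠ ‖starRingEnd ℂ x.1‖
    rw [norm_neg, RCLike.norm_conj, RCLike.norm_conj]
    exact hx.symm

lemma isOpen_setN : IsOpen (setN q) :=
  (isOpen_ne.preimage (by fun_prop : Continuous fun x : Coord q => x.2.2.1)).union
    (isOpen_ne.preimage (by fun_prop : Continuous fun x : Coord q => x.2.2.2))

lemma isOpen_setV : IsOpen (setV q) :=
  (isOpen_ne.preimage (by fun_prop : Continuous fun x : Coord q => x.1)).inter
    (isOpen_ne.preimage (by fun_prop : Continuous fun x : Coord q => x.2.1))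

lemma continuousOn_quotient :
    ContinuousOn (fun x : Coord q => x.2.2.2 / (x.1 * x.2.1)) (setV q) :=
  ContinuousOn.div (by fun_prop) (by fun_prop) fun _ hx => mul_ne_zero hx.1 hx.2

lemma isOpen_setV0 : IsOpen (setV0 q) :=
  (Complex.continuous_re.comp_continuousOn continuousOn_quotient).isOpen_inter_preimage
    isOpen_setV isOpen_ne

lemma isOpen_setD : IsOpen (setD q) := isOpen_ne_fun (by fun_prop) (by fun_prop)

lemma isOpen_cproj {P : Set (Coord q)} (h : Inv P) (ho : IsOpen P) : IsOpen (cproj '' P) :=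
  (isOrbitMap_cproj q).isOpen_image h ho

lemma continuousOn_cproj : ContinuousOn (cproj (q := q)) {0}ᶜ := fun x hx =>
  ContinuousAt.continuousWithinAt ((isOrbitMap_cproj q).map_nhds x hx).le

lemma continuousOn_cproj_comp {E : Type*} [TopologicalSpace E] {S : Set E} {G : E → Coord q}
    (hG : ContinuousOn G S) (h0 : ∀ x ∈ S, G x ≠ 0) : ContinuousOn (fun x => cproj (G x)) S :=
  continuousOn_cproj.comp hG h0

lemma image_union_setD : cproj '' setD q ∪ cproj '' (setN q ∪ setV q) = Set.univ := by
  refine Set.eq_univ_of_forall fun y => ?_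
  obtain ⟨x, hx, rfl⟩ := (isOrbitMap_cproj q).surj y
  by_contra h
  rw [Set.mem_union, not_or] at h
  obtain ⟨h1, h2⟩ := h
  have hD : ‖x.1‖ = ‖x.2.1‖ := by
    by_contra hne
    exact h1 ⟨x, hne, rfl⟩
  have hC : ¬ (x ∈ setN q ∪ setV q) := fun hne => h2 ⟨x, hne, rfl⟩
  simp only [setN, setV, Set.mem_union, Set.mem_ofPred_eq, not_or, not_not, not_and] at hC
  obtain ⟨⟨hv, hc⟩, hab⟩ := hC
  have ha : x.1 = 0 := by
    by_contra ha
    rw [hab ha, norm_zero, norm_eq_zero] at hD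
    exact ha hD
  have hb : x.2.1 = 0 := by
    rw [ha, norm_zero] at hD
    exact norm_eq_zero.1 hD.symm
  exact hx (Prod.ext ha (Prod.ext hb (Prod.ext hv hc)))

/-- The subset `N` is homotopy equivalent to the orbit space of the next lower dimension. -/
theorem equiv_setN (q n : ℕ) :
    Nonempty (H n (Set.univ : Set (Y q)) ∅ ≃ₗ[ℤ] H n (cproj '' setN q) ∅) := by
  have hp := isOrbitMap_proj q
  have hc := isOrbitMap_cproj q
  have hI : IsInvariant ({0}ᶜ : Set (HSpace q × ℂ)) act conjJ {0}ᶜ :=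
    ⟨subset_rfl, fun z hz x hx => act_ne_zero hz hx, fun x hx => conjJ_ne_zero hx⟩
  have himg : proj '' ({0}ᶜ : Set (HSpace q × ℂ)) = Set.univ :=
    Set.eq_univ_of_forall fun y => hp.surj y
  -- the inclusion of `ℍ^q × ℂ` and the projection onto it
  let i : HSpace q × ℂ → Coord q := fun x => (0, 0, x.1, x.2)
  let r : Coord q → HSpace q × ℂ := fun x => (x.2.2.1, x.2.2.2)
  have hi : ∀ x ∈ ({0}ᶜ : Set (HSpace q × ℂ)), i x ∈ setN q := by
    intro x hx
    by_contra h
    simp only [setN, Set.mem_ofPred_eq, not_or, not_not] at h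
    exact hx (Prod.ext h.1 h.2)
  have hr : ∀ x ∈ setN q, r x ∈ ({0}ᶜ : Set (HSpace q × ℂ)) := by
    rintro x (hx | hx) h
    · exact hx (congrArg Prod.fst h)
    · exact hx (congrArg Prod.snd h)
  let F : HSpace q × ℂ → Y (q + 1) := fun x => cproj (i x)
  have hFa : ∀ z ≠ 0, ∀ x ∈ ({0}ᶜ : Set (HSpace q × ℂ)), F (act z x) = F x := by
    intro z hz x _
    change cproj (i (act z x)) = cproj (i x)
    rw [← cproj_cact hz (i x)]
    congr 1
    simp [i, act, cact]
  have hFj : ∀ x ∈ ({0}ᶜ : Set (HSpace q × ℂ)), F (conjJ x) = F x := by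
    intro x _
    change cproj (i (conjJ x)) = cproj (i x)
    rw [← cproj_cconj (i x)]
    congr 1
    simp [i, conjJ, cconj]
  have hFc : ContinuousOn F {0}ᶜ :=
    continuousOn_cproj_comp (by fun_prop) fun x hx => inv_setN.sub (hi x hx)
  let G : Coord q → Y q := fun x => proj (r x)
  have hGa : ∀ z ≠ 0, ∀ x ∈ setN q, G (cact z x) = G x := fun z hz x _ => proj_act hz (r x)
  have hGj : ∀ x ∈ setN q, G (cconj x) = G x := fun x _ => proj_conjJ (r x)
  have hGc : ContinuousOn G (setN q) := fun x hx =>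
    ContinuousAt.continuousWithinAt (ContinuousAt.comp (f := r) (continuousAt_proj (hr x hx))
      (by fun_prop))
  -- the homotopy that contracts the first coordinate
  let κ : Coord q × ℝ → Coord q := fun p =>
    (((1 - p.2 : ℝ) : ℂ) * p.1.1, ((1 - p.2 : ℝ) : ℂ) * p.1.2.1, p.1.2.2.1, p.1.2.2.2)
  have hκ : ∀ x ∈ setN q, ∀ s, κ (x, s) ∈ setN q := fun x hx _ => hx
  let K : Coord q × ℝ → Y (q + 1) := fun p => cproj (κ p)
  have hKa : ∀ s, ∀ z ≠ 0, ∀ x ∈ setN q, K (cact z x, s) = K (x, s) := by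
    intro s z hz x _
    change cproj (κ (cact z x, s)) = cproj (κ (x, s))
    rw [← cproj_cact hz (κ (x, s))]
    congr 1
    simp [κ, cact, mul_left_comm]
  have hKj : ∀ s, ∀ x ∈ setN q, K (cconj x, s) = K (x, s) := by
    intro s x _
    change cproj (κ (cconj x, s)) = cproj (κ (x, s))
    rw [← cproj_cconj (κ (x, s))]
    congr 1
    simp [κ, cconj]
  have hKc : ContinuousOn K (setN q ×ˢ Set.Icc (0 : ℝ) 1) :=
    continuousOn_cproj_comp (by fun_prop) fun p hp => inv_setN.sub (hκ p.1 hp.1 p.2)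
  have hF : ∀ x ≠ 0, F (hp.rep (proj x)) = F x := fun x hx => hp.desc_apply hI hFa hFj hx
  have hG : ∀ x ∈ setN q, G (hc.rep (cproj x)) = G x := fun x hx =>
    hc.desc_apply inv_setN hGa hGj hx
  have hK : ∀ s, ∀ x ∈ setN q, K (hc.rep (cproj x), s) = K (x, s) := fun s x hx =>
    hc.desc_apply inv_setN (F := fun x => K (x, s)) (hKa s) (hKj s) hx
  let e : HEquiv (Set.univ : Set (Y q)) ∅ (cproj '' setN q) ∅ :=
    HEquiv.ofHomotopies (fun y => F (hp.rep y)) (fun y => G (hc.rep y))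
      (himg ▸ hp.continuousOn_desc hI isOpen_compl_singleton hFa hFj hFc)
      (hc.continuousOn_desc inv_setN isOpen_setN hGa hGj hGc)
      (fun y _ => ⟨_, hi _ (hp.rep_mem y), rfl⟩) (Set.mapsTo_univ _ _)
      Prod.fst continuousOn_fst (Set.mapsTo_univ _ _) (fun _ _ => rfl) (fun y _ => by
        change y = G (hc.rep (cproj (i (hp.rep y))))
        rw [hG _ (hi _ (hp.rep_mem y))]
        exact (hp.p_rep y).symm)
      (fun p => K (hc.rep p.1, p.2))
      (hc.continuousOn_desc_prod inv_setN isOpen_setN (fun s _ => hKa s) (fun s _ => hKj s) hKc)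
      (by
        rintro ⟨_, s⟩ ⟨⟨x, hx, rfl⟩, -⟩
        change K (hc.rep (cproj x), s) ∈ _
        rw [hK s x hx]
        exact ⟨_, hκ x hx s, rfl⟩)
      (by
        rintro _ ⟨x, hx, rfl⟩
        change K (hc.rep (cproj x), 0) = _
        rw [hK 0 x hx]
        simp [K, κ])
      (by
        rintro _ ⟨x, hx, rfl⟩
        change K (hc.rep (cproj x), 1) = F (hp.rep (G (hc.rep (cproj x))))
        rw [hK 1 x hx, hG x hx, hF _ (hr x hx)]
        simp [K, κ, F, i, r])
  exact e.equiv n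

/-! ### The local homology at the added point -/

/-- The chart at the point with coordinates `(1, 0, 0, 0)`. -/
def chart (x : Coord q) : ℂ × HSpace q × ℂ :=
  if ‖x.2.1‖ < ‖x.1‖ then (x.2.1 / x.1, (quat x.1 x.2.1)⁻¹ • x.2.2.1, x.2.2.2 / x.1 ^ 2)
  else (-(starRingEnd ℂ x.1 / starRingEnd ℂ x.2.1), (quat x.1 x.2.1)⁻¹ • x.2.2.1,
    starRingEnd ℂ x.2.2.2 / starRingEnd ℂ x.2.1 ^ 2)

/-- The inverse of the chart. -/
def chartInv (e : ℂ × HSpace q × ℂ) : Coord q := (1, e.1, quat 1 e.1 • e.2.1, e.2.2)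

lemma chart_cact {z : ℂ} (hz : z ≠ 0) (x : Coord q) : chart (cact z x) = chart x := by
  have hz' : starRingEnd ℂ z ≠ 0 := (map_ne_zero (starRingEnd ℂ)).2 hz
  have h1 : ‖z * x.2.1‖ < ‖z * x.1‖ ↔ ‖x.2.1‖ < ‖x.1‖ := by
    rw [norm_mul, norm_mul, mul_lt_mul_iff_right₀ (norm_pos_iff.2 hz)]
  have h2 : (quat (z * x.1) (z * x.2.1))⁻¹ • (z : Quaternion ℝ) • x.2.2.1 =
      (quat x.1 x.2.1)⁻¹ • x.2.2.1 := by
    rw [quat_smul, mul_inv_rev, smul_smul, mul_assoc, inv_mul_cancel₀ (coeComplex_ne_zero hz),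
      mul_one]
  simp only [chart, cact, h1, h2, mul_pow, map_mul, map_pow, mul_div_mul_left _ _ hz,
    mul_div_mul_left _ _ hz', mul_div_mul_left _ _ (pow_ne_zero 2 hz),
    mul_div_mul_left _ _ (pow_ne_zero 2 hz')]

lemma chart_cconj {x : Coord q} (hx : x ∈ setD q) : chart (cconj x) = chart x := by
  have h2 : (quat (-starRingEnd ℂ x.2.1) (starRingEnd ℂ x.1))⁻¹ • quatJ • x.2.2.1 =
      (quat x.1 x.2.1)⁻¹ • x.2.2.1 := by
    rw [quat_conj, mul_inv_rev, smul_smul, mul_assoc, inv_mul_cancel₀ quatJ_ne_zero, mul_one]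
  rcases lt_or_gt_of_ne hx with h | h
  · simp [chart, cconj, h2, h, not_lt.2 h.le, div_neg]
  · simp [chart, cconj, h2, h, not_lt.2 h.le, neg_div]

lemma quat_ne_zero_of_mem {x : Coord q} (hx : x ∈ setD q) : quat x.1 x.2.1 ≠ 0 := by
  intro h
  obtain ⟨h1, h2⟩ := quat_eq_zero.1 h
  exact hx (by rw [h1, h2])

lemma continuousOn_quat_inv_smul {S : Set (Coord q)} (hS : ∀ x ∈ S, quat x.1 x.2.1 ≠ 0) :
    ContinuousOn (fun x : Coord q => (quat x.1 x.2.1)⁻¹ • x.2.2.1) S := by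
  have h : Continuous fun x : Coord q => quat x.1 x.2.1 :=
    continuous_quat.comp (by fun_prop : Continuous fun x : Coord q => (x.1, x.2.1))
  exact (h.continuousOn.inv₀ hS).smul (by fun_prop)

lemma continuousOn_chart : ContinuousOn (chart (q := q)) (setD q) := by
  intro x hx
  have hconj := Complex.continuous_conj
  have hw : ContinuousAt (fun x : Coord q => (quat x.1 x.2.1)⁻¹ • x.2.2.1) x :=
    (continuousOn_quat_inv_smul fun _ => quat_ne_zero_of_mem).continuousAt
      (isOpen_setD.mem_nhds hx)
  refine ContinuousAt.continuousWithinAt ?_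
  rcases lt_or_gt_of_ne hx with h | h
  · have hb : x.2.1 ≠ 0 := norm_pos_iff.1 ((norm_nonneg _).trans_lt h)
    have hb' : starRingEnd ℂ x.2.1 ≠ 0 := (map_ne_zero (starRingEnd ℂ)).2 hb
    have hev : ∀ᶠ y : Coord q in 𝓝 x, ‖y.1‖ < ‖y.2.1‖ :=
      ContinuousAt.eventually_lt (by fun_prop) (by fun_prop) h
    refine ContinuousAt.congr (f := fun x : Coord q =>
      (-(starRingEnd ℂ x.1 / starRingEnd ℂ x.2.1), (quat x.1 x.2.1)⁻¹ • x.2.2.1,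
        starRingEnd ℂ x.2.2.2 / starRingEnd ℂ x.2.1 ^ 2)) ?_ ?_
    · refine ContinuousAt.prodMk (ContinuousAt.neg (ContinuousAt.div (by fun_prop) (by fun_prop)
        hb')) (hw.prodMk (ContinuousAt.div (by fun_prop) (by fun_prop) (pow_ne_zero 2 hb')))
    · filter_upwards [hev] with y hy
      rw [chart, if_neg (not_lt.2 hy.le)]
  · have ha : x.1 ≠ 0 := norm_pos_iff.1 ((norm_nonneg _).trans_lt h)
    have hev : ∀ᶠ y : Coord q in 𝓝 x, ‖y.2.1‖ < ‖y.1‖ :=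
      ContinuousAt.eventually_lt (by fun_prop) (by fun_prop) h
    refine ContinuousAt.congr (f := fun x : Coord q =>
      (x.2.1 / x.1, (quat x.1 x.2.1)⁻¹ • x.2.2.1, x.2.2.2 / x.1 ^ 2)) ?_ ?_
    · refine ContinuousAt.prodMk (ContinuousAt.div (by fun_prop) (by fun_prop) ha)
        (hw.prodMk (ContinuousAt.div (by fun_prop) (by fun_prop) (pow_ne_zero 2 ha)))
    · filter_upwards [hev] with y hy
      rw [chart, if_pos hy]

lemma chart_chartInv {e : ℂ × HSpace q × ℂ} (he : ‖e.1‖ < 1) : chart (chartInv e) = e := by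
  have h : quat 1 e.1 ≠ 0 := fun h => one_ne_zero (quat_eq_zero.1 h).1
  have he' : ‖e.1‖ < ‖(1 : ℂ)‖ := by rwa [norm_one]
  rw [chart, chartInv, if_pos he']
  simp only [div_one, one_pow]
  rw [smul_smul, inv_mul_cancel₀ h, one_smul]

lemma cproj_chartInv_chart {x : Coord q} (hx : x ∈ setD q) :
    cproj (chartInv (chart x)) = cproj x := by
  have key : ∀ x : Coord q, x ∈ setD q → ‖x.2.1‖ < ‖x.1‖ →
      cproj (chartInv (chart x)) = cproj x := by
    intro x hx h
    have ha : x.1 ≠ 0 := norm_pos_iff.1 ((norm_nonneg _).trans_lt h)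
    rw [← cproj_cact (inv_ne_zero ha) x]
    congr 1
    rw [chart, if_pos h, chartInv, cact, inv_mul_cancel₀ ha, smul_smul]
    have h1 : quat 1 (x.2.1 / x.1) = ((x.1⁻¹ : ℂ) : Quaternion ℝ) * quat x.1 x.2.1 := by
      rw [← quat_smul, inv_mul_cancel₀ ha, div_eq_inv_mul]
    rw [h1, mul_assoc, mul_inv_cancel₀ (quat_ne_zero_of_mem hx), mul_one, div_eq_inv_mul,
      div_eq_inv_mul, inv_pow]
  rcases lt_or_gt_of_ne hx with h | h
  · rw [← cproj_cconj x, ← chart_cconj hx]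
    refine key _ (inv_setD.conj x hx) ?_
    change ‖starRingEnd ℂ x.1‖ < ‖-starRingEnd ℂ x.2.1‖
    rwa [norm_neg, RCLike.norm_conj, RCLike.norm_conj]
  · exact key x hx h

lemma norm_chart_lt {x : Coord q} (hx : x ∈ setD q) : ‖(chart x).1‖ < 1 := by
  rcases lt_or_gt_of_ne hx with h | h
  · have hb : 0 < ‖x.2.1‖ := (norm_nonneg _).trans_lt h
    rw [chart, if_neg (not_lt.2 h.le)]
    simpa [div_lt_one hb] using h
  · have ha : 0 < ‖x.1‖ := (norm_nonneg _).trans_lt h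
    rw [chart, if_pos h]
    simpa [div_lt_one ha] using h

lemma chart_ne_zero {x : Coord q} (hx : x ∈ setD q) (hx' : x ∈ setN q ∪ setV q) :
    chart x ≠ 0 := by
  intro h0
  have hw := quat_ne_zero_of_mem hx
  have hv : x.2.2.1 = 0 := by
    have h1 : (quat x.1 x.2.1)⁻¹ • x.2.2.1 = 0 := by
      have := congrArg (fun e => e.2.1) h0
      unfold chart at this
      split_ifs at this <;> exact this
    exact (smul_eq_zero.1 h1).resolve_left (inv_ne_zero hw)
  rcases lt_or_gt_of_ne hx with h | h
  · have hb : x.2.1 ≠ 0 := norm_pos_iff.1 ((norm_nonneg _).trans_lt h)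
    rw [chart, if_neg (not_lt.2 h.le)] at h0
    have h1 : -(starRingEnd ℂ x.1 / starRingEnd ℂ x.2.1) = 0 := congrArg (fun e => e.1) h0
    have h2 : starRingEnd ℂ x.2.2.2 / starRingEnd ℂ x.2.1 ^ 2 = 0 :=
      congrArg (fun e => e.2.2) h0
    simp [hb] at h1 h2
    rcases hx' with (h3 | h3) | h3
    · exact h3 hv
    · exact h3 h2
    · exact h3.1 h1
  · have ha : x.1 ≠ 0 := norm_pos_iff.1 ((norm_nonneg _).trans_lt h)
    rw [chart, if_pos h] at h0
    have h1 : x.2.1 / x.1 = 0 := congrArg (fun e => e.1) h0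
    have h2 : x.2.2.2 / x.1 ^ 2 = 0 := congrArg (fun e => e.2.2) h0
    simp [ha] at h1 h2
    rcases hx' with (h3 | h3) | h3
    · exact h3 hv
    · exact h3 h2
    · exact h3.2 h1

/-- The chart as an equivalence of pairs. -/
def chartEquiv (q : ℕ) : HEquiv (cproj '' setD q) (cproj '' (setD q ∩ (setN q ∪ setV q)))
    {e : ℂ × HSpace q × ℂ | ‖e.1‖ < 1} ({e | ‖e.1‖ < 1} ∩ {0}ᶜ) :=
  have hc := isOrbitMap_cproj q
  have hdesc : ∀ x ∈ setD q, chart (hc.rep (cproj x)) = chart x := fun x hx =>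
    hc.desc_apply inv_setD (fun z hz x _ => chart_cact hz x) (fun x hx => chart_cconj hx) hx
  have hD : ∀ e : ℂ × HSpace q × ℂ, ‖e.1‖ < 1 → chartInv e ∈ setD q := fun e he h => by
    change ‖(1 : ℂ)‖ = ‖e.1‖ at h
    rw [norm_one] at h
    exact absurd he (by rw [h]; exact lt_irrefl _)
  HEquiv.ofInverse (fun y => chart (hc.rep y)) (fun e => cproj (chartInv e))
    (Set.image_mono Set.inter_subset_left) Set.inter_subset_left
    (hc.continuousOn_desc inv_setD isOpen_setD (fun z hz x _ => chart_cact hz x)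
      (fun x hx => chart_cconj hx) continuousOn_chart)
    (continuousOn_cproj_comp (by
        have h : Continuous fun e : ℂ × HSpace q × ℂ => quat 1 e.1 :=
          continuous_quat.comp
            (by fun_prop : Continuous fun e : ℂ × HSpace q × ℂ => ((1 : ℂ), e.1))
        unfold chartInv
        fun_prop) fun e he => inv_setD.sub (hD e he))
    (by
      rintro _ ⟨x, hx, rfl⟩
      change ‖(chart (hc.rep (cproj x))).1‖ < 1
      rw [hdesc x hx]
      exact norm_chart_lt hx)
    (by
      rintro _ ⟨x, hx, rfl⟩
      change chart (hc.rep (cproj x)) ∈ _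
      rw [hdesc x hx.1]
      exact ⟨norm_chart_lt hx.1, chart_ne_zero hx.1 hx.2⟩)
    (fun e he => ⟨_, hD e he, rfl⟩)
    (by
      rintro e ⟨he, he0⟩
      refine ⟨_, ⟨hD e he, ?_⟩, rfl⟩
      by_contra h
      simp only [setN, setV, chartInv, Set.mem_union, Set.mem_ofPred_eq, not_or, not_not,
        not_and] at h
      have hw : quat 1 e.1 ≠ 0 := fun h => one_ne_zero (quat_eq_zero.1 h).1
      exact he0 (Prod.ext (h.2 one_ne_zero)
        (Prod.ext ((smul_eq_zero.1 h.1.1).resolve_left hw) h.1.2)))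
    (by
      rintro _ ⟨x, hx, rfl⟩
      rw [hdesc x hx]
      exact cproj_chartInv_chart hx)
    (by
      intro e he
      rw [hdesc _ (hD e he)]
      exact chart_chartInv he)

/-- The homology of the orbit space relative to the complement of the point with coordinates
`(1, 0, 0, 0)`. -/
theorem homology_rel_compl (q n : ℕ) :
    (n = 4 * q + 4 → Nonempty (H n Set.univ (cproj '' (setN q ∪ setV q)) ≃ₗ[ℤ] ℤ)) ∧
      (n ≠ 4 * q + 4 → Triv n Set.univ (cproj '' (setN q ∪ setV q))) := by
  have hI := inv_union (q := q) inv_setN inv_setV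
  have hrank : Module.finrank ℝ (ℂ × HSpace q × ℂ) = 4 * q + 4 := by
    rw [Module.finrank_prod, Module.finrank_prod, Complex.finrank_real_complex,
      Module.finrank_pi_fintype]
    simp [Quaternion.finrank_eq_four]
    ring
  obtain ⟨e1⟩ := excision (isOpen_cproj inv_setD isOpen_setD)
    (isOpen_cproj hI (isOpen_setN.union isOpen_setV)) n
  rw [image_union_setD, ← image_inter inv_setD hI] at e1
  obtain ⟨e2⟩ := (chartEquiv q).equiv n
  obtain ⟨e3⟩ := excision (U := {e : ℂ × HSpace q × ℂ | ‖e.1‖ < 1})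
    (V := ({0}ᶜ : Set (ℂ × HSpace q × ℂ)))
    (isOpen_lt (by fun_prop) (by fun_prop)) isOpen_compl_singleton n
  have huniv : {e : ℂ × HSpace q × ℂ | ‖e.1‖ < 1} ∪ {0}ᶜ = Set.univ := by
    refine Set.eq_univ_of_forall fun e => ?_
    by_cases he : e = 0
    · left
      rw [he]
      simp
    · exact Or.inr he
  rw [huniv] at e3
  have e4 := e1.symm.trans (e2.trans e3)
  obtain ⟨h1, h2⟩ := local_homology (ℂ × HSpace q × ℂ) n
  rw [hrank] at h1 h2
  refine ⟨fun hn => ?_, fun hn => (Triv.congr ⟨e4⟩).2 (h2 hn)⟩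
  obtain ⟨e5⟩ := h1 hn
  exact ⟨e4.trans e5⟩

end Pieces


section Torus

open Topology Filter RelHom

variable {q : ℕ}

/-! ### The suspension -/

/-- The coordinates of `(a + b j)⁻¹ v` and the imaginary part of `c / (a b)`. -/
def height (i : Option (Fin (Module.finrank ℝ (HSpace q)))) (x : Coord q) : ℝ :=
  match i with
  | some i => (Module.finBasis ℝ (HSpace q)).coord i ((quat x.1 x.2.1)⁻¹ • x.2.2.1)
  | none => (x.2.2.2 / (x.1 * x.2.1)).im

/-- The flows along which the functions `height i` are coordinates. -/
def shift (i : Option (Fin (Module.finrank ℝ (HSpace q)))) (p : Coord q × ℝ) : Coord q :=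
  match i with
  | some i => (p.1.1, p.1.2.1, p.1.2.2.1 + quat p.1.1 p.1.2.1 •
      (p.2 • Module.finBasis ℝ (HSpace q) i), p.1.2.2.2)
  | none => (p.1.1, p.1.2.1, p.1.2.2.1, p.1.2.2.2 + (p.2 : ℂ) * Complex.I * (p.1.1 * p.1.2.1))

lemma quat_ne_zero_of_mem_setV {x : Coord q} (hx : x ∈ setV q) : quat x.1 x.2.1 ≠ 0 := fun h =>
  hx.1 (quat_eq_zero.1 h).1

lemma height_cact (i) {z : ℂ} (hz : z ≠ 0) (x : Coord q) : height i (cact z x) = height i x := by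
  cases i with
  | none =>
    change ((cact z x).2.2.2 / ((cact z x).1 * (cact z x).2.1)).im = _
    rw [quotient_cact hz]
    rfl
  | some i =>
    change (Module.finBasis ℝ (HSpace q)).coord i
      ((quat (z * x.1) (z * x.2.1))⁻¹ • (z : Quaternion ℝ) • x.2.2.1) = _
    rw [quat_smul, mul_inv_rev, smul_smul, mul_assoc, inv_mul_cancel₀ (coeComplex_ne_zero hz),
      mul_one]
    rfl

lemma height_cconj (i) (x : Coord q) : height i (cconj x) = height i x := by
  cases i with
  | none =>
    change ((cconj x).2.2.2 / ((cconj x).1 * (cconj x).2.1)).im = _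
    rw [quotient_cconj, Complex.neg_im, Complex.conj_im, neg_neg]
    rfl
  | some i =>
    change (Module.finBasis ℝ (HSpace q)).coord i
      ((quat (-starRingEnd ℂ x.2.1) (starRingEnd ℂ x.1))⁻¹ • quatJ • x.2.2.1) = _
    rw [quat_conj, mul_inv_rev, smul_smul, mul_assoc, inv_mul_cancel₀ quatJ_ne_zero, mul_one]
    rfl

lemma continuousOn_height (i) : ContinuousOn (height (q := q) i) (setV q) := by
  cases i with
  | none => exact Complex.continuous_im.comp_continuousOn continuousOn_quotient
  | some i =>
    exact (LinearMap.continuous_of_finiteDimensional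
      ((Module.finBasis ℝ (HSpace q)).coord i)).comp_continuousOn
      (continuousOn_quat_inv_smul fun _ => quat_ne_zero_of_mem_setV)

lemma shift_cact (i) (z : ℂ) (x : Coord q) (s : ℝ) :
    shift i (cact z x, s) = cact z (shift i (x, s)) := by
  cases i with
  | none => simp only [shift, cact]; ring_nf
  | some i => simp only [shift, cact, quat_smul, mul_smul, smul_add]

lemma shift_cconj (i) (x : Coord q) (s : ℝ) :
    shift i (cconj x, s) = cconj (shift i (x, s)) := by
  cases i with
  | none =>
    refine Prod.ext rfl (Prod.ext rfl (Prod.ext rfl ?_))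
    change starRingEnd ℂ x.2.2.2 +
      (s : ℂ) * Complex.I * (-starRingEnd ℂ x.2.1 * starRingEnd ℂ x.1) =
      starRingEnd ℂ (x.2.2.2 + (s : ℂ) * Complex.I * (x.1 * x.2.1))
    simp only [map_add, map_mul, Complex.conj_ofReal, Complex.conj_I]
    ring
  | some i => simp only [shift, cconj, quat_conj, mul_smul, smul_add]

lemma continuous_shift (i) : Continuous (shift (q := q) i) := by
  cases i with
  | none =>
    unfold shift
    fun_prop
  | some i =>
    have h : Continuous fun p : Coord q × ℝ => quat p.1.1 p.1.2.1 :=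
      continuous_quat.comp (by fun_prop : Continuous fun p : Coord q × ℝ => (p.1.1, p.1.2.1))
    unfold shift
    fun_prop

lemma shift_mem_setV (i) {x : Coord q} (hx : x ∈ setV q) (s : ℝ) : shift i (x, s) ∈ setV q := by
  cases i <;> exact hx

lemma shift_mem_setV0 (i) {x : Coord q} (hx : x ∈ setV0 q) (s : ℝ) :
    shift i (x, s) ∈ setV0 q := by
  refine ⟨shift_mem_setV i hx.1 s, ?_⟩
  cases i with
  | none =>
    change ((x.2.2.2 + (s : ℂ) * Complex.I * (x.1 * x.2.1)) / (x.1 * x.2.1)).re ≠ 0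
    rw [add_div, mul_div_cancel_right₀ _ (mul_ne_zero hx.1.1 hx.1.2)]
    simpa using hx.2
  | some i => exact hx.2

lemma height_shift (i j) {x : Coord q} (hx : x ∈ setV q) (s : ℝ) :
    height j (shift i (x, s)) = height j x + if i = j then s else 0 := by
  have hw := quat_ne_zero_of_mem_setV hx
  cases i with
  | none =>
    cases j with
    | none =>
      change ((x.2.2.2 + (s : ℂ) * Complex.I * (x.1 * x.2.1)) / (x.1 * x.2.1)).im =
        (x.2.2.2 / (x.1 * x.2.1)).im + _
      rw [add_div, mul_div_cancel_right₀ _ (mul_ne_zero hx.1 hx.2)]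
      simp
    | some j => simp [height, shift]
  | some i =>
    cases j with
    | none => simp [height, shift]
    | some j =>
      simp only [height, shift, smul_add, smul_smul (quat x.1 x.2.1)⁻¹, inv_mul_cancel₀ hw,
        one_smul]
      simp [Finsupp.single_apply]

lemma mem_setN_iff {x : Coord q} (hx : x ∈ setV q) :
    x ∈ setN q ↔ (∃ i ∈ Finset.univ, height i x ≠ 0) ∨ x ∈ setV0 q := by
  have hw := quat_ne_zero_of_mem_setV hx
  have hv : x.2.2.1 = 0 ↔ ∀ i, height (some i) x = 0 := by
    change _ ↔ ∀ i, (Module.finBasis ℝ (HSpace q)).coord i ((quat x.1 x.2.1)⁻¹ • x.2.2.1) = 0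
    rw [Module.Basis.forall_coord_eq_zero_iff, smul_eq_zero]
    simp [hw]
  have hc : x.2.2.2 = 0 ↔ height none x = 0 ∧ x ∉ setV0 q := by
    have h1 : x ∉ setV0 q ↔ (x.2.2.2 / (x.1 * x.2.1)).re = 0 :=
      ⟨fun h => by_contra fun h' => h ⟨hx, h'⟩, fun h h' => h'.2 h⟩
    rw [h1, and_comm]
    change _ ↔ (x.2.2.2 / (x.1 * x.2.1)).re = 0 ∧ (x.2.2.2 / (x.1 * x.2.1)).im = 0
    have h2 : x.2.2.2 / (x.1 * x.2.1) = 0 ↔ x.2.2.2 = 0 := by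
      rw [div_eq_zero_iff, or_iff_left (mul_ne_zero hx.1 hx.2)]
    rw [← h2, Complex.ext_iff]
    rfl
  rw [← not_iff_not]
  simp only [setN, Set.mem_ofPred_eq, not_or, not_not, hv, hc, not_exists, not_and,
    Finset.mem_univ, forall_const, Option.forall]
  tauto

/-- The homology of the pair `(V ∪ N, N)` is that of the pair `(V, V0)`, up to a shift of
degree. -/
theorem equiv_suspension (q : ℕ) :
    (∀ n, Nonempty (H (n + (4 * q + 1)) (cproj '' (setN q ∪ setV q)) (cproj '' setN q) ≃ₗ[ℤ]
      H n (cproj '' setV q) (cproj '' setV0 q))) ∧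
      ∀ n < 4 * q + 1, Triv n (cproj '' (setN q ∪ setV q)) (cproj '' setN q) := by
  have hc := isOrbitMap_cproj q
  have hh : ∀ i, ∀ x ∈ setV q, height i (hc.rep (cproj x)) = height i x := fun i x hx =>
    hc.desc_apply inv_setV (fun z hz x _ => height_cact i hz x) (fun x _ => height_cconj i x) hx
  have hsa : ∀ i (s : ℝ), ∀ z ≠ 0, ∀ x ∈ setV q,
      cproj (shift i (cact z x, s)) = cproj (shift i (x, s)) := fun i s z hz x _ => by
    rw [shift_cact, cproj_cact hz]
  have hsj : ∀ i (s : ℝ), ∀ x ∈ setV q,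
      cproj (shift i (cconj x, s)) = cproj (shift i (x, s)) := fun i s x _ => by
    rw [shift_cconj, cproj_cconj]
  have hs : ∀ i, ∀ x ∈ setV q, ∀ s : ℝ,
      cproj (shift i (hc.rep (cproj x), s)) = cproj (shift i (x, s)) := fun i x hx s =>
    hc.desc_apply inv_setV (F := fun x => cproj (shift i (x, s))) (hsa i s) (hsj i s) hx
  obtain ⟨h1, h2⟩ := iterated_suspension (X := Y (q + 1))
    (T := cproj '' setV q) (W := cproj '' setV0 q)
    (isOpen_cproj inv_setV isOpen_setV) (isOpen_cproj inv_setV0 isOpen_setV0)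
    (Set.image_mono fun x hx => hx.1) (t := fun i y => height i (hc.rep y))
    (fun i => hc.continuousOn_desc inv_setV isOpen_setV (fun z hz x _ => height_cact i hz x)
      (fun x _ => height_cconj i x) (continuousOn_height i))
    (τ := fun i p => cproj (shift i (hc.rep p.1, p.2)))
    (fun i => hc.continuousOn_desc_prod inv_setV isOpen_setV (F := fun p => cproj (shift i p))
      (fun s _ => hsa i s) (fun s _ => hsj i s)
      (continuousOn_cproj_comp (continuous_shift i).continuousOn
        fun p hp => inv_setV.sub (shift_mem_setV i hp.1 p.2)))
    (by
      rintro i _ ⟨x, hx, rfl⟩ s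
      exact ⟨_, shift_mem_setV i hx s, (hs i x hx s).symm⟩)
    (by
      rintro i _ ⟨x, hx, rfl⟩ s
      exact ⟨_, shift_mem_setV0 i hx s, (hs i x hx.1 s).symm⟩)
    (by
      rintro i j _ ⟨x, hx, rfl⟩ s
      change height j (hc.rep (cproj (shift i (hc.rep (cproj x), s)))) = _
      rw [hs i x hx s, hh j _ (shift_mem_setV i hx s), height_shift i j hx, hh j x hx])
    (by
      rintro i _ ⟨x, hx, rfl⟩
      change cproj (shift i (hc.rep (cproj x), 0)) = _
      rw [hs i x hx]
      cases i <;> simp [shift])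
    Finset.univ
  have hset : {y ∈ cproj '' setV q | ∃ i ∈ Finset.univ, height i (hc.rep y) ≠ 0} ∪
      cproj '' setV0 q = cproj '' (setV q ∩ setN q) := by
    ext y
    constructor
    · rintro (⟨⟨x, hx, rfl⟩, i, hi, hne⟩ | ⟨x, hx, rfl⟩)
      · rw [hh i x hx] at hne
        exact ⟨x, ⟨hx, (mem_setN_iff hx).2 (Or.inl ⟨i, hi, hne⟩)⟩, rfl⟩
      · exact ⟨x, ⟨hx.1, (mem_setN_iff hx.1).2 (Or.inr hx)⟩, rfl⟩
    · rintro ⟨x, ⟨hx, hN⟩, rfl⟩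
      rcases (mem_setN_iff hx).1 hN with ⟨i, hi, hne⟩ | h
      · exact Or.inl ⟨⟨x, hx, rfl⟩, i, hi, by rwa [hh i x hx]⟩
      · exact Or.inr ⟨x, h, rfl⟩
  have hcard : (Finset.univ : Finset (Option (Fin (Module.finrank ℝ (HSpace q))))).card =
      4 * q + 1 := by
    rw [Finset.card_univ, Fintype.card_option, Fintype.card_fin, Module.finrank_pi_fintype]
    simp [Quaternion.finrank_eq_four]
    ring
  rw [hset, hcard] at h1 h2
  have hex : ∀ n, Nonempty (H n (cproj '' setV q) (cproj '' (setV q ∩ setN q)) ≃ₗ[ℤ]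
      H n (cproj '' (setN q ∪ setV q)) (cproj '' setN q)) := by
    intro n
    have := excision (isOpen_cproj (q := q) inv_setV isOpen_setV)
      (isOpen_cproj inv_setN isOpen_setN) n
    rwa [← image_inter inv_setV inv_setN, ← Set.image_union, Set.union_comm] at this
  refine ⟨fun n => ?_, fun n hn => (Triv.congr (hex n)).1 (h2 n hn)⟩
  obtain ⟨e1⟩ := h1 n
  obtain ⟨e2⟩ := hex (n + (4 * q + 1))
  exact ⟨e2.symm.trans e1⟩

/-! ### The homotopy circles -/

/-- The homotopy on `ℂ^×` that normalizes a complex number. -/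
def normalize (p : ℂ × ℝ) : ℂ := ((1 - p.2 + p.2 / ‖p.1‖ : ℝ) : ℂ) * p.1

lemma normalize_ne_zero {u : ℂ} (hu : u ≠ 0) {s : ℝ} (hs : s ∈ Set.Icc (0 : ℝ) 1) :
    normalize (u, s) ≠ 0 := by
  have hu' := norm_pos_iff.2 hu
  refine mul_ne_zero (Complex.ofReal_ne_zero.2 (ne_of_gt ?_)) hu
  change 0 < 1 - s + s / ‖u‖
  rcases hs.1.eq_or_lt with h | h
  · rw [← h]
    norm_num
  · have := div_pos h hu'
    linarith [hs.2]

lemma continuousOn_normalize :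
    ContinuousOn normalize (({0}ᶜ : Set ℂ) ×ˢ Set.Icc (0 : ℝ) 1) := by
  have h : ContinuousOn (fun p : ℂ × ℝ => p.2 / ‖p.1‖) (({0}ᶜ : Set ℂ) ×ˢ Set.Icc (0 : ℝ) 1) :=
    ContinuousOn.div (by fun_prop) (by fun_prop) fun p hp => norm_ne_zero_iff.2 hp.1
  exact (Complex.continuous_ofReal.comp_continuousOn ((by fun_prop : ContinuousOn
    (fun p : ℂ × ℝ => 1 - p.2) _).add h)).mul (by fun_prop)

lemma normalize_zero (u : ℂ) : normalize (u, 0) = u := by simp [normalize]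

lemma normalize_one (u : ℂ) : normalize (u, 1) = u / ‖u‖ := by
  simp [normalize, div_eq_inv_mul]

lemma norm_unit {u : ℂ} (hu : u ≠ 0) : ‖u / (‖u‖ : ℂ)‖ = 1 := by
  rw [norm_div, Complex.norm_real, norm_norm, div_self (norm_ne_zero_iff.2 hu)]

/-- The factors by which the coordinates `a` and `b` are rescaled to the same absolute value. -/
def scale (x : Coord q) (s r : ℝ) : ℝ := 1 - s + s * ((‖x.1‖ + ‖x.2.1‖) / r)

lemma scale_cact {z : ℂ} (hz : z ≠ 0) (x : Coord q) (s r : ℝ) :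
    scale (cact z x) s (‖z‖ * r) = scale x s r := by
  simp only [scale, cact, norm_mul, ← mul_add]
  rw [mul_div_mul_left _ _ (norm_ne_zero_iff.2 hz)]

lemma scale_cconj (x : Coord q) (s r : ℝ) : scale (cconj x) s r = scale x s r := by
  simp only [scale, cconj, norm_neg, RCLike.norm_conj, add_comm ‖x.2.1‖]

lemma scale_pos {x : Coord q} (hx : x ∈ setV q) {s r : ℝ} (hs : s ∈ Set.Icc (0 : ℝ) 1)
    (hr : 0 < r) : 0 < scale x s r := by
  have h1 : 0 < ‖x.1‖ + ‖x.2.1‖ := add_pos (norm_pos_iff.2 hx.1) (norm_pos_iff.2 hx.2)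
  have h2 : 0 < (‖x.1‖ + ‖x.2.1‖) / r := div_pos h1 hr
  rw [scale]
  rcases hs.1.eq_or_lt with h | h
  · rw [← h]
    norm_num
  · have := mul_pos h h2
    linarith [hs.2]

/-- The rescaled coordinate `a`. -/
def scaleA (p : Coord q × ℝ) : ℂ := (scale p.1 p.2 ‖p.1.1‖ : ℂ) * p.1.1

/-- The rescaled coordinate `b`. -/
def scaleB (p : Coord q × ℝ) : ℂ := (scale p.1 p.2 ‖p.1.2.1‖ : ℂ) * p.1.2.1

lemma scaleA_cact {z : ℂ} (hz : z ≠ 0) (x : Coord q) (s : ℝ) :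
    scaleA (cact z x, s) = z * scaleA (x, s) := by
  have := scale_cact hz x s ‖x.1‖
  rw [← norm_mul] at this
  change (scale (cact z x) s ‖z * x.1‖ : ℂ) * (z * x.1) = z * ((scale x s ‖x.1‖ : ℂ) * x.1)
  rw [this, mul_left_comm]

lemma scaleB_cact {z : ℂ} (hz : z ≠ 0) (x : Coord q) (s : ℝ) :
    scaleB (cact z x, s) = z * scaleB (x, s) := by
  have := scale_cact hz x s ‖x.2.1‖
  rw [← norm_mul] at this
  change (scale (cact z x) s ‖z * x.2.1‖ : ℂ) * (z * x.2.1) =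
    z * ((scale x s ‖x.2.1‖ : ℂ) * x.2.1)
  rw [this, mul_left_comm]

lemma scaleA_cconj (x : Coord q) (s : ℝ) :
    scaleA (cconj x, s) = -starRingEnd ℂ (scaleB (x, s)) := by
  change (scale (cconj x) s ‖-starRingEnd ℂ x.2.1‖ : ℂ) * (-starRingEnd ℂ x.2.1) =
    -starRingEnd ℂ ((scale x s ‖x.2.1‖ : ℂ) * x.2.1)
  rw [norm_neg, RCLike.norm_conj, scale_cconj, map_mul, Complex.conj_ofReal, mul_neg]

lemma scaleB_cconj (x : Coord q) (s : ℝ) :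
    scaleB (cconj x, s) = starRingEnd ℂ (scaleA (x, s)) := by
  change (scale (cconj x) s ‖starRingEnd ℂ x.1‖ : ℂ) * (starRingEnd ℂ x.1) =
    starRingEnd ℂ ((scale x s ‖x.1‖ : ℂ) * x.1)
  rw [RCLike.norm_conj, scale_cconj, map_mul, Complex.conj_ofReal]

lemma scaleA_ne_zero {x : Coord q} (hx : x ∈ setV q) {s : ℝ} (hs : s ∈ Set.Icc (0 : ℝ) 1) :
    scaleA (x, s) ≠ 0 :=
  mul_ne_zero (Complex.ofReal_ne_zero.2 (scale_pos hx hs (norm_pos_iff.2 hx.1)).ne') hx.1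

lemma scaleB_ne_zero {x : Coord q} (hx : x ∈ setV q) {s : ℝ} (hs : s ∈ Set.Icc (0 : ℝ) 1) :
    scaleB (x, s) ≠ 0 :=
  mul_ne_zero (Complex.ofReal_ne_zero.2 (scale_pos hx hs (norm_pos_iff.2 hx.2)).ne') hx.2

lemma continuousOn_scaleA (T : Set ℝ) : ContinuousOn (scaleA (q := q)) (setV q ×ˢ T) := by
  have h : ContinuousOn (fun p : Coord q × ℝ => (‖p.1.1‖ + ‖p.1.2.1‖) / ‖p.1.1‖) (setV q ×ˢ T) :=
    ContinuousOn.div (by fun_prop) (by fun_prop) fun p hp => norm_ne_zero_iff.2 hp.1.1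
  unfold scaleA scale
  exact (Complex.continuous_ofReal.comp_continuousOn ((by fun_prop : ContinuousOn
    (fun p : Coord q × ℝ => 1 - p.2) _).add (ContinuousOn.mul (by fun_prop) h))).mul (by fun_prop)

lemma continuousOn_scaleB (T : Set ℝ) : ContinuousOn (scaleB (q := q)) (setV q ×ˢ T) := by
  have h : ContinuousOn (fun p : Coord q × ℝ => (‖p.1.1‖ + ‖p.1.2.1‖) / ‖p.1.2.1‖)
      (setV q ×ˢ T) :=
    ContinuousOn.div (by fun_prop) (by fun_prop) fun p hp => norm_ne_zero_iff.2 hp.1.2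
  unfold scaleB scale
  exact (Complex.continuous_ofReal.comp_continuousOn ((by fun_prop : ContinuousOn
    (fun p : Coord q × ℝ => 1 - p.2) _).add (ContinuousOn.mul (by fun_prop) h))).mul (by fun_prop)

lemma scaleA_zero (x : Coord q) : scaleA (x, 0) = x.1 := by simp [scaleA, scale]

lemma scaleB_zero (x : Coord q) : scaleB (x, 0) = x.2.1 := by simp [scaleB, scale]

/-- The ratio `b / a`, normalized to absolute value one. -/
def ratio (x : Coord q) : ℂ := x.2.1 / x.1 / (‖x.2.1 / x.1‖ : ℂ)

lemma ratio_cact {z : ℂ} (hz : z ≠ 0) (x : Coord q) : ratio (cact z x) = ratio x := by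
  simp only [ratio, cact, mul_div_mul_left _ _ hz]

lemma ratio_ne_zero {x : Coord q} (hx : x ∈ setV q) : ratio x ≠ 0 := by
  have h := div_ne_zero hx.2 hx.1
  exact div_ne_zero h (Complex.ofReal_ne_zero.2 (norm_ne_zero_iff.2 h))

lemma norm_ratio {x : Coord q} (hx : x ∈ setV q) : ‖ratio x‖ = 1 :=
  norm_unit (div_ne_zero hx.2 hx.1)

lemma ratio_cconj {x : Coord q} (hx : x ∈ setV q) : ratio (cconj x) = -ratio x := by
  have ha : (‖x.1‖ : ℂ) ≠ 0 := Complex.ofReal_ne_zero.2 (norm_ne_zero_iff.2 hx.1)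
  have hb : (‖x.2.1‖ : ℂ) ≠ 0 := Complex.ofReal_ne_zero.2 (norm_ne_zero_iff.2 hx.2)
  have hb' : starRingEnd ℂ x.2.1 ≠ 0 := (map_ne_zero (starRingEnd ℂ)).2 hx.2
  have h1 : starRingEnd ℂ x.1 * x.1 = (‖x.1‖ : ℂ) ^ 2 := Complex.conj_mul' x.1
  have h2 : starRingEnd ℂ x.2.1 * x.2.1 = (‖x.2.1‖ : ℂ) ^ 2 := Complex.conj_mul' x.2.1
  have ha1 := hx.1
  simp only [ratio, cconj, norm_div, norm_neg, RCLike.norm_conj, Complex.ofReal_div]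
  field_simp
  linear_combination (‖x.1‖ : ℂ) ^ 2 * h2 - (‖x.2.1‖ : ℂ) ^ 2 * h1

lemma continuousOn_ratio : ContinuousOn (ratio (q := q)) (setV q) := by
  have h : ContinuousOn (fun x : Coord q => x.2.1 / x.1) (setV q) :=
    ContinuousOn.div (by fun_prop) (by fun_prop) fun x hx => hx.1
  exact h.div (Complex.continuous_ofReal.comp_continuousOn h.norm) fun x hx =>
    Complex.ofReal_ne_zero.2 (norm_ne_zero_iff.2 (div_ne_zero hx.2 hx.1))

/-- At the end of the rescaling, the ratio of the coordinates is normalized. -/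
lemma scaleB_one {x : Coord q} (hx : x ∈ setV q) : scaleB (x, 1) = scaleA (x, 1) * ratio x := by
  have ha : (‖x.1‖ : ℂ) ≠ 0 := Complex.ofReal_ne_zero.2 (norm_ne_zero_iff.2 hx.1)
  have hb : (‖x.2.1‖ : ℂ) ≠ 0 := Complex.ofReal_ne_zero.2 (norm_ne_zero_iff.2 hx.2)
  have ha1 := hx.1
  simp only [scaleA, scaleB, scale, ratio, norm_div, Complex.ofReal_div, Complex.ofReal_add,
    sub_self, zero_add, one_mul]
  field_simp

/-- The points of the orbit space with `a = 1`, `v = 0` and `|b| = 1`. -/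
def circlePt (u c : ℂ) : Y (q + 1) := cproj (q := q) (1, u, 0, c)

lemma circlePt_neg {u : ℂ} (hu : ‖u‖ = 1) (c : ℂ) :
    circlePt (q := q) (-u) c = circlePt u (u ^ 2 * starRingEnd ℂ c) := by
  have hu0 : u ≠ 0 := norm_pos_iff.1 (hu ▸ one_pos)
  have h : u * starRingEnd ℂ u = 1 := by rw [Complex.mul_conj', hu]; simp
  rw [circlePt, ← cproj_cconj, ← cproj_cact hu0]
  simp [circlePt, cact, cconj, h]

lemma cproj_eq_circlePt {x : Coord q} (hx : x ∈ setV q) (c : ℂ) :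
    cproj (q := q) (scaleA (x, 1), scaleB (x, 1), 0, scaleA (x, 1) * scaleB (x, 1) * c) =
      circlePt (ratio x) (ratio x * c) := by
  have h := scaleA_ne_zero hx (s := 1) (by simp)
  rw [scaleB_one hx, circlePt]
  refine Eq.trans (congrArg cproj ?_) (cproj_cact h _)
  simp only [cact, mul_one, smul_zero]
  ring_nf

end Torus


section Circles

open Topology Filter RelHom

variable {q : ℕ}

/-- The deformation of `V` that rescales the coordinates `a` and `b` to the same absolute value,
contracts `v` to `0`, and moves `c / (a b)` to `σ`. -/
def squeeze (σ : Coord q → ℝ) (p : Coord q × ℝ) : Coord q :=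
  (scaleA p, scaleB p, (1 - p.2) • p.1.2.2.1, scaleA p * scaleB p *
    (((1 - p.2 : ℝ) : ℂ) * (p.1.2.2.2 / (p.1.1 * p.1.2.1)) + ((p.2 * σ p.1 : ℝ) : ℂ)))

lemma squeeze_cact {σ : Coord q → ℝ} {z : ℂ} (hz : z ≠ 0) {x : Coord q}
    (hσ : σ (cact z x) = σ x) (s : ℝ) :
    squeeze σ (cact z x, s) = cact z (squeeze σ (x, s)) := by
  simp only [squeeze, scaleA_cact hz, scaleB_cact hz, hσ, quotient_cact hz]
  refine Prod.ext rfl (Prod.ext rfl (Prod.ext ?_ ?_))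
  · exact smul_comm _ _ _
  · simp only [cact]
    ring

lemma squeeze_cconj {σ : Coord q → ℝ} {x : Coord q} (hσ : σ (cconj x) = -σ x) (s : ℝ) :
    squeeze σ (cconj x, s) = cconj (squeeze σ (x, s)) := by
  simp only [squeeze, scaleA_cconj, scaleB_cconj, hσ, quotient_cconj]
  refine Prod.ext rfl (Prod.ext rfl (Prod.ext ?_ ?_))
  · exact smul_comm _ _ _
  · simp only [cconj, map_mul, map_add, Complex.conj_ofReal, Complex.ofReal_mul, Complex.ofReal_neg]
    ring

lemma squeeze_mem_setV (σ : Coord q → ℝ) {x : Coord q} (hx : x ∈ setV q) {s : ℝ}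
    (hs : s ∈ Set.Icc (0 : ℝ) 1) : squeeze σ (x, s) ∈ setV q :=
  ⟨scaleA_ne_zero hx hs, scaleB_ne_zero hx hs⟩

lemma continuousOn_squeeze {σ : Coord q → ℝ} {P : Set (Coord q)} (hP : P ⊆ setV q)
    (hσ : ContinuousOn σ P) (T : Set ℝ) : ContinuousOn (squeeze σ) (P ×ˢ T) := by
  have hA := (continuousOn_scaleA (q := q) T).mono (Set.prod_mono hP (subset_refl T))
  have hB := (continuousOn_scaleB (q := q) T).mono (Set.prod_mono hP (subset_refl T))
  have ht : ContinuousOn (fun p : Coord q × ℝ => p.1.2.2.2 / (p.1.1 * p.1.2.1)) (P ×ˢ T) :=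
    continuousOn_quotient.comp continuousOn_fst fun p hp => hP hp.1
  have hσ' : ContinuousOn (fun p : Coord q × ℝ => σ p.1) (P ×ˢ T) :=
    hσ.comp continuousOn_fst fun p hp => hp.1
  have h1 : ContinuousOn (fun p : Coord q × ℝ => ((1 - p.2 : ℝ) : ℂ)) (P ×ˢ T) := by fun_prop
  refine hA.prodMk (hB.prodMk (ContinuousOn.prodMk (by fun_prop) ((hA.mul hB).mul
    ((h1.mul ht).add (Complex.continuous_ofReal.comp_continuousOn
      (continuousOn_snd.mul hσ'))))))

lemma squeeze_zero (σ : Coord q → ℝ) {x : Coord q} (hx : x ∈ setV q) :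
    squeeze σ (x, 0) = x := by
  simp only [squeeze, scaleA_zero, scaleB_zero, sub_zero, one_smul, Complex.ofReal_one, one_mul,
    zero_mul, Complex.ofReal_zero, add_zero]
  rw [mul_div_cancel₀ _ (mul_ne_zero hx.1 hx.2)]

lemma cproj_squeeze_one (σ : Coord q → ℝ) {x : Coord q} (hx : x ∈ setV q) :
    cproj (squeeze σ (x, 1)) = circlePt (ratio x) (ratio x * (σ x : ℂ)) := by
  rw [← cproj_eq_circlePt hx]
  simp [squeeze]

/-- The sign of the real part of `c / (a b)`. -/
def sgn (x : Coord q) : ℝ :=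
  (x.2.2.2 / (x.1 * x.2.1)).re / |(x.2.2.2 / (x.1 * x.2.1)).re|

lemma sgn_cact {z : ℂ} (hz : z ≠ 0) (x : Coord q) : sgn (cact z x) = sgn x := by
  simp only [sgn, quotient_cact hz]

lemma sgn_cconj (x : Coord q) : sgn (cconj x) = -sgn x := by
  simp only [sgn, quotient_cconj, Complex.neg_re, Complex.conj_re, abs_neg, neg_div]

lemma sgn_eq {x : Coord q} (hx : x ∈ setV0 q) : sgn x = 1 ∨ sgn x = -1 := by
  rcases lt_or_gt_of_ne hx.2 with h | h
  · right
    rw [sgn, abs_of_neg h, div_neg, div_self h.ne]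
  · left
    rw [sgn, abs_of_pos h, div_self h.ne']

lemma continuousOn_sgn : ContinuousOn (sgn (q := q)) (setV0 q) := by
  have h : ContinuousOn (fun x : Coord q => (x.2.2.2 / (x.1 * x.2.1)).re) (setV0 q) :=
    (Complex.continuous_re.comp_continuousOn continuousOn_quotient).mono fun x hx => hx.1
  exact h.div h.abs fun x hx => abs_ne_zero.2 hx.2

lemma squeeze_mem_setV0 {x : Coord q} (hx : x ∈ setV0 q) {s : ℝ} (hs : s ∈ Set.Icc (0 : ℝ) 1) :
    squeeze sgn (x, s) ∈ setV0 q := by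
  refine ⟨squeeze_mem_setV _ hx.1 hs, ?_⟩
  have h := mul_ne_zero (scaleA_ne_zero hx.1 hs) (scaleB_ne_zero hx.1 hs)
  simp only [squeeze]
  rw [mul_div_cancel_left₀ _ h, Complex.add_re, Complex.re_ofReal_mul, Complex.ofReal_re]
  have h1 := hx.2
  -- the real part stays a positive multiple of itself
  have h2 : (1 - s) * (x.2.2.2 / (x.1 * x.2.1)).re + s * sgn x =
      (1 - s + s / |(x.2.2.2 / (x.1 * x.2.1)).re|) * (x.2.2.2 / (x.1 * x.2.1)).re := by
    rw [sgn]
    ring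
  rw [h2]
  refine mul_ne_zero (ne_of_gt ?_) h1
  have h3 := abs_pos.2 h1
  rcases hs.1.eq_or_lt with h | h
  · rw [← h]
    norm_num
  · have := div_pos h h3
    linarith [hs.2]

/-- A square root of a complex number. -/
def root (u : ℂ) : ℂ := (IsAlgClosed.exists_pow_nat_eq u two_pos).choose

lemma root_sq (u : ℂ) : root u ^ 2 = u := (IsAlgClosed.exists_pow_nat_eq u two_pos).choose_spec

lemma circlePt_root (u : ℂ) (hu : u ≠ 0) :
    circlePt (q := q) (root (u ^ 2) / ‖root (u ^ 2)‖) 0 = circlePt (u / ‖u‖) 0 := by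
  rcases sq_eq_sq_iff_eq_or_eq_neg.1 (root_sq (u ^ 2)) with h | h
  · rw [h]
  · rw [h, norm_neg, neg_div, circlePt_neg (norm_unit hu), map_zero, mul_zero]

lemma continuousOn_circlePt {f g : ℂ → ℂ} {S : Set ℂ} (hf : ContinuousOn f S)
    (hg : ContinuousOn g S) : ContinuousOn (fun u => circlePt (q := q) (f u) (g u)) S :=
  continuousOn_cproj_comp (by fun_prop) fun _ _ h => one_ne_zero (congrArg Prod.fst h)

lemma continuousOn_unit : ContinuousOn (fun u : ℂ => u / (‖u‖ : ℂ)) {0}ᶜ :=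
  ContinuousOn.div (by fun_prop) (by fun_prop) fun _ hu =>
    Complex.ofReal_ne_zero.2 (norm_ne_zero_iff.2 hu)

lemma continuousOn_circlePt_root :
    ContinuousOn (fun u => circlePt (q := q) (root u / ‖root u‖) 0) {0}ᶜ := by
  intro u hu
  have hr : root u ≠ 0 := by
    intro h
    have := root_sq u
    rw [h, zero_pow two_ne_zero] at this
    exact hu this.symm
  have hmap : map (fun z : ℂ => z ^ 2) (𝓝 (root u)) = 𝓝 (root u ^ 2) := by
    have h : HasStrictDerivAt (fun z : ℂ => z ^ 2) (2 * root u) (root u) := by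
      simpa using hasStrictDerivAt_pow 2 (root u)
    exact h.map_nhds_eq (mul_ne_zero two_ne_zero hr)
  rw [root_sq] at hmap
  refine ContinuousAt.continuousWithinAt ?_
  rw [ContinuousAt, ← hmap, tendsto_map'_iff]
  have h1 : ContinuousAt (fun z : ℂ => circlePt (q := q) (z / ‖z‖) 0) (root u) :=
    (continuousOn_circlePt continuousOn_unit continuousOn_const).continuousAt
      (isOpen_compl_singleton.mem_nhds hr)
  refine h1.tendsto.congr' ?_
  filter_upwards [isOpen_compl_singleton.mem_nhds hr] with z hz
  exact (circlePt_root z hz).symm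

lemma circlePt_mem {P : Set (Coord q)} {u c : ℂ} (h : ((1, u, 0, c) : Coord q) ∈ P) :
    circlePt u c ∈ cproj '' P := ⟨_, h, rfl⟩

/-- The homotopy equivalence of the punctured plane with `V0`. -/
def circleEquivV0 (q : ℕ) : HEquiv ({0}ᶜ : Set ℂ) ∅ (cproj '' setV0 q) ∅ :=
  have hc := isOrbitMap_cproj q
  have hsub : setV0 q ⊆ setV q := fun _ hx => hx.1
  have ha : ∀ z ≠ 0, ∀ x ∈ setV0 q, (sgn (cact z x) : ℂ) * ratio (cact z x) = sgn x * ratio x :=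
    fun z hz x _ => by rw [sgn_cact hz, ratio_cact hz]
  have hj : ∀ x ∈ setV0 q, (sgn (cconj x) : ℂ) * ratio (cconj x) = sgn x * ratio x :=
    fun x hx => by rw [sgn_cconj, ratio_cconj hx.1, Complex.ofReal_neg, neg_mul_neg]
  have hf : ∀ x ∈ setV0 q, (fun x => (sgn x : ℂ) * ratio x) (hc.rep (cproj x)) =
    sgn x * ratio x := fun x hx =>
    hc.desc_apply inv_setV0 (F := fun x => (sgn x : ℂ) * ratio x) ha hj hx
  have hka : ∀ s : ℝ, ∀ z ≠ 0, ∀ x ∈ setV0 q, cproj (squeeze sgn (cact z x, s)) =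
    cproj (squeeze sgn (x, s)) := fun s z hz x _ => by
      rw [squeeze_cact hz (sgn_cact hz x), cproj_cact hz]
  have hkj : ∀ s : ℝ, ∀ x ∈ setV0 q, cproj (squeeze sgn (cconj x, s)) =
    cproj (squeeze sgn (x, s)) := fun s x _ => by
      rw [squeeze_cconj (sgn_cconj x), cproj_cconj]
  have hk : ∀ s, ∀ x ∈ setV0 q, cproj (squeeze sgn (hc.rep (cproj x), s)) =
    cproj (squeeze sgn (x, s)) := fun s x hx =>
      hc.desc_apply inv_setV0 (F := fun x => cproj (squeeze sgn (x, s))) (hka s) (hkj s) hx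
  have hs0 : ∀ x ∈ setV0 q, (sgn x : ℂ) ≠ 0 := fun x hx => by
    rcases sgn_eq hx with h | h <;> rw [h] <;> norm_num
  have hmem : ∀ u : ℂ, u ≠ 0 → ((1, u / ‖u‖, 0, u / ‖u‖) : Coord q) ∈ setV0 q := fun u hu => by
    have h : u / (‖u‖ : ℂ) ≠ 0 :=
      div_ne_zero hu (Complex.ofReal_ne_zero.2 (norm_ne_zero_iff.2 hu))
    refine ⟨⟨one_ne_zero, h⟩, ?_⟩
    change (u / (‖u‖ : ℂ) / (1 * (u / (‖u‖ : ℂ)))).re ≠ 0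
    rw [one_mul, div_self h]
    norm_num
  HEquiv.ofHomotopies (fun u => circlePt (u / ‖u‖) (u / ‖u‖))
    (fun y => (fun x => (sgn x : ℂ) * ratio x) (hc.rep y))
    (continuousOn_circlePt continuousOn_unit continuousOn_unit)
    (hc.continuousOn_desc inv_setV0 isOpen_setV0 ha hj
      ((Complex.continuous_ofReal.comp_continuousOn continuousOn_sgn).mul
        (continuousOn_ratio.mono hsub)))
    (fun u hu => circlePt_mem (hmem u hu))
    (by
      rintro _ ⟨x, hx, rfl⟩
      change (fun x => (sgn x : ℂ) * ratio x) (hc.rep (cproj x)) ≠ 0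
      rw [hf x hx]
      exact mul_ne_zero (hs0 x hx) (ratio_ne_zero hx.1))
    normalize continuousOn_normalize (fun p hp => normalize_ne_zero hp.1 hp.2)
    (fun u _ => normalize_zero u)
    (fun u hu => by
      rw [normalize_one]
      refine Eq.trans ?_ (hf _ (hmem u hu)).symm
      have h : u / (‖u‖ : ℂ) ≠ 0 :=
        div_ne_zero hu (Complex.ofReal_ne_zero.2 (norm_ne_zero_iff.2 hu))
      simp only [sgn, ratio, one_mul, div_one, div_self h, norm_unit hu]
      simp)
    (fun p => cproj (squeeze sgn (hc.rep p.1, p.2)))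
    (hc.continuousOn_desc_prod inv_setV0 isOpen_setV0 (F := fun p => cproj (squeeze sgn p))
      (fun s _ => hka s) (fun s _ => hkj s)
      (continuousOn_cproj_comp (continuousOn_squeeze hsub continuousOn_sgn _)
        fun p hp => inv_setV0.sub (squeeze_mem_setV0 hp.1 hp.2)))
    (by
      rintro ⟨_, s⟩ ⟨⟨x, hx, rfl⟩, hs⟩
      exact ⟨_, squeeze_mem_setV0 hx hs, (hk s x hx).symm⟩)
    (by
      rintro _ ⟨x, hx, rfl⟩
      change cproj (squeeze sgn (hc.rep (cproj x), 0)) = _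
      rw [hk 0 x hx, squeeze_zero _ hx.1])
    (by
      rintro _ ⟨x, hx, rfl⟩
      change cproj (squeeze sgn (hc.rep (cproj x), 1)) = _
      rw [hk 1 x hx, cproj_squeeze_one _ hx.1]
      simp only [show (sgn (hc.rep (cproj x)) : ℂ) * ratio (hc.rep (cproj x)) =
        sgn x * ratio x from hf x hx]
      have hn := norm_ratio hx.1
      have hr : starRingEnd ℂ (ratio x) * ratio x = 1 := by rw [Complex.conj_mul', hn]; simp
      rcases sgn_eq hx with h | h
      · rw [h]
        simp [hn]
      · rw [h]
        simp only [Complex.ofReal_neg, Complex.ofReal_one, neg_mul, one_mul, norm_neg, hn, div_one,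
          mul_neg, mul_one]
        rw [circlePt_neg hn, map_neg]
        congr 1
        linear_combination ratio x * hr)

/-- The homotopy equivalence of `V` with the punctured plane. -/
def circleEquivV (q : ℕ) : HEquiv (cproj '' setV q) ∅ ({0}ᶜ : Set ℂ) ∅ :=
  have hc := isOrbitMap_cproj q
  have ha : ∀ z ≠ 0, ∀ x ∈ setV q, ratio (cact z x) ^ 2 = ratio x ^ 2 :=
    fun z hz x _ => by rw [ratio_cact hz]
  have hj : ∀ x ∈ setV q, ratio (cconj x) ^ 2 = ratio x ^ 2 :=
    fun x hx => by rw [ratio_cconj hx, neg_sq]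
  have hf : ∀ x ∈ setV q, (fun x => ratio x ^ 2) (hc.rep (cproj x)) = ratio x ^ 2 :=
    fun x hx => hc.desc_apply inv_setV (F := fun x => ratio x ^ 2) ha hj hx
  have hka : ∀ s : ℝ, ∀ z ≠ 0, ∀ x ∈ setV q, cproj (squeeze 0 (cact z x, s)) =
    cproj (squeeze 0 (x, s)) := fun s z hz x _ => by
      rw [squeeze_cact hz rfl, cproj_cact hz]
  have hkj : ∀ s : ℝ, ∀ x ∈ setV q, cproj (squeeze 0 (cconj x, s)) =
    cproj (squeeze 0 (x, s)) := fun s x _ => by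
      rw [squeeze_cconj (by simp), cproj_cconj]
  have hk : ∀ s, ∀ x ∈ setV q, cproj (squeeze 0 (hc.rep (cproj x), s)) =
    cproj (squeeze 0 (x, s)) := fun s x hx =>
      hc.desc_apply inv_setV (F := fun x => cproj (squeeze 0 (x, s))) (hka s) (hkj s) hx
  have hroot : ∀ u : ℂ, u ≠ 0 → root u / (‖root u‖ : ℂ) ≠ 0 := fun u hu => by
    have hr : root u ≠ 0 := by
      intro h
      have := root_sq u
      rw [h, zero_pow two_ne_zero] at this
      exact hu this.symm
    exact div_ne_zero hr (Complex.ofReal_ne_zero.2 (norm_ne_zero_iff.2 hr))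
  have hmem : ∀ u : ℂ, u ≠ 0 → ((1, root u / ‖root u‖, 0, 0) : Coord q) ∈ setV q :=
    fun u hu => ⟨one_ne_zero, hroot u hu⟩
  HEquiv.ofHomotopies (fun y => (fun x => ratio x ^ 2) (hc.rep y))
    (fun u => circlePt (root u / ‖root u‖) 0)
    (hc.continuousOn_desc inv_setV isOpen_setV ha hj (continuousOn_ratio.pow 2))
    continuousOn_circlePt_root
    (by
      rintro _ ⟨x, hx, rfl⟩
      change (fun x => ratio x ^ 2) (hc.rep (cproj x)) ≠ 0
      rw [hf x hx]
      exact pow_ne_zero 2 (ratio_ne_zero hx))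
    (fun u hu => circlePt_mem (hmem u hu))
    (fun p => cproj (squeeze 0 (hc.rep p.1, p.2)))
    (hc.continuousOn_desc_prod inv_setV isOpen_setV (F := fun p => cproj (squeeze 0 p))
      (fun s _ => hka s) (fun s _ => hkj s)
      (continuousOn_cproj_comp (continuousOn_squeeze subset_rfl continuousOn_const _)
        fun p hp => inv_setV.sub (squeeze_mem_setV 0 hp.1 hp.2)))
    (by
      rintro ⟨_, s⟩ ⟨⟨x, hx, rfl⟩, hs⟩
      exact ⟨_, squeeze_mem_setV 0 hx hs, (hk s x hx).symm⟩)
    (by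
      rintro _ ⟨x, hx, rfl⟩
      change cproj (squeeze 0 (hc.rep (cproj x), 0)) = _
      rw [hk 0 x hx, squeeze_zero _ hx])
    (by
      rintro _ ⟨x, hx, rfl⟩
      change cproj (squeeze 0 (hc.rep (cproj x), 1)) = _
      rw [hk 1 x hx, cproj_squeeze_one _ hx]
      simp only [show ratio (hc.rep (cproj x)) ^ 2 = ratio x ^ 2 from hf x hx]
      rw [circlePt_root _ (ratio_ne_zero hx), norm_ratio hx]
      simp)
    normalize continuousOn_normalize (fun p hp => normalize_ne_zero hp.1 hp.2)
    (fun u _ => normalize_zero u)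
    (fun u hu => by
      rw [normalize_one]
      refine Eq.trans ?_ (hf _ (hmem u hu)).symm
      have hn : ‖root u‖ ^ 2 = ‖u‖ := by rw [← norm_pow, root_sq]
      have hr : root u ≠ 0 := by
        intro h
        have := root_sq u
        rw [h, zero_pow two_ne_zero] at this
        exact hu this.symm
      simp only [ratio, div_one, norm_unit hr]
      rw [Complex.ofReal_one, div_one, div_pow, root_sq, ← Complex.ofReal_pow, hn])

/-- The homology of the pair `(V, V0)`. -/
theorem homology_V_V0 (q : ℕ) :
    Nonempty (H 1 (cproj '' setV q) (cproj '' setV0 q) ≃ₗ[ℤ] ZMod 2) ∧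
      ∀ n ≠ 1, Triv n (cproj '' setV q) (cproj '' setV0 q) := by
  refine homology_of_squaring (Set.image_mono fun x hx => hx.1) (circleEquivV0 q)
    (circleEquivV q) fun u hu => ?_
  have h : u / (‖u‖ : ℂ) ≠ 0 := div_ne_zero hu (Complex.ofReal_ne_zero.2 (norm_ne_zero_iff.2 hu))
  have h1 := (isOrbitMap_cproj q).desc_apply inv_setV (F := fun x => ratio x ^ 2)
    (fun z hz x _ => by rw [ratio_cact hz]) (fun x hx => by rw [ratio_cconj hx, neg_sq])
    (x := (1, u / ‖u‖, 0, u / ‖u‖)) ⟨one_ne_zero, h⟩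
  refine Eq.trans h1 ?_
  simp only [ratio, div_one, norm_unit hu, Complex.ofReal_one]

/-- The homology of the orbit space without the added point, relative to `N`. -/
theorem homology_compl_rel (q n : ℕ) :
    (n = 4 * q + 2 →
      Nonempty (H n (cproj '' (setN q ∪ setV q)) (cproj '' setN q) ≃ₗ[ℤ] ZMod 2)) ∧
      (n ≠ 4 * q + 2 → Triv n (cproj '' (setN q ∪ setV q)) (cproj '' setN q)) := by
  obtain ⟨h1, h2⟩ := equiv_suspension q
  obtain ⟨⟨e⟩, h3⟩ := homology_V_V0 q
  refine ⟨?_, fun hn => ?_⟩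
  · rintro rfl
    obtain ⟨e'⟩ := h1 1
    rw [show 1 + (4 * q + 1) = 4 * q + 2 by ring] at e'
    exact ⟨e'.trans e⟩
  · rcases lt_or_ge n (4 * q + 1) with h | h
    · exact h2 n h
    · obtain ⟨m, rfl⟩ := Nat.exists_eq_add_of_le' h
      exact (Triv.congr (h1 m)).2 (h3 m (by omega))

/-! ### Induction on the dimension -/

/-- The orbit space for `q = 0` is a point. -/
lemma homology_zero : Nonempty (H 0 (Set.univ : Set (Y 0)) ∅ ≃ₗ[ℤ] ℤ) ∧
    ∀ n, Triv (n + 1) (Set.univ : Set (Y 0)) ∅ := by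
  have hsub : ∀ y y' : Y 0, y = y' := by
    have key : ∀ y : Y 0, y = mkY OnePoint.infty := by
      intro y
      obtain ⟨⟨v, c⟩, -, rfl⟩ := exists_proj_eq y
      rw [Subsingleton.elim v 0, proj_zero]
    intro y y'
    rw [key y, key y']
  exact contractible_homology (p := mkY OnePoint.infty) trivial (k := Prod.fst) continuousOn_fst
    (Set.mapsTo_univ _ _) (fun _ _ => rfl) (fun x _ => hsub _ _)

/-- The homology of the orbit space, as relative homology of a pair of subsets. The inductive step
consists of the long exact sequences of `∅ ⊆ N ⊆ N ∪ V ⊆ Y (q + 1)`. -/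
theorem homology_orbit_space (q n : ℕ) :
    (n % 4 = 0 ∧ n ≤ 4 * q → Nonempty (H n (Set.univ : Set (Y q)) ∅ ≃ₗ[ℤ] ℤ)) ∧
    (n % 4 = 2 ∧ n + 2 ≤ 4 * q → Nonempty (H n (Set.univ : Set (Y q)) ∅ ≃ₗ[ℤ] ZMod 2)) ∧
    (¬ (n % 4 = 0 ∧ n ≤ 4 * q) ∧ ¬ (n % 4 = 2 ∧ n + 2 ≤ 4 * q) →
      Triv n (Set.univ : Set (Y q)) ∅) := by
  induction q generalizing n with
  | zero =>
    obtain ⟨h1, h2⟩ := homology_zero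
    refine ⟨fun hn => ?_, fun hn => by omega, fun hn => ?_⟩
    · obtain rfl : n = 0 := by omega
      exact h1
    · obtain ⟨m, rfl⟩ : ∃ m, n = m + 1 := ⟨n - 1, by omega⟩
      exact h2 m
  | succ q ih =>
    set C : Set (Y (q + 1)) := cproj '' (setN q ∪ setV q) with hC
    set N : Set (Y (q + 1)) := cproj '' setN q with hN
    have hNC : N ⊆ C := Set.image_mono Set.subset_union_left
    -- the vanishing for `N`, from the induction hypothesis
    have hTN : ∀ m, 4 * q < m → Triv m N ∅ := fun m hm =>
      (Triv.congr (equiv_setN q m)).1 ((ih m).2.2 ⟨by omega, by omega⟩)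
    have hCN := homology_compl_rel q
    have hYC := homology_rel_compl q
    have hTC : Triv (4 * q + 3) C ∅ := triv_of_triv hNC (hTN _ (by omega))
      ((hCN _).2 (by omega)) (Set.empty_subset _)
    have hTC4 : Triv (4 * q + 4) C ∅ := triv_of_triv hNC (hTN _ (by omega))
      ((hCN _).2 (by omega)) (Set.empty_subset _)
    by_cases h4 : n = 4 * q + 4
    · subst h4
      obtain ⟨e⟩ := (hYC (4 * q + 4)).1 rfl
      obtain ⟨e'⟩ := equiv_quot (Set.subset_univ C) hTC4 (fun m hm => by
        obtain rfl : m = 4 * q + 3 := by omega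
        exact hTC) (Set.empty_subset _)
      exact ⟨fun _ => ⟨e'.trans e⟩, fun h => by omega, fun h => by omega⟩
    by_cases h3 : n = 4 * q + 3
    · subst h3
      have hT := triv_of_triv (Set.subset_univ C) hTC ((hYC _).2 h4) (Set.empty_subset _)
      exact ⟨fun h => by omega, fun h => by omega, fun _ => hT⟩
    -- in the remaining degrees the homology is that of the complement of the added point
    obtain ⟨e1⟩ := equiv_sub (Set.subset_univ C) ((hYC n).2 h4) ((hYC (n + 1)).2 (by omega))
      (Set.empty_subset _)
    by_cases h2 : n = 4 * q + 2
    · subst h2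
      obtain ⟨e⟩ := (hCN (4 * q + 2)).1 rfl
      obtain ⟨e'⟩ := equiv_quot hNC (hTN (4 * q + 2) (by omega)) (fun m hm => hTN m (by omega))
        (Set.empty_subset _)
      exact ⟨fun h => by omega, fun _ => ⟨e1.symm.trans (e'.trans e)⟩, fun h => by omega⟩
    by_cases h1 : n = 4 * q + 1
    · subst h1
      have hT := triv_of_triv hNC (hTN _ (by omega)) ((hCN _).2 h2) (Set.empty_subset _)
      exact ⟨fun h => by omega, fun h => by omega, fun _ => (Triv.congr ⟨e1⟩).1 hT⟩
    obtain ⟨e2⟩ := equiv_sub hNC ((hCN n).2 h2) ((hCN (n + 1)).2 (by omega)) (Set.empty_subset _)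
    obtain ⟨e3⟩ := equiv_setN q n
    have e := e1.symm.trans (e2.symm.trans e3.symm)
    obtain ⟨i1, i2, i3⟩ := ih n
    refine ⟨fun h => ?_, fun h => ?_, fun h => (Triv.congr ⟨e⟩).2 (i3 ⟨by omega, by omega⟩)⟩
    · obtain ⟨e4⟩ := i1 ⟨h.1, by omega⟩
      exact ⟨e.trans e4⟩
    · obtain ⟨e4⟩ := i2 ⟨h.1, by omega⟩
      exact ⟨e.trans e4⟩

end Circles

end QuatThom

end

theorem proposition6p5 (q n : ℕ) :
    (n % 4 = 0 ∧ n ≤ 4 * q →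
      Nonempty (QuatThom.integralHomology n (QuatThom.Y q) ≃ₗ[ℤ] ℤ)) ∧
    (n % 4 = 2 ∧ n + 2 ≤ 4 * q →
      Nonempty (QuatThom.integralHomology n (QuatThom.Y q) ≃ₗ[ℤ] ZMod 2)) ∧
    (¬ (n % 4 = 0 ∧ n ≤ 4 * q) ∧ ¬ (n % 4 = 2 ∧ n + 2 ≤ 4 * q) →
      Subsingleton (QuatThom.integralHomology n (QuatThom.Y q))) := by
  obtain ⟨e⟩ := RelHom.nonempty_equiv_integralHomology (X := QuatThom.Y q) n
  obtain ⟨h1, h2, h3⟩ := QuatThom.homology_orbit_space q n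
  refine ⟨fun h => ?_, fun h => ?_, fun h => ?_⟩
  · obtain ⟨e'⟩ := h1 h
    exact ⟨e.trans e'⟩
  · obtain ⟨e'⟩ := h2 h
    exact ⟨e.trans e'⟩
  · exact e.toEquiv.subsingleton_congr.2 (RelHom.triv_iff.1 (h3 h))
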